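/- Let $0\le k<n$ be integers. Let $\Lambda^k(\mathbb R^n)$ be the space of $k$-vectors with the inner product determined by $(\mathbf u_1\wedge\dots\wedge \mathbf u_k)\cdot(\mathbf v_1\wedge\dots\wedge \mathbf v_k)=\det(\mathbf u_i\cdot \mathbf v_j)_{i,j}$, and let $\hat\Lambda^k_u(\mathbb R^n)$ be the set of simple $k$-vectors $\boldsymbol\omega=\mathbf v_1\wedge\dots\wedge\mathbf v_k$ with $|\boldsymbol\omega|=1$; for such $\boldsymbol\omega$ let $[\boldsymbol\omega]$ be the span of $\mathbf v_1,\dots,\mathbf v_k$. (For $k=0$: $\Lambda^0(\mathbb R^n)=\mathbb R$, $\hat\Lambda^0_u(\mathbb R^n)=\{-1,1\}$ and $[\pm1]=\{\mathbf 0\}$.) Put $$\mathcal W=\{(\mathbf a,\boldsymbol\omega)\in\mathbb R^n\times\hat\Lambda^k_u(\mathbb R^n): |\mathbf a|=1,\ \mathbf a\in[\boldsymbol\omega]^\perp\}\subset \mathbb R^n\times\Lambda^k(\mathbb R^n),$$ where the product carries the Euclidean product metric, and let $m=n-1+k(n-k-1)$. Then $\mathcal W$ has Hausdorff dimension $m$,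 and for every $\boldsymbol\nu\in\hat\Lambda^k_u(\mathbb R^n)$ the function $(\mathbf a,\boldsymbol\omega)\mapsto|\boldsymbol\nu\cdot\boldsymbol\omega|$ is $\mathcal H^m$-integrable on $\mathcal W$ with $$\int_{\mathcal W}|\boldsymbol\nu\cdot\boldsymbol\omega|\,d\mathcal H^m(\mathbf a,\boldsymbol\omega)=\frac{2^{\frac{k+4}{2}}\,\pi^{\frac{(n+2)(k+1)}{2}}\,\Gamma\left(\frac{n-k+1}{2}\right)}{\sqrt\pi\,\Gamma\left(\frac{n+1}{2}\right)}\prod_{i=1}^{k+1}\frac{\Gamma\left(\frac i2\right)}{\pi^i\,\Gamma\left(\frac{n-i+1}{2}\right)}.$$ Here $\mathcal H^m$ is the $m$-dimensional Hausdorff measure normalized so that on $\mathbb R^m$ it equals Lebesgue measure. -/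

import Mathlib

noncomputable section

/-- Euclidean space `ℝⁿ`. -/
abbrev EucSpace (n : ℕ) : Type := EuclideanSpace ℝ (Fin n)

/-- The space `Λᵏ(ℝⁿ)` of `k`-vectors, with Mathlib's inner product, which on simple `k`-vectors is
`(u₁ ∧ ⋯ ∧ uₖ) · (v₁ ∧ ⋯ ∧ vₖ) = det (uᵢ · vⱼ)`. -/
abbrev KVec (n k : ℕ) : Type := ⋀[ℝ]^k (EucSpace n)

instance instMeasurableSpaceKVec (n k : ℕ) : MeasurableSpace (KVec n k) := borel _

instance instBorelSpaceKVec (n k : ℕ) : BorelSpace (KVec n k) := ⟨rfl⟩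

/-- The wedge product `v₁ ∧ ⋯ ∧ vₖ`. -/
abbrev wedge {n k : ℕ} (v : Fin k → EucSpace n) : KVec n k := exteriorPower.ιMulti ℝ k v

/-- `ω` is a simple `k`-vector: `ω = c (v₁ ∧ ⋯ ∧ vₖ)`.  For `k ≥ 1` the scalar `c` can be absorbed
into `v₁`; for `k = 0` the empty wedge is `1`, so that all numbers are simple `0`-vectors. -/
def IsSimpleKVec {n k : ℕ} (ω : KVec n k) : Prop :=
  ∃ (c : ℝ) (v : Fin k → EucSpace n), ω = c • wedge v

/-- The set of unit simple `k`-vectors of `ℝⁿ`. -/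
def unitSimple (n k : ℕ) : Set (KVec n k) := {ω | IsSimpleKVec ω ∧ ‖ω‖ = 1}

/-- The subspace `[ω]` of `ℝⁿ` spanned by `v₁, …, vₖ` when `ω = c (v₁ ∧ ⋯ ∧ vₖ)`.  For `ω ≠ 0` all
these representations span the same subspace (`kSpan_smul_wedge`); the infimum selects it. -/
def kSpan {n k : ℕ} (ω : KVec n k) : Submodule ℝ (EucSpace n) :=
  sInf {S | ∃ (c : ℝ) (v : Fin k → EucSpace n),
    ω = c • wedge v ∧ S = Submodule.span ℝ (Set.range v)}

theorem span_le_of_smul_wedge_eq {n k : ℕ} {c d : ℝ} {v w : Fin k → EucSpace n}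
    (h0 : c • wedge v ≠ 0) (h : c • wedge v = d • wedge w) :
    Submodule.span ℝ (Set.range v) ≤ Submodule.span ℝ (Set.range w) := by
  have hd : d ≠ 0 := by
    rintro rfl
    exact h0 (by rw [h, zero_smul])
  have hw0 : wedge w ≠ 0 := fun h' => h0 (by rw [h, h', smul_zero])
  have hw : LinearIndependent ℝ w := by
    apply Matrix.linearIndependent_of_det_gram_ne_zero (𝕜 := ℝ)
    rw [← exteriorPower.inner_ιMulti_self]
    exact inner_self_ne_zero.mpr hw0
  rw [Submodule.span_le]
  rintro _ ⟨i, rfl⟩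
  by_contra hi
  have hcons : LinearIndependent ℝ (Fin.cons (v i) w : Fin (k + 1) → EucSpace n) :=
    linearIndependent_finCons.mpr ⟨hw, hi⟩
  have hne : wedge (Fin.cons (v i) w : Fin (k + 1) → EucSpace n) ≠ 0 := by
    rw [← inner_self_ne_zero (𝕜 := ℝ), exteriorPower.inner_ιMulti_self]
    exact Matrix.det_gram_ne_zero_iff_linearIndependent.mpr hcons
  have hcw : ∀ u : Fin k → EucSpace n,
      ((wedge (Fin.cons (v i) u : Fin (k + 1) → EucSpace n) : KVec n (k + 1)) :
        ExteriorAlgebra ℝ (EucSpace n))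
        = ExteriorAlgebra.ι ℝ (v i) * ((wedge u : KVec n k) : ExteriorAlgebra ℝ (EucSpace n)) := by
    intro u
    simp only [wedge, exteriorPower.ιMulti_apply_coe, ExteriorAlgebra.ιMulti_succ_apply]
    simp [Matrix.vecTail, Function.comp_def]
  have hv : wedge (Fin.cons (v i) v : Fin (k + 1) → EucSpace n) = 0 :=
    (exteriorPower.ιMulti ℝ (k + 1)).map_eq_zero_of_eq _ (i := 0) (j := i.succ) (by simp)
      (Fin.succ_ne_zero i).symm
  apply hne
  have h1 : d • ((wedge (Fin.cons (v i) w : Fin (k + 1) → EucSpace n) : KVec n (k + 1)) :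
      ExteriorAlgebra ℝ (EucSpace n)) = 0 := by
    have h2 : (c • ((wedge v : KVec n k) : ExteriorAlgebra ℝ (EucSpace n)))
        = d • ((wedge w : KVec n k) : ExteriorAlgebra ℝ (EucSpace n)) := congrArg Subtype.val h
    rw [hcw, ← mul_smul_comm, ← h2, mul_smul_comm, ← hcw, hv]
    simp
  have h3 := (smul_eq_zero.mp h1).resolve_left hd
  exact Subtype.ext h3

/-- `[c (v₁ ∧ ⋯ ∧ vₖ)]` is the span of `v₁, …, vₖ`, whenever this `k`-vector is nonzero. -/
theorem kSpan_smul_wedge {n k : ℕ} {c : ℝ} {v : Fin k → EucSpace n} (h0 : c • wedge v ≠ 0) :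
    kSpan (c • wedge v) = Submodule.span ℝ (Set.range v) := by
  apply le_antisymm
  · exact sInf_le ⟨c, v, rfl, rfl⟩
  · refine le_sInf ?_
    rintro _ ⟨d, w, h, rfl⟩
    exact span_le_of_smul_wedge_eq h0 h

/-- The set `𝒲` of pairs `(a, ω)`, where `a` is a unit vector and `ω` is a unit simple `k`-vector
with `a ∈ [ω]ᗮ`, as a subset of `ℝⁿ × Λᵏ(ℝⁿ)` with the Euclidean product metric. -/
def setW (n k : ℕ) : Set (WithLp 2 (EucSpace n × KVec n k)) :=
  {p | ‖p.fst‖ = 1 ∧ p.snd ∈ unitSimple n k ∧ p.fst ∈ (kSpan p.snd)ᗮ}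

end

open MeasureTheory

/-!
The group of linear isometries of `ℝⁿ`, together with the orientation reversal `ω ↦ -ω`, acts
transitively on `𝒲` by isometries of the ambient space.  Hence averages over `𝒲` can be compared
with averages over Gaussian frames `(v₁, …, vₖ, g)`, each of which determines a flag `flagOf` in
`𝒲`, by interchanging two integrals.

* For the function `|ν · ω|` this gives (`setLIntegral_inner_mul`)
  `E ‖v₁ ∧ ⋯ ∧ vₖ‖ · ∫ |ν · ω| = ℋᵐ(𝒲) · E |ν · (v₁ ∧ ⋯ ∧ vₖ)|`, and both expectations are products
  of moments of Gaussian vectors (`lintegral_norm_wedge_pow`); the second one is the mean absolute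
  value of a Gaussian `k × k` determinant.
* For the indicator function of a small ball `B` around a point of `𝒲` it gives
  (`measure_mul_flagWeight`) `ℋᵐ(𝒲) · P(flag ∈ B) = 2 ℋᵐ(𝒲 ∩ B)`, where the orientation reversal
  is counted in `P`, which is the reason for the factor `2`.

The second identity determines `ℋᵐ(𝒲)`.  Write `n = k + (d + 1)`, and describe the flags near that
of the standard basis by the `k`-plane's being the graph of a linear map `Z : ℝᵏ → ℝᵈ⁺¹`, and by the
vector's lying over `(1, c)` with `c ∈ ℝᵈ` (`flagChart`).  The derivative of this chart at the
origin multiplies volumes by `2^{k/2}`: the `k` entries of `Z` in the direction of the base vector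
move both `a` and `ω`, and therefore count with a factor `√2`
(`norm_chartDeriv_sq`, `exists_nhds_euclideanHausdorffMeasure_flagChart`).  On the other side, a
frame is given by `(Z, c)`, by a `k × k` matrix `X`, and by the components `x` and `τ` of its last
vector along and across the graph; the Jacobian is `|det X|^{d+1} |τ|^d` times a factor close to
`1` (`lintegral_frame`).  So the Gaussian weight of `B` is nearly the volume of `B` in the chart
times an explicit constant (`flagWeight_le`, `flagWeight_ge`).  Letting `B` shrink gives `ℋᵐ(𝒲)`
(`toReal_measure_setW_mul`), in particular that it is positive and finite, so that the dimension is
`m`.  What remains is an identity between values of the Gamma function (`measure_mul_moments_eq`).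
-/

/-! ### Wedge products -/

theorem inner_wedge {n k : ℕ} (v w : Fin k → EucSpace n) :
    inner ℝ (wedge v) (wedge w) = (Matrix.of fun i j => (inner ℝ (v i) (w j) : ℝ)).det := by
  rw [exteriorPower.inner_ιMulti_ιMulti, ← Matrix.det_transpose]
  rfl

theorem norm_wedge_sq {n k : ℕ} (v : Fin k → EucSpace n) :
    ‖wedge v‖ ^ 2 = (Matrix.of fun i j => (inner ℝ (v i) (v j) : ℝ)).det := by
  rw [← real_inner_self_eq_norm_sq, inner_wedge]

/-- The wedge product is continuous, because the distance of two wedge products is a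
polynomial in scalar products of the factors. -/
theorem continuous_wedge (n k : ℕ) : Continuous (wedge : (Fin k → EucSpace n) → KVec n k) := by
  rw [continuous_iff_continuousAt]
  intro w
  rw [ContinuousAt, tendsto_iff_norm_sub_tendsto_zero]
  have key : ∀ v : Fin k → EucSpace n, ‖wedge v - wedge w‖ =
      √((Matrix.of fun i j => (inner ℝ (v i) (v j) : ℝ)).det
        - 2 * (Matrix.of fun i j => (inner ℝ (v i) (w j) : ℝ)).det
        + (Matrix.of fun i j => (inner ℝ (w i) (w j) : ℝ)).det) := by
    intro v
    rw [← inner_wedge, ← inner_wedge, ← inner_wedge, real_inner_self_eq_norm_sq,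
      real_inner_self_eq_norm_sq, ← norm_sub_sq_real, Real.sqrt_sq (norm_nonneg _)]
  simp_rw [key]
  have hc : Continuous fun v : Fin k → EucSpace n =>
      √((Matrix.of fun i j => (inner ℝ (v i) (v j) : ℝ)).det
        - 2 * (Matrix.of fun i j => (inner ℝ (v i) (w j) : ℝ)).det
        + (Matrix.of fun i j => (inner ℝ (w i) (w j) : ℝ)).det) := by
    refine Real.continuous_sqrt.comp ((Continuous.sub ?_ (continuous_const.mul ?_)).add
      continuous_const)
    · refine Continuous.matrix_det ?_
      refine continuous_matrix fun i j => ?_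
      simp only [Matrix.of_apply]
      fun_prop
    · refine Continuous.matrix_det ?_
      refine continuous_matrix fun i j => ?_
      simp only [Matrix.of_apply]
      fun_prop
  have h0 := hc.tendsto w
  rwa [← key w, sub_self, norm_zero] at h0

/-- The wedge product as a continuous multilinear map. -/
def wedgeCMM (n k : ℕ) : ContinuousMultilinearMap ℝ (fun _ : Fin k => EucSpace n) (KVec n k) where
  toMultilinearMap := (exteriorPower.ιMulti ℝ k).toMultilinearMap
  cont := continuous_wedge n k

theorem wedgeCMM_apply {n k : ℕ} (v : Fin k → EucSpace n) : wedgeCMM n k v = wedge v := rfl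

theorem wedge_sum_smul {n k : ℕ} (X : Matrix (Fin k) (Fin k) ℝ) (u : Fin k → EucSpace n) :
    wedge (fun i => ∑ j, X i j • u j) = X.det • wedge u := by
  let f : (Fin k → ℝ) [⋀^Fin k]→ₗ[ℝ] KVec n k :=
    (exteriorPower.ιMulti ℝ k).compLinearMap (Fintype.linearCombination ℝ u)
  let g : (Fin k → ℝ) [⋀^Fin k]→ₗ[ℝ] KVec n k :=
    ((LinearMap.id (R := ℝ) (M := ℝ)).smulRight (wedge u)).compAlternatingMap
      Matrix.detRowAlternating
  have hfg : f = g := by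
    refine Module.Basis.ext_alternating (Pi.basisFun ℝ (Fin k)) fun v hv => ?_
    let σ : Equiv.Perm (Fin k) := Equiv.ofBijective v (Finite.injective_iff_bijective.mp hv)
    have hσ : v = σ := rfl
    have h1 : f (fun i => Pi.basisFun ℝ (Fin k) (v i)) = wedge (u ∘ σ) := by
      simp only [f, AlternatingMap.compLinearMap_apply, hσ]
      congr 1
      ext1 i
      simp [Fintype.linearCombination_apply, Pi.single_apply]
    have h2 : g (fun i => Pi.basisFun ℝ (Fin k) (v i)) =
        (Matrix.of fun i => (Pi.basisFun ℝ (Fin k) (σ i))).det • wedge u := rfl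
    rw [h1, h2]
    have h3 : (Matrix.of fun i => (Pi.basisFun ℝ (Fin k) (σ i))).det
        = ((Equiv.Perm.sign σ : ℤ) : ℝ) := by
      rw [← Matrix.det_permutation]
      congr 1
      ext i j
      simp [Equiv.Perm.permMatrix, PEquiv.toMatrix_apply, Pi.single_apply, eq_comm]
    rw [h3, wedge, AlternatingMap.map_perm, Units.smul_def, ← Int.cast_smul_eq_zsmul ℝ]
  exact AlternatingMap.congr_fun hfg X

theorem norm_wedge_of_orthonormal {n k : ℕ} {u : Fin k → EucSpace n} (hu : Orthonormal ℝ u) :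
    ‖wedge u‖ = 1 := by
  have h : ‖wedge u‖ ^ 2 = 1 := by
    rw [norm_wedge_sq]
    convert Matrix.det_one (R := ℝ) (n := Fin k)
    ext i j
    rw [Matrix.of_apply, orthonormal_iff_ite.mp hu i j, Matrix.one_apply]
  nlinarith [norm_nonneg (wedge u), h]

theorem wedge_ne_zero_iff {n k : ℕ} {v : Fin k → EucSpace n} :
    wedge v ≠ 0 ↔ LinearIndependent ℝ v := by
  rw [← inner_self_ne_zero (𝕜 := ℝ), exteriorPower.inner_ιMulti_self]
  exact Matrix.det_gram_ne_zero_iff_linearIndependent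

/-- A linearly independent family is a linear combination of an orthonormal one. -/
theorem exists_orthonormal_of_linearIndependent {n k : ℕ} {v : Fin k → EucSpace n}
    (hv : LinearIndependent ℝ v) :
    ∃ (u : Fin k → EucSpace n) (X : Matrix (Fin k) (Fin k) ℝ), Orthonormal ℝ u ∧
      Submodule.span ℝ (Set.range u) = Submodule.span ℝ (Set.range v) ∧
      v = fun i => ∑ j, X i j • u j := by
  have hrank : Module.finrank ℝ (Submodule.span ℝ (Set.range v)) = k := by
    rw [finrank_span_eq_card hv, Fintype.card_fin]
  let b := (stdOrthonormalBasis ℝ (Submodule.span ℝ (Set.range v))).reindex (finCongr hrank)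
  refine ⟨fun i => (b i : EucSpace n), fun i j => inner ℝ (b j)
    ⟨v i, Submodule.subset_span ⟨i, rfl⟩⟩, ?_, ?_, ?_⟩
  · exact b.orthonormal.comp_linearIsometry (Submodule.subtypeₗᵢ _)
  · have h := b.toBasis.span_eq
    have h2 := congrArg (Submodule.map (Submodule.subtype _)) h
    rw [Submodule.map_span, Submodule.map_top, Submodule.range_subtype, ← Set.range_comp] at h2
    convert h2 using 3
    ext i
    simp
  · ext1 i
    have h := b.sum_repr' ⟨v i, Submodule.subset_span ⟨i, rfl⟩⟩
    have h2 := congrArg (Submodule.subtype _) h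
    simp only [map_sum, map_smul, Submodule.subtype_apply] at h2
    exact h2.symm

/-- A linear isometry acts on `k`-vectors by a linear isometry. -/
noncomputable def kMap {n : ℕ} (k : ℕ) (g : EucSpace n ≃ₗᵢ[ℝ] EucSpace n) :
    KVec n k →ₗᵢ[ℝ] KVec n k where
  toLinearMap := exteriorPower.map k g.toLinearEquiv.toLinearMap
  norm_map' := by
    have h : ((innerₗ (KVec n k)).compl₁₂ (exteriorPower.map k g.toLinearEquiv.toLinearMap)
        (exteriorPower.map k g.toLinearEquiv.toLinearMap)) = innerₗ (KVec n k) := by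
      apply exteriorPower.linearMap_ext
      ext1 v
      apply exteriorPower.linearMap_ext
      ext1 w
      have := inner_wedge (fun i => g (v i)) (fun i => g (w i))
      simp only [LinearIsometryEquiv.inner_map_map] at this
      rw [← inner_wedge] at this
      simpa [exteriorPower.map_apply_ιMulti, Function.comp_def] using this
    intro x
    have h2 := LinearMap.congr_fun₂ h x x
    simp only [LinearMap.compl₁₂_apply, innerₗ_apply_apply, real_inner_self_eq_norm_sq] at h2
    exact (sq_eq_sq₀ (norm_nonneg _) (norm_nonneg _)).mp h2

theorem kMap_wedge {n k : ℕ} (g : EucSpace n ≃ₗᵢ[ℝ] EucSpace n) (v : Fin k → EucSpace n) :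
    kMap k g (wedge v) = wedge (fun i => g (v i)) :=
  exteriorPower.map_apply_ιMulti _ _

theorem coe_wedge_cons {n k : ℕ} (g : EucSpace n) (u : Fin k → EucSpace n) :
    ((wedge (Fin.cons g u : Fin (k + 1) → EucSpace n) : KVec n (k + 1)) :
        ExteriorAlgebra ℝ (EucSpace n))
      = ExteriorAlgebra.ι ℝ g * ((wedge u : KVec n k) : ExteriorAlgebra ℝ (EucSpace n)) := by
  simp only [wedge, exteriorPower.ιMulti_apply_coe, ExteriorAlgebra.ιMulti_succ_apply]
  simp [Matrix.vecTail, Function.comp_def]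

theorem wedge_cons_eq_smul {n k : ℕ} {c : ℝ} {v u : Fin k → EucSpace n}
    (h : wedge v = c • wedge u) (g : EucSpace n) :
    wedge (Fin.cons g v : Fin (k + 1) → EucSpace n)
      = c • wedge (Fin.cons g u : Fin (k + 1) → EucSpace n) := by
  apply Subtype.ext
  rw [Submodule.coe_smul, coe_wedge_cons, coe_wedge_cons, h, Submodule.coe_smul, mul_smul_comm]

theorem norm_wedge_cons {n k : ℕ} {u : Fin k → EucSpace n} (hu : Orthonormal ℝ u)
    (g : EucSpace n) : ‖wedge (Fin.cons g u : Fin (k + 1) → EucSpace n)‖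
      = ‖g - ∑ i, (inner ℝ (u i) g : ℝ) • u i‖ := by
  set g' := g - ∑ i, (inner ℝ (u i) g : ℝ) • u i with hg'
  have horth : ∀ i, inner ℝ (u i) g' = (0 : ℝ) := by
    intro i
    rw [hg', inner_sub_right, hu.inner_right_fintype, sub_self]
  have h1 : wedge (Fin.cons g u : Fin (k + 1) → EucSpace n) =
      wedge (Fin.cons g' u : Fin (k + 1) → EucSpace n) := by
    apply Subtype.ext
    rw [coe_wedge_cons, coe_wedge_cons, hg', map_sub, sub_mul, map_sum, Finset.sum_mul,
      Finset.sum_eq_zero, sub_zero]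
    intro i _
    rw [map_smul, smul_mul_assoc, ← coe_wedge_cons]
    have : wedge (Fin.cons (u i) u : Fin (k + 1) → EucSpace n) = 0 :=
      (exteriorPower.ιMulti ℝ (k + 1)).map_eq_zero_of_eq _ (i := 0) (j := i.succ) (by simp)
        (Fin.succ_ne_zero i).symm
    rw [this]
    simp
  have h2 : ‖wedge (Fin.cons g' u : Fin (k + 1) → EucSpace n)‖ ^ 2 = ‖g'‖ ^ 2 := by
    rw [norm_wedge_sq, Matrix.det_succ_row_zero, Fin.sum_univ_succ, Finset.sum_eq_zero]
    · have : ((Matrix.of fun i j => (inner ℝ ((Fin.cons g' u : Fin (k + 1) → EucSpace n) i)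
          ((Fin.cons g' u : Fin (k + 1) → EucSpace n) j) : ℝ)).submatrix Fin.succ
            (Fin.succAbove 0)) = 1 := by
        ext i j
        simp [orthonormal_iff_ite.mp hu i j, Matrix.one_apply]
      rw [this]
      simp
    · intro i _
      simp [real_inner_comm, horth]
  rw [h1]
  exact (sq_eq_sq₀ (norm_nonneg _) (norm_nonneg _)).mp h2

/-- Orthonormal families of the same length are related by a linear isometry. -/
theorem exists_isometry_of_orthonormal {n j : ℕ} {u v : Fin j → EucSpace n}
    (hu : Orthonormal ℝ u) (hv : Orthonormal ℝ v) :
    ∃ g : EucSpace n ≃ₗᵢ[ℝ] EucSpace n, ∀ i, g (u i) = v i := by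
  have hj : j ≤ n := by
    have := hu.linearIndependent.fintype_card_le_finrank
    simpa using this
  have ext : ∀ w : Fin j → EucSpace n, Orthonormal ℝ w →
      ∃ b : OrthonormalBasis (Fin n) ℝ (EucSpace n), ∀ i, b (Fin.castLE hj i) = w i := by
    intro w hw
    let w' : Fin n → EucSpace n := fun i => if h : (i : ℕ) < j then w ⟨i, h⟩ else 0
    have hw' : Orthonormal ℝ ((Set.range (Fin.castLE hj)).domRestrict w') := by
      have : (Set.range (Fin.castLE hj)).domRestrict w' = w ∘ fun i : Set.range (Fin.castLE hj) =>
          (⟨(i : Fin n), by obtain ⟨_, l, rfl⟩ := i; simp⟩ : Fin j) := by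
        ext1 ⟨_, l, rfl⟩
        simp [w', Set.domRestrict]
      rw [this]
      refine hw.comp _ ?_
      rintro ⟨_, l, rfl⟩ ⟨_, l', rfl⟩ h
      have h' : l = l' := by simpa using h
      rw [h']
    obtain ⟨b, hb⟩ := hw'.exists_orthonormalBasis_extension_of_card_eq (by simp)
    refine ⟨b, fun i => ?_⟩
    rw [hb _ ⟨i, rfl⟩]
    simp [w']
  obtain ⟨b, hb⟩ := ext u hu
  obtain ⟨c, hc⟩ := ext v hv
  refine ⟨b.equiv c (Equiv.refl _), fun i => ?_⟩
  rw [← hb, ← hc, OrthonormalBasis.equiv_apply_basis]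
  rfl

/-! ### The group action on the space of flags -/

/-- The ambient space `ℝⁿ × Λᵏ(ℝⁿ)` of `𝒲`. -/
abbrev FlagAmbient (n k : ℕ) : Type := WithLp 2 (EucSpace n × KVec n k)

theorem borelSpace_flagAmbient (n k : ℕ) : BorelSpace (FlagAmbient n k) := inferInstance

section

-- This spares the search for the instance, which is slow for `n = k + (d + 1)`.
attribute [local instance] borelSpace_flagAmbient

theorem mem_setW_iff {n k : ℕ} {p : FlagAmbient n k} :
    p ∈ setW n k ↔ ‖p.fst‖ = 1 ∧ ∃ u : Fin k → EucSpace n, Orthonormal ℝ u ∧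
      (∀ i, inner ℝ (u i) p.fst = (0 : ℝ)) ∧ (p.snd = wedge u ∨ p.snd = -wedge u) := by
  constructor
  · rintro ⟨h1, ⟨⟨c, v, hcv⟩, h2⟩, h3⟩
    refine ⟨h1, ?_⟩
    have hne : c • wedge v ≠ 0 := by
      rw [← hcv, ← norm_ne_zero_iff, h2]
      exact one_ne_zero
    have hc : c ≠ 0 := fun h => hne (by rw [h, zero_smul])
    have hv : wedge v ≠ 0 := fun h => hne (by rw [h, smul_zero])
    obtain ⟨u, X, hu, hspan, hX⟩ :=
      exists_orthonormal_of_linearIndependent (wedge_ne_zero_iff.mp hv)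
    refine ⟨u, hu, fun i => ?_, ?_⟩
    · rw [hcv, kSpan_smul_wedge hne, ← hspan, Submodule.mem_orthogonal] at h3
      exact h3 _ (Submodule.subset_span ⟨i, rfl⟩)
    · rw [hX, wedge_sum_smul, smul_smul] at hcv
      rw [hcv, norm_smul, norm_wedge_of_orthonormal hu, mul_one, Real.norm_eq_abs] at h2
      rcases eq_or_eq_neg_of_abs_eq h2 with h | h
      · left
        rw [hcv, h, one_smul]
      · right
        rw [hcv, h, neg_smul, one_smul]
  · rintro ⟨h1, u, hu, h2, h3⟩
    have h4 : ∃ s : ℝ, |s| = 1 ∧ p.snd = s • wedge u := by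
      rcases h3 with h | h
      · exact ⟨1, by simp, by rw [h, one_smul]⟩
      · exact ⟨-1, by simp, h.trans (neg_one_smul ℝ _).symm⟩
    obtain ⟨s, hs, h4⟩ := h4
    have hnorm : ‖p.snd‖ = 1 := by
      rw [h4, norm_smul, norm_wedge_of_orthonormal hu, Real.norm_eq_abs, hs, mul_one]
    have hne : s • wedge u ≠ 0 := by
      rw [← h4, ← norm_ne_zero_iff, hnorm]
      exact one_ne_zero
    refine ⟨h1, ⟨⟨s, u, h4⟩, hnorm⟩, ?_⟩
    rw [h4, kSpan_smul_wedge hne, Submodule.mem_orthogonal]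
    intro x hx
    induction hx using Submodule.span_induction with
    | mem x hx => obtain ⟨i, rfl⟩ := hx; exact h2 i
    | zero => simp
    | add x y _ _ hx hy => rw [inner_add_left, hx, hy, add_zero]
    | smul c x _ hx => rw [inner_smul_left, hx, mul_zero]

theorem exists_eq_wedge_of_mem_unitSimple {n k : ℕ} {ω : KVec n k} (hω : ω ∈ unitSimple n k) :
    ∃ u : Fin k → EucSpace n, Orthonormal ℝ u ∧ (ω = wedge u ∨ ω = -wedge u) := by
  obtain ⟨⟨c, v, hcv⟩, h2⟩ := hω
  have hv : wedge v ≠ 0 := by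
    rintro h
    rw [hcv, h, smul_zero, norm_zero] at h2
    exact zero_ne_one h2
  obtain ⟨u, X, hu, -, hX⟩ :=
    exists_orthonormal_of_linearIndependent (wedge_ne_zero_iff.mp hv)
  refine ⟨u, hu, ?_⟩
  rw [hX, wedge_sum_smul, smul_smul] at hcv
  rw [hcv, norm_smul, norm_wedge_of_orthonormal hu, mul_one, Real.norm_eq_abs] at h2
  rcases eq_or_eq_neg_of_abs_eq h2 with h | h
  · left
    rw [hcv, h, one_smul]
  · right
    rw [hcv, h, neg_smul, one_smul]

/-- A linear isometry of `ℝⁿ`, acting on pairs `(a, ω)`. -/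
noncomputable def flagAct {n : ℕ} (k : ℕ) (g : EucSpace n ≃ₗᵢ[ℝ] EucSpace n) :
    FlagAmbient n k ≃ₗᵢ[ℝ] FlagAmbient n k :=
  LinearIsometryEquiv.withLpProdCongr 2 g ((kMap k g).toLinearIsometryEquiv rfl)

/-- The orientation reversal `(a, ω) ↦ (a, -ω)`. -/
noncomputable def flagFlip (n k : ℕ) : FlagAmbient n k ≃ₗᵢ[ℝ] FlagAmbient n k :=
  LinearIsometryEquiv.withLpProdCongr 2 (LinearIsometryEquiv.refl ℝ _) (LinearIsometryEquiv.neg ℝ)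

@[simp] theorem flagAct_fst {n k : ℕ} (g : EucSpace n ≃ₗᵢ[ℝ] EucSpace n) (p : FlagAmbient n k) :
    (flagAct k g p).fst = g p.fst := rfl

@[simp] theorem flagAct_snd {n k : ℕ} (g : EucSpace n ≃ₗᵢ[ℝ] EucSpace n) (p : FlagAmbient n k) :
    (flagAct k g p).snd = kMap k g p.snd := rfl

@[simp] theorem flagFlip_snd {n k : ℕ} (p : FlagAmbient n k) :
    (flagFlip n k p).snd = -p.snd := rfl

@[simp] theorem flagFlip_flagFlip {n k : ℕ} (p : FlagAmbient n k) :
    flagFlip n k (flagFlip n k p) = p :=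
  (WithLp.equiv 2 _).injective (Prod.ext rfl (neg_neg _))

theorem flagAct_flagFlip {n k : ℕ} (g : EucSpace n ≃ₗᵢ[ℝ] EucSpace n) (p : FlagAmbient n k) :
    flagAct k g (flagFlip n k p) = flagFlip n k (flagAct k g p) :=
  (WithLp.equiv 2 _).injective (Prod.ext rfl ((kMap k g).map_neg _))

theorem flagFlip_mem_setW {n k : ℕ} {p : FlagAmbient n k} (hp : p ∈ setW n k) :
    flagFlip n k p ∈ setW n k := by
  rw [mem_setW_iff] at hp ⊢
  obtain ⟨h1, u, hu, h2, h3⟩ := hp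
  refine ⟨h1, u, hu, h2, ?_⟩
  rcases h3 with h | h
  · right; rw [flagFlip_snd, h]
  · left; rw [flagFlip_snd, h, neg_neg]

theorem flagAct_mem_setW {n k : ℕ} (g : EucSpace n ≃ₗᵢ[ℝ] EucSpace n) {p : FlagAmbient n k}
    (hp : p ∈ setW n k) : flagAct k g p ∈ setW n k := by
  rw [mem_setW_iff] at hp ⊢
  obtain ⟨h1, u, hu, h2, h3⟩ := hp
  refine ⟨by simpa using h1, fun i => g (u i), hu.comp_linearIsometryEquiv g, ?_, ?_⟩
  · intro i
    simpa using h2 i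
  · rcases h3 with h | h
    · left; rw [flagAct_snd, h, kMap_wedge]
    · right; rw [flagAct_snd, h, map_neg, kMap_wedge]

theorem flagAct_symm_apply {n k : ℕ} (g : EucSpace n ≃ₗᵢ[ℝ] EucSpace n) (p : FlagAmbient n k) :
    flagAct k g (flagAct k g.symm p) = p := by
  refine (WithLp.equiv 2 _).injective (Prod.ext (g.apply_symm_apply p.fst) ?_)
  change kMap k g (kMap k g.symm p.snd) = p.snd
  have h : (kMap k g).toLinearMap ∘ₗ (kMap k g.symm).toLinearMap = LinearMap.id := by
    apply exteriorPower.linearMap_ext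
    ext1 v
    change kMap k g (kMap k g.symm (wedge v)) = wedge v
    simp [kMap_wedge]
  exact LinearMap.congr_fun h p.snd

theorem preimage_flagAct_setW {n k : ℕ} (g : EucSpace n ≃ₗᵢ[ℝ] EucSpace n) :
    flagAct k g ⁻¹' setW n k = setW n k := by
  ext p
  refine ⟨fun h => ?_, flagAct_mem_setW g⟩
  have := flagAct_mem_setW g.symm h
  have h2 := flagAct_symm_apply (k := k) g.symm p
  rw [LinearIsometryEquiv.symm_symm] at h2
  rwa [h2] at this

theorem preimage_flagFlip_setW {n k : ℕ} : flagFlip n k ⁻¹' setW n k = setW n k := by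
  ext p
  refine ⟨fun h => ?_, flagFlip_mem_setW⟩
  simpa using flagFlip_mem_setW h

/-- The isometry group, together with the orientation reversal, acts transitively on `𝒲`. -/
theorem exists_flagAct_eq {n k : ℕ} {p q : FlagAmbient n k} (hp : p ∈ setW n k)
    (hq : q ∈ setW n k) : ∃ g : EucSpace n ≃ₗᵢ[ℝ] EucSpace n,
      q = flagAct k g p ∨ q = flagFlip n k (flagAct k g p) := by
  rw [mem_setW_iff] at hp hq
  obtain ⟨h1, u, hu, h2, h3⟩ := hp
  obtain ⟨h1', v, hv, h2', h3'⟩ := hq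
  have cons_orth : ∀ (w : Fin k → EucSpace n) (a : EucSpace n), ‖a‖ = 1 → Orthonormal ℝ w →
      (∀ i, inner ℝ (w i) a = (0 : ℝ)) →
      Orthonormal ℝ (Fin.cons a w : Fin (k + 1) → EucSpace n) := by
    intro w a ha hw hwa
    rw [orthonormal_iff_ite] at hw ⊢
    intro i j
    refine Fin.cases ?_ (fun i => ?_) i <;> refine Fin.cases ?_ (fun j => ?_) j
    · simp [ha]
    · simpa [(Fin.succ_ne_zero j).symm, real_inner_comm] using hwa j
    · simp [hwa]
    · simp [hw i j]
  obtain ⟨g, hg⟩ := exists_isometry_of_orthonormal (cons_orth u _ h1 hu h2)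
    (cons_orth v _ h1' hv h2')
  have hga : g p.fst = q.fst := by simpa using hg 0
  have hgu : ∀ i, g (u i) = v i := fun i => by simpa using hg i.succ
  have hgw : kMap k g (wedge u) = wedge v := by
    rw [kMap_wedge]
    congr 1
    ext1 i
    exact hgu i
  refine ⟨g, ?_⟩
  have key : q.snd = kMap k g p.snd ∨ q.snd = -kMap k g p.snd := by
    rcases h3 with h | h <;> rcases h3' with h' | h' <;> rw [h, h'] <;> simp [hgw]
  rcases key with h | h
  · left
    exact (WithLp.equiv 2 _).injective (Prod.ext hga.symm h)
  · right
    exact (WithLp.equiv 2 _).injective (Prod.ext hga.symm h)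

theorem isCompact_setW (n k : ℕ) : IsCompact (setW n k) := by
  let S : Set ((Fin k → EucSpace n) × EucSpace n) :=
    {p | Orthonormal ℝ p.1 ∧ ‖p.2‖ = 1 ∧ ∀ i, inner ℝ (p.1 i) p.2 = (0 : ℝ)}
  have hS : IsCompact S := by
    refine Metric.isCompact_of_isClosed_isBounded ?_ ?_
    · refine IsClosed.inter ?_ (IsClosed.inter ?_ ?_)
      · have : {p : (Fin k → EucSpace n) × EucSpace n | Orthonormal ℝ p.1} =
            ⋂ i, ⋂ j, {p | (inner ℝ (p.1 i) (p.1 j) : ℝ) = if i = j then 1 else 0} := by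
          ext p
          simp [orthonormal_iff_ite]
        change IsClosed {p : (Fin k → EucSpace n) × EucSpace n | Orthonormal ℝ p.1}
        rw [this]
        refine isClosed_iInter fun i => isClosed_iInter fun j => isClosed_eq ?_ continuous_const
        fun_prop
      · exact isClosed_eq (by fun_prop) continuous_const
      · have : {p : (Fin k → EucSpace n) × EucSpace n | ∀ i, inner ℝ (p.1 i) p.2 = (0 : ℝ)} =
            ⋂ i, {p | (inner ℝ (p.1 i) p.2 : ℝ) = 0} := by
          ext p
          simp
        change IsClosed {p : (Fin k → EucSpace n) × EucSpace n |
          ∀ i, inner ℝ (p.1 i) p.2 = (0 : ℝ)}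
        rw [this]
        refine isClosed_iInter fun i => isClosed_eq ?_ continuous_const
        fun_prop
    · refine (Metric.isBounded_closedBall (x := 0) (r := 1)).subset ?_
      rintro p ⟨h1, h2, -⟩
      rw [mem_closedBall_zero_iff, Prod.norm_def]
      refine max_le ((pi_norm_le_iff_of_nonneg zero_le_one).mpr fun i => (h1.1 i).le) h2.le
  let f : (Fin k → EucSpace n) × EucSpace n → FlagAmbient n k := fun p =>
    WithLp.toLp 2 (p.2, wedge p.1)
  have hf : Continuous f := (WithLp.prod_continuous_toLp 2 _ _).comp
    (continuous_snd.prodMk ((continuous_wedge n k).comp continuous_fst))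
  have hW : setW n k = f '' S ∪ flagFlip n k '' (f '' S) := by
    ext p
    rw [mem_setW_iff]
    constructor
    · rintro ⟨h1, u, hu, h2, h | h⟩
      · left
        exact ⟨(u, p.fst), ⟨hu, h1, h2⟩, (WithLp.equiv 2 _).injective (Prod.ext rfl h.symm)⟩
      · right
        exact ⟨_, ⟨(u, p.fst), ⟨hu, h1, h2⟩, rfl⟩,
          (WithLp.equiv 2 _).injective (Prod.ext rfl h.symm)⟩
    · rintro (⟨q, ⟨h1, h2, h3⟩, rfl⟩ | ⟨_, ⟨q, ⟨h1, h2, h3⟩, rfl⟩, rfl⟩)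
      · exact ⟨h2, q.1, h1, h3, Or.inl rfl⟩
      · exact ⟨h2, q.1, h1, h3, Or.inr rfl⟩
  rw [hW]
  exact (hS.image hf).union ((hS.image hf).image (flagFlip n k).continuous)

/-! ### The flag of a frame -/

/-- The component of `g` orthogonal to the vectors `v i`. -/
noncomputable def perp {n k : ℕ} (v : Fin k → EucSpace n) (g : EucSpace n) : EucSpace n :=
  (Submodule.span ℝ (Set.range v))ᗮ.starProjection g

theorem perp_eq {n k : ℕ} {v : Fin k → EucSpace n} {g p : EucSpace n}
    (h1 : ∀ i, inner ℝ (v i) p = (0 : ℝ)) (h2 : g - p ∈ Submodule.span ℝ (Set.range v)) :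
    perp v g = p := by
  refine Submodule.eq_starProjection_of_mem_orthogonal ?_ ?_
  · rw [Submodule.mem_orthogonal]
    intro x hx
    induction hx using Submodule.span_induction with
    | mem x hx => obtain ⟨i, rfl⟩ := hx; exact h1 i
    | zero => simp
    | add x y _ _ hx hy => rw [inner_add_left, hx, hy, add_zero]
    | smul c x _ hx => rw [inner_smul_left, hx, mul_zero]
  · exact Submodule.le_orthogonal_orthogonal _ h2

theorem inner_perp {n k : ℕ} (v : Fin k → EucSpace n) (g : EucSpace n) (i : Fin k) :
    inner ℝ (v i) (perp v g) = (0 : ℝ) :=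
  (Submodule.mem_orthogonal _ _).mp (Submodule.starProjection_apply_mem _ g) _
    (Submodule.subset_span ⟨i, rfl⟩)

theorem sub_perp_mem {n k : ℕ} (v : Fin k → EucSpace n) (g : EucSpace n) :
    g - perp v g ∈ Submodule.span ℝ (Set.range v) := by
  have := Submodule.sub_starProjection_mem_orthogonal (K := (Submodule.span ℝ (Set.range v))ᗮ) g
  rwa [Submodule.orthogonal_orthogonal] at this

/-- The pair `(a, ω)` that the frame `v₁, …, vₖ, g` determines: `ω` is the unit multiple of
`v₁ ∧ ⋯ ∧ vₖ`, and `a` is the direction of the component of `g` orthogonal to it. -/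
noncomputable def flagOf {n k : ℕ} (p : (Fin k → EucSpace n) × EucSpace n) : FlagAmbient n k :=
  WithLp.toLp 2 (NormedSpace.normalize (perp p.1 p.2), NormedSpace.normalize (wedge p.1))

theorem flagOf_mem_setW {n k : ℕ} {p : (Fin k → EucSpace n) × EucSpace n}
    (h1 : LinearIndependent ℝ p.1) (h2 : p.2 ∉ Submodule.span ℝ (Set.range p.1)) :
    flagOf p ∈ setW n k := by
  obtain ⟨u, X, hu, hspan, hX⟩ := exists_orthonormal_of_linearIndependent h1
  have hp : perp p.1 p.2 ≠ 0 := by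
    intro h
    have := sub_perp_mem p.1 p.2
    rw [h, sub_zero] at this
    exact h2 this
  have hperp : ∀ i, inner ℝ (u i) (perp p.1 p.2) = (0 : ℝ) := by
    intro i
    refine (Submodule.mem_orthogonal _ _).mp (Submodule.starProjection_apply_mem _ p.2) _ ?_
    rw [← hspan]
    exact Submodule.subset_span ⟨i, rfl⟩
  have hne : wedge p.1 ≠ 0 := wedge_ne_zero_iff.mpr h1
  rw [mem_setW_iff]
  refine ⟨NormedSpace.norm_normalize hp, u, hu, ?_, ?_⟩
  · intro i
    change inner ℝ (u i) (NormedSpace.normalize (perp p.1 p.2)) = (0 : ℝ)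
    rw [NormedSpace.normalize, inner_smul_right, hperp, mul_zero]
  · change NormedSpace.normalize (wedge p.1) = _ ∨ NormedSpace.normalize (wedge p.1) = _
    have hw : NormedSpace.normalize (wedge p.1) = (|X.det|⁻¹ * X.det) • wedge u := by
      rw [NormedSpace.normalize, hX, wedge_sum_smul, norm_smul, norm_wedge_of_orthonormal hu,
        mul_one, Real.norm_eq_abs, smul_smul]
    have hdet : X.det ≠ 0 := by
      intro h
      apply hne
      rw [hX, wedge_sum_smul, h, zero_smul]
    rw [hw]
    rcases lt_or_gt_of_ne hdet with h | h
    · right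
      rw [abs_of_neg h, inv_neg, neg_mul, inv_mul_cancel₀ hdet]
      exact neg_one_smul ℝ (wedge u)
    · left
      rw [abs_of_pos h, inv_mul_cancel₀ hdet, one_smul]

theorem flagOf_map {n k : ℕ} (g : EucSpace n ≃ₗᵢ[ℝ] EucSpace n)
    (p : (Fin k → EucSpace n) × EucSpace n) :
    flagOf (fun i => g (p.1 i), g p.2) = flagAct k g (flagOf p) := by
  have h1 : perp (fun i => g (p.1 i)) (g p.2) = g (perp p.1 p.2) := by
    refine perp_eq (fun i => ?_) ?_
    · rw [LinearIsometryEquiv.inner_map_map, inner_perp]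
    · have h := Submodule.mem_map_of_mem (f := g.toLinearEquiv.toLinearMap)
        (sub_perp_mem p.1 p.2)
      rw [Submodule.map_span, ← Set.range_comp] at h
      rw [← map_sub]
      exact h
  refine (WithLp.equiv 2 _).injective (Prod.ext ?_ ?_)
  · change NormedSpace.normalize (perp (fun i => g (p.1 i)) (g p.2)) = g (NormedSpace.normalize _)
    rw [h1, NormedSpace.normalize, NormedSpace.normalize, map_smul, g.norm_map]
  · change NormedSpace.normalize (wedge (fun i => g (p.1 i))) =
      kMap k g (NormedSpace.normalize (wedge p.1))
    rw [← kMap_wedge, NormedSpace.normalize, NormedSpace.normalize, map_smul, (kMap k g).norm_map]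

/-- The flag of a frame, in terms of another basis `u` of its subspace. -/
theorem flagOf_eq {n k : ℕ} (X : Matrix (Fin k) (Fin k) ℝ) (hX : X.det ≠ 0)
    (u : Fin k → EucSpace n) (x : Fin k → ℝ) (τ : ℝ) {g p : EucSpace n}
    (h1 : ∀ i, inner ℝ (u i) p = (0 : ℝ)) (h2 : g = ∑ j, x j • u j + τ • p) :
    flagOf (fun i => ∑ j, X i j • u j, g) =
      WithLp.toLp 2 (NormedSpace.normalize (τ • p), NormedSpace.normalize (X.det • wedge u)) := by
  have h3 : perp (fun i => ∑ j, X i j • u j) g = τ • p := by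
    refine perp_eq (fun i => ?_) ?_
    · simp [sum_inner, inner_smul_left, inner_smul_right, h1]
    · rw [h2, add_sub_cancel_right]
      have hspan : ∀ j, u j ∈ Submodule.span ℝ (Set.range fun i => ∑ j, X i j • u j) := by
        intro j
        have : u j = ∑ i, X⁻¹ j i • ∑ l, X i l • u l := by
          simp_rw [Finset.smul_sum, smul_smul]
          rw [Finset.sum_comm]
          simp_rw [← Finset.sum_smul, ← Matrix.mul_apply,
            Matrix.nonsing_inv_mul X (isUnit_iff_ne_zero.mpr hX), Matrix.one_apply]
          simp
        rw [this]
        exact Submodule.sum_mem _ fun i _ => Submodule.smul_mem _ _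
          (Submodule.subset_span ⟨i, rfl⟩)
      exact Submodule.sum_mem _ fun i _ => Submodule.smul_mem _ _ (hspan i)
  rw [flagOf, h3, wedge_sum_smul]

theorem measurable_gramSchmidt {n k : ℕ} (i : Fin k) :
    Measurable fun v : Fin k → EucSpace n => InnerProductSpace.gramSchmidt ℝ v i := by
  induction i using WellFoundedLT.induction with
  | ind i ih =>
    have : (fun v : Fin k → EucSpace n => InnerProductSpace.gramSchmidt ℝ v i) =
        fun v => v i - ∑ j ∈ Finset.Iio i, ((inner ℝ (InnerProductSpace.gramSchmidt ℝ v j) (v i) /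
          ‖InnerProductSpace.gramSchmidt ℝ v j‖ ^ 2 : ℝ)) •
            InnerProductSpace.gramSchmidt ℝ v j := by
      ext1 v
      rw [eq_sub_iff_add_eq]
      exact (InnerProductSpace.gramSchmidt_def'' ℝ v i).symm
    rw [this]
    refine (measurable_pi_apply i).sub (Finset.measurable_sum _ fun j hj => ?_)
    have hj' := ih j (Finset.mem_Iio.mp hj)
    exact ((hj'.inner (measurable_pi_apply i)).div (hj'.norm.pow_const 2)).smul hj'

theorem measurable_perp {n k : ℕ} :
    Measurable fun p : (Fin k → EucSpace n) × EucSpace n => perp p.1 p.2 := by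
  have : (fun p : (Fin k → EucSpace n) × EucSpace n => perp p.1 p.2) =
      fun p => p.2 - ∑ j, ((inner ℝ (InnerProductSpace.gramSchmidt ℝ p.1 j) p.2 /
          ‖InnerProductSpace.gramSchmidt ℝ p.1 j‖ ^ 2 : ℝ)) •
            InnerProductSpace.gramSchmidt ℝ p.1 j := by
    ext1 p
    have hspan := InnerProductSpace.span_gramSchmidt ℝ p.1
    have hgs : perp p.1 p.2 = perp (InnerProductSpace.gramSchmidt ℝ p.1) p.2 := by
      simp only [perp, hspan]
    rw [hgs]
    refine perp_eq (v := InnerProductSpace.gramSchmidt ℝ p.1) (fun i => ?_) ?_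
    · rw [inner_sub_right, inner_sum, Finset.sum_eq_single i]
      · rw [inner_smul_right, real_inner_self_eq_norm_sq]
        by_cases h : InnerProductSpace.gramSchmidt ℝ p.1 i = 0
        · simp [h]
        · have : ‖InnerProductSpace.gramSchmidt ℝ p.1 i‖ ≠ 0 := norm_ne_zero_iff.mpr h
          field_simp
          simp
      · intro j _ hj
        rw [inner_smul_right, InnerProductSpace.gramSchmidt_orthogonal ℝ p.1 hj.symm, mul_zero]
      · simp
    · rw [sub_sub_cancel]
      exact Submodule.sum_mem _ fun j _ => Submodule.smul_mem _ _
        (Submodule.subset_span ⟨j, rfl⟩)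
  rw [this]
  refine measurable_snd.sub (Finset.measurable_sum _ fun j _ => ?_)
  have hj : Measurable fun p : (Fin k → EucSpace n) × EucSpace n =>
      InnerProductSpace.gramSchmidt ℝ p.1 j := (measurable_gramSchmidt j).comp measurable_fst
  exact ((hj.inner measurable_snd).div (hj.norm.pow_const 2)).smul hj

theorem measurable_flagOf {n k : ℕ} : Measurable (flagOf (n := n) (k := k)) := by
  have h1 := measurable_perp (n := n) (k := k)
  have h2 : Measurable fun p : (Fin k → EucSpace n) × EucSpace n => wedge p.1 :=
    ((continuous_wedge n k).comp continuous_fst).measurable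
  exact (WithLp.prod_continuous_toLp 2 _ _).measurable.comp
    ((h1.norm.inv.smul h1).prodMk (h2.norm.inv.smul h2))

/-! ### Gaussian frames -/

/-- The Gaussian weight `exp (-b ‖x‖²)`. -/
noncomputable def gaussW {E : Type*} [NormedAddCommGroup E] (b : ℝ) (x : E) : ENNReal :=
  ENNReal.ofReal (Real.exp (-b * ‖x‖ ^ 2))

theorem measurable_gaussW {E : Type*} [NormedAddCommGroup E] [MeasurableSpace E]
    [OpensMeasurableSpace E] (b : ℝ) : Measurable (gaussW b : E → ENNReal) := by
  unfold gaussW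
  fun_prop

/-- The Gaussian weight of a family of vectors. -/
noncomputable def gaussPi {E ι : Type*} [Fintype ι] [NormedAddCommGroup E] (b : ℝ) (v : ι → E) :
    ENNReal := ∏ i, gaussW b (v i)

theorem measurable_gaussPi {E ι : Type*} [Fintype ι] [NormedAddCommGroup E] [MeasurableSpace E]
    [OpensMeasurableSpace E] (b : ℝ) : Measurable (gaussPi b : (ι → E) → ENNReal) :=
  Finset.measurable_fun_prod _ fun i _ => (measurable_gaussW b).comp (measurable_pi_apply i)

theorem gaussPi_map {n j : ℕ} (b : ℝ) (g : EucSpace n ≃ₗᵢ[ℝ] EucSpace n) (v : Fin j → EucSpace n) :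
    gaussPi b (fun i => g (v i)) = gaussPi b v := by
  simp [gaussPi, gaussW]

/-- The Gaussian weight of a frame `v₁, …, vₖ, g`. -/
noncomputable def gaussFrame {n k : ℕ} (p : (Fin k → EucSpace n) × EucSpace n) : ENNReal :=
  gaussPi Real.pi p.1 * gaussW Real.pi p.2

theorem measurable_gaussFrame {n k : ℕ} : Measurable (gaussFrame (n := n) (k := k)) :=
  ((measurable_gaussPi _).comp measurable_fst).mul ((measurable_gaussW _).comp measurable_snd)

theorem measurePreserving_pi_isometry {n : ℕ} (j : ℕ) (g : EucSpace n ≃ₗᵢ[ℝ] EucSpace n) :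
    MeasurePreserving (fun (v : Fin j → EucSpace n) i => g (v i)) :=
  volume_preserving_pi fun _ => g.measurePreserving

theorem lintegral_pi_isometry {n j : ℕ} (g : EucSpace n ≃ₗᵢ[ℝ] EucSpace n)
    {f : (Fin j → EucSpace n) → ENNReal} (hf : Measurable f) :
    ∫⁻ v : Fin j → EucSpace n, f (fun i => g (v i)) = ∫⁻ v, f v :=
  (measurePreserving_pi_isometry j g).lintegral_comp hf

theorem lintegral_frame_isometry {n k : ℕ} (g : EucSpace n ≃ₗᵢ[ℝ] EucSpace n)
    {f : (Fin k → EucSpace n) × EucSpace n → ENNReal} (hf : Measurable f) :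
    ∫⁻ p : (Fin k → EucSpace n) × EucSpace n, f (fun i => g (p.1 i), g p.2) = ∫⁻ p, f p :=
  ((measurePreserving_pi_isometry k g).prod g.measurePreserving).lintegral_comp hf

theorem ae_frame_linearIndependent {n k : ℕ} (hk : k < n)
    (h : ∀ᵐ v : Fin k → EucSpace n, LinearIndependent ℝ v) :
    ∀ᵐ p : (Fin k → EucSpace n) × EucSpace n,
      LinearIndependent ℝ p.1 ∧ p.2 ∉ Submodule.span ℝ (Set.range p.1) := by
  have hc : Continuous fun p : (Fin k → EucSpace n) × EucSpace n =>
      wedge (Fin.cons p.2 p.1 : Fin (k + 1) → EucSpace n) := by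
    refine (continuous_wedge _ _).comp (continuous_pi fun i => ?_)
    refine Fin.cases ?_ (fun i => ?_) i
    · simpa using continuous_snd
    · simp only [Fin.cons_succ]
      fun_prop
  have hiff : ∀ p : (Fin k → EucSpace n) × EucSpace n,
      (LinearIndependent ℝ p.1 ∧ p.2 ∉ Submodule.span ℝ (Set.range p.1)) ↔
        wedge (Fin.cons p.2 p.1 : Fin (k + 1) → EucSpace n) ≠ 0 := by
    intro p
    rw [wedge_ne_zero_iff, linearIndependent_finCons]
  simp_rw [hiff]
  rw [ae_iff]
  have hm : MeasurableSet {p : (Fin k → EucSpace n) × EucSpace n |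
      ¬ wedge (Fin.cons p.2 p.1 : Fin (k + 1) → EucSpace n) ≠ 0} := by
    simp only [not_not]
    exact (isClosed_eq hc continuous_const).measurableSet
  rw [Measure.volume_eq_prod, Measure.measure_prod_null hm]
  filter_upwards [h] with v hv
  have hsub : Prod.mk v ⁻¹' {p : (Fin k → EucSpace n) × EucSpace n |
      ¬ wedge (Fin.cons p.2 p.1 : Fin (k + 1) → EucSpace n) ≠ 0} ⊆
      (Submodule.span ℝ (Set.range v) : Set (EucSpace n)) := by
    intro g hg
    by_contra hg'
    exact hg ((hiff (v, g)).mp ⟨hv, hg'⟩)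
  refine measure_mono_null hsub (Measure.addHaar_submodule _ _ ?_)
  intro htop
  have h1 : Module.finrank ℝ (Submodule.span ℝ (Set.range v)) = k := by
    rw [finrank_span_eq_card hv, Fintype.card_fin]
  rw [htop, finrank_top, finrank_euclideanSpace_fin] at h1
  omega

theorem ae_linearIndependent {n : ℕ} (j : ℕ) (hj : j ≤ n) :
    ∀ᵐ v : Fin j → EucSpace n, LinearIndependent ℝ v := by
  induction j with
  | zero => exact Filter.Eventually.of_forall fun v => linearIndependent_empty_type
  | succ j ih =>
    have h1 := ae_frame_linearIndependent (by omega) (ih (by omega))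
    have hmp := (volume_preserving_piFinSuccAbove (fun _ : Fin (j + 1) => EucSpace n) 0)
    have hsw : MeasurePreserving (Prod.swap : EucSpace n × (Fin j → EucSpace n) → _) :=
      Measure.measurePreserving_swap
    have h2 := hmp.quasiMeasurePreserving.ae (hsw.quasiMeasurePreserving.ae h1)
    filter_upwards [h2] with v hv
    have : v = Fin.cons (v 0) (Fin.tail v) := (Fin.cons_self_tail v).symm
    rw [this, linearIndependent_finCons]
    exact hv

theorem ae_flagOf_mem_setW {n k : ℕ} (hk : k < n) :
    ∀ᵐ p : (Fin k → EucSpace n) × EucSpace n, flagOf p ∈ setW n k := by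
  filter_upwards [ae_frame_linearIndependent hk (ae_linearIndependent k hk.le)] with p hp
  exact flagOf_mem_setW hp.1 hp.2

/-! ### Averages over the space of flags -/

theorem measurableSet_setW (n k : ℕ) : MeasurableSet (setW n k) :=
  (isCompact_setW n k).isClosed.measurableSet

theorem measurePreserving_flagAct {n k : ℕ} (m : ℕ) (g : EucSpace n ≃ₗᵢ[ℝ] EucSpace n) :
    MeasurePreserving (flagAct k g) (μHE[m].restrict (setW n k)) (μHE[m].restrict (setW n k)) := by
  have h := ((flagAct k g).toIsometryEquiv.measurePreserving_euclideanHausdorffMeasure m)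
  have := h.restrict_preimage (measurableSet_setW n k)
  change MeasurePreserving (flagAct k g) (μHE[m].restrict (flagAct k g ⁻¹' setW n k)) _ at this
  rwa [preimage_flagAct_setW] at this

theorem measurePreserving_flagFlip {n k : ℕ} (m : ℕ) :
    MeasurePreserving (flagFlip n k) (μHE[m].restrict (setW n k))
      (μHE[m].restrict (setW n k)) := by
  have h := ((flagFlip n k).toIsometryEquiv.measurePreserving_euclideanHausdorffMeasure m)
  have := h.restrict_preimage (measurableSet_setW n k)
  change MeasurePreserving (flagFlip n k) (μHE[m].restrict (flagFlip n k ⁻¹' setW n k)) _ at this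
  rwa [preimage_flagFlip_setW] at this

theorem indicator_ball {n k : ℕ} (x y : FlagAmbient n k) (r : ℝ) :
    ((Metric.ball x r).indicator 1 y : ENNReal) = if dist y x < r then 1 else 0 := by
  by_cases h : dist y x < r
  · rw [if_pos h, Set.indicator_of_mem (Metric.mem_ball.mpr h), Pi.one_apply]
  · rw [if_neg h, Set.indicator_of_notMem (fun h' => h (Metric.mem_ball.mp h'))]

/-- Balls of the same radius around points of `𝒲` have the same measure. -/
theorem measure_ball_eq {n k : ℕ} (m : ℕ) (r : ℝ) {p q : FlagAmbient n k} (hp : p ∈ setW n k)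
    (hq : q ∈ setW n k) : (μHE[m].restrict (setW n k)) (Metric.ball q r) =
      (μHE[m].restrict (setW n k)) (Metric.ball p r) := by
  have h1 : ∀ (g) (x : FlagAmbient n k), (μHE[m].restrict (setW n k))
      (Metric.ball (flagAct k g x) r) = (μHE[m].restrict (setW n k)) (Metric.ball x r) := by
    intro g x
    rw [← (measurePreserving_flagAct m g).measure_preimage
      Metric.isOpen_ball.measurableSet.nullMeasurableSet]
    congr 1
    ext y
    simp
  have h2 : ∀ (x : FlagAmbient n k), (μHE[m].restrict (setW n k))
      (Metric.ball (flagFlip n k x) r) = (μHE[m].restrict (setW n k)) (Metric.ball x r) := by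
    intro x
    rw [← (measurePreserving_flagFlip m).measure_preimage
      Metric.isOpen_ball.measurableSet.nullMeasurableSet]
    congr 1
    ext y
    simp
  obtain ⟨g, h | h⟩ := exists_flagAct_eq hp hq
  · rw [h, h1]
  · rw [h, h2, h1]

/-- The weight of the Gaussian frames whose flag is, up to orientation, in `B`. -/
noncomputable def flagWeight {n k : ℕ} (B : Set (FlagAmbient n k)) : ENNReal :=
  ∫⁻ p : (Fin k → EucSpace n) × EucSpace n, gaussFrame p *
    (B.indicator 1 (flagOf p) + B.indicator 1 (flagFlip n k (flagOf p)))

theorem measurable_flagWeight_integrand {n k : ℕ} {B : Set (FlagAmbient n k)}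
    (hB : MeasurableSet B) : Measurable fun p : (Fin k → EucSpace n) × EucSpace n =>
      gaussFrame p * (B.indicator 1 (flagOf p) + B.indicator 1 (flagFlip n k (flagOf p)) :
        ENNReal) := by
  have hi : Measurable (B.indicator 1 : FlagAmbient n k → ENNReal) := measurable_one.indicator hB
  exact measurable_gaussFrame.mul ((hi.comp measurable_flagOf).add
    (hi.comp ((flagFlip n k).continuous.measurable.comp measurable_flagOf)))

theorem flagWeight_ball_eq {n k : ℕ} (r : ℝ) {p q : FlagAmbient n k} (hp : p ∈ setW n k)
    (hq : q ∈ setW n k) : flagWeight (Metric.ball q r) = flagWeight (Metric.ball p r) := by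
  have hmeas := fun x : FlagAmbient n k =>
    measurable_flagWeight_integrand (Metric.isOpen_ball (x := x) (ε := r)).measurableSet
  have hind : ∀ (f : FlagAmbient n k ≃ₗᵢ[ℝ] FlagAmbient n k) (x y : FlagAmbient n k),
      ((Metric.ball (f x) r).indicator 1 (f y) : ENNReal) = (Metric.ball x r).indicator 1 y := by
    intro f x y
    rw [indicator_ball, indicator_ball, f.dist_map]
  have h1 : ∀ (g) (x : FlagAmbient n k),
      flagWeight (Metric.ball (flagAct k g x) r) = flagWeight (Metric.ball x r) := by
    intro g x
    rw [flagWeight, ← lintegral_frame_isometry g (hmeas _)]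
    refine lintegral_congr fun p => ?_
    rw [flagOf_map, ← flagAct_flagFlip, hind, hind]
    congr 1
    simp [gaussFrame, gaussPi_map, gaussW]
  have h2 : ∀ (x : FlagAmbient n k),
      flagWeight (Metric.ball (flagFlip n k x) r) = flagWeight (Metric.ball x r) := by
    intro x
    refine lintegral_congr fun p => ?_
    rw [hind, add_comm, ← hind (flagFlip n k) x (flagFlip n k (flagOf p)), flagFlip_flagFlip]
  obtain ⟨g, h | h⟩ := exists_flagAct_eq hp hq
  · rw [h, h1]
  · rw [h, h2, h1]

/-- Double counting of the pairs consisting of a point of `𝒲` and a Gaussian frame whose flag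
is within distance `r` of the point. -/
theorem measure_mul_flagWeight {n k : ℕ} (hk : k < n) (m : ℕ) (r : ℝ)
    [SFinite (μHE[m].restrict (setW n k))] {x : FlagAmbient n k} (hx : x ∈ setW n k) :
    μHE[m] (setW n k) * flagWeight (Metric.ball x r) =
      (∫⁻ p : (Fin k → EucSpace n) × EucSpace n, gaussFrame p) *
        (2 * (μHE[m].restrict (setW n k)) (Metric.ball x r)) := by
  have hB : ∀ f : ((Fin k → EucSpace n) × EucSpace n) → FlagAmbient n k, Measurable f →
      Measurable fun q : FlagAmbient n k × ((Fin k → EucSpace n) × EucSpace n) =>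
        ((Metric.ball q.1 r).indicator 1 (f q.2) : ENNReal) := by
    intro f hf
    have : (fun q : FlagAmbient n k × ((Fin k → EucSpace n) × EucSpace n) =>
        ((Metric.ball q.1 r).indicator 1 (f q.2) : ENNReal)) =
        {q | dist (f q.2) q.1 < r}.indicator 1 := by
      ext q
      rw [indicator_ball]
      rfl
    rw [this]
    exact measurable_one.indicator (measurableSet_lt
      ((hf.comp measurable_snd).dist measurable_fst) measurable_const)
  have hflip : Measurable fun p => flagFlip n k (flagOf p) :=
    (flagFlip n k).continuous.measurable.comp measurable_flagOf
  have hswap := lintegral_lintegral_swap (μ := μHE[m].restrict (setW n k))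
    (ν := (volume : Measure ((Fin k → EucSpace n) × EucSpace n)))
    (f := fun y p => gaussFrame p * ((Metric.ball y r).indicator 1 (flagOf p) +
      (Metric.ball y r).indicator 1 (flagFlip n k (flagOf p))))
    (((measurable_gaussFrame.comp measurable_snd).mul
      ((hB _ measurable_flagOf).add (hB _ hflip))).aemeasurable)
  have hleft : ∫⁻ y in setW n k, (∫⁻ p, gaussFrame p * ((Metric.ball y r).indicator 1 (flagOf p) +
      (Metric.ball y r).indicator 1 (flagFlip n k (flagOf p)))) ∂μHE[m] =
      μHE[m] (setW n k) * flagWeight (Metric.ball x r) := by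
    refine (setLIntegral_congr_fun (g := fun _ => flagWeight (Metric.ball x r))
      (measurableSet_setW n k) (fun y hy => flagWeight_ball_eq r hx hy)).trans ?_
    rw [setLIntegral_const, mul_comm]
  rw [← hleft, hswap, ← lintegral_mul_const _ measurable_gaussFrame]
  refine lintegral_congr_ae ?_
  filter_upwards [ae_flagOf_mem_setW hk] with p hp
  have hcount : ∀ z ∈ setW n k, ∫⁻ y in setW n k, ((Metric.ball y r).indicator 1 z : ENNReal)
      ∂μHE[m] = (μHE[m].restrict (setW n k)) (Metric.ball x r) := by
    intro z hz
    rw [← measure_ball_eq m r hx hz, ← lintegral_indicator_one Metric.isOpen_ball.measurableSet]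
    refine lintegral_congr fun y => ?_
    rw [indicator_ball, indicator_ball, dist_comm]
  have hm : ∀ z, Measurable fun y : FlagAmbient n k =>
      ((Metric.ball y r).indicator 1 z : ENNReal) := by
    intro z
    have : (fun y : FlagAmbient n k => ((Metric.ball y r).indicator 1 z : ENNReal)) =
        (Metric.ball z r).indicator 1 := by
      ext y
      rw [indicator_ball, indicator_ball, dist_comm]
    rw [this]
    exact measurable_one.indicator Metric.isOpen_ball.measurableSet
  refine (lintegral_const_mul _ ((hm _).add (hm _))).trans ?_
  congr 1
  refine (lintegral_add_left (hm _) _).trans ?_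
  rw [hcount _ hp, hcount _ (flagFlip_mem_setW hp), two_mul]

theorem lintegral_inner_wedge_eq {n k : ℕ} {ν ω : KVec n k} (hν : ν ∈ unitSimple n k)
    (hω : ω ∈ unitSimple n k) :
    ∫⁻ v : Fin k → EucSpace n, gaussPi Real.pi v * ENNReal.ofReal |inner ℝ ω (wedge v)| =
      ∫⁻ v : Fin k → EucSpace n, gaussPi Real.pi v * ENNReal.ofReal |inner ℝ ν (wedge v)| := by
  obtain ⟨u, hu, hωu⟩ := exists_eq_wedge_of_mem_unitSimple hω
  obtain ⟨w, hw, hνw⟩ := exists_eq_wedge_of_mem_unitSimple hν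
  have h1 : ∀ v : Fin k → EucSpace n, |inner ℝ ω (wedge v)| =
      |(inner ℝ (wedge u) (wedge v) : ℝ)| := by
    intro v
    rcases hωu with h | h
    · rw [h]
    · rw [h, inner_neg_left, abs_neg]
  have h2 : ∀ v : Fin k → EucSpace n, |inner ℝ ν (wedge v)| =
      |(inner ℝ (wedge w) (wedge v) : ℝ)| := by
    intro v
    rcases hνw with h | h
    · rw [h]
    · rw [h, inner_neg_left, abs_neg]
  simp_rw [h1, h2]
  obtain ⟨g, hg⟩ := exists_isometry_of_orthonormal hw hu
  have hm : Measurable fun v : Fin k → EucSpace n =>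
      gaussPi Real.pi v * ENNReal.ofReal |(inner ℝ (wedge u) (wedge v) : ℝ)| := by
    have hc : Continuous fun v : Fin k → EucSpace n => |(inner ℝ (wedge u) (wedge v) : ℝ)| :=
      (continuous_const.inner (continuous_wedge n k)).abs
    exact (measurable_gaussPi _).mul hc.measurable.ennreal_ofReal
  rw [← lintegral_pi_isometry g hm]
  refine lintegral_congr fun v => ?_
  rw [gaussPi_map, ← kMap_wedge]
  have : wedge u = kMap k g (wedge w) := by
    rw [kMap_wedge]
    congr 1
    ext1 i
    exact (hg i).symm
  rw [this, LinearIsometry.inner_map_map]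

theorem setLIntegral_inner_eq {n k : ℕ} (m : ℕ) {ν ω : KVec n k} (hν : ν ∈ unitSimple n k)
    (hω : ω ∈ unitSimple n k) :
    ∫⁻ p in setW n k, ENNReal.ofReal |inner ℝ ω p.snd| ∂μHE[m] =
      ∫⁻ p in setW n k, ENNReal.ofReal |inner ℝ ν p.snd| ∂μHE[m] := by
  obtain ⟨u, hu, hωu⟩ := exists_eq_wedge_of_mem_unitSimple hω
  obtain ⟨w, hw, hνw⟩ := exists_eq_wedge_of_mem_unitSimple hν
  have h1 : ∀ v : KVec n k, |inner ℝ ω v| = |(inner ℝ (wedge u) v : ℝ)| := by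
    intro v
    rcases hωu with h | h
    · rw [h]
    · rw [h, inner_neg_left, abs_neg]
  have h2 : ∀ v : KVec n k, |inner ℝ ν v| = |(inner ℝ (wedge w) v : ℝ)| := by
    intro v
    rcases hνw with h | h
    · rw [h]
    · rw [h, inner_neg_left, abs_neg]
  simp_rw [h1, h2]
  obtain ⟨g, hg⟩ := exists_isometry_of_orthonormal hw hu
  have hm : Measurable fun p : FlagAmbient n k =>
      ENNReal.ofReal |(inner ℝ (wedge u) p.snd : ℝ)| := by
    have hc : Continuous fun p : FlagAmbient n k => |(inner ℝ (wedge u) p.snd : ℝ)| :=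
      (continuous_const.inner (WithLp.continuous_snd 2 _ _)).abs
    exact hc.measurable.ennreal_ofReal
  rw [← (measurePreserving_flagAct m g).lintegral_comp hm]
  refine lintegral_congr fun p => ?_
  have : wedge u = kMap k g (wedge w) := by
    rw [kMap_wedge]
    congr 1
    ext1 i
    exact (hg i).symm
  rw [this, flagAct_snd, LinearIsometry.inner_map_map]

/-- Double counting for the function `|ω · (v₁ ∧ ⋯ ∧ vₖ)|` of a point of `𝒲` and a Gaussian
family of vectors. -/
theorem setLIntegral_inner_mul {n k : ℕ} (m : ℕ) [SFinite (μHE[m].restrict (setW n k))]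
    {ν : KVec n k} (hν : ν ∈ unitSimple n k) :
    (∫⁻ v : Fin k → EucSpace n, gaussPi Real.pi v * ENNReal.ofReal ‖wedge v‖) *
      ∫⁻ p in setW n k, ENNReal.ofReal |inner ℝ ν p.snd| ∂μHE[m] =
    μHE[m] (setW n k) *
      ∫⁻ v : Fin k → EucSpace n, gaussPi Real.pi v * ENNReal.ofReal |inner ℝ ν (wedge v)| := by
  have hcont : Continuous fun q : FlagAmbient n k × (Fin k → EucSpace n) =>
      |(inner ℝ q.1.snd (wedge q.2) : ℝ)| :=
    (((WithLp.continuous_snd 2 _ _).comp continuous_fst).inner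
      ((continuous_wedge n k).comp continuous_snd)).abs
  have hswap := lintegral_lintegral_swap (μ := μHE[m].restrict (setW n k))
    (ν := (volume : Measure (Fin k → EucSpace n)))
    (f := fun p v => gaussPi Real.pi v * ENNReal.ofReal |inner ℝ p.snd (wedge v)|)
    ((((measurable_gaussPi _).comp measurable_snd).mul
      hcont.measurable.ennreal_ofReal).aemeasurable)
  have hleft : ∫⁻ p in setW n k, (∫⁻ v, gaussPi Real.pi v *
      ENNReal.ofReal |inner ℝ p.snd (wedge v)|) ∂μHE[m] = μHE[m] (setW n k) *
      ∫⁻ v : Fin k → EucSpace n, gaussPi Real.pi v * ENNReal.ofReal |inner ℝ ν (wedge v)| := by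
    rw [setLIntegral_congr_fun (measurableSet_setW n k)
      (fun p hp => lintegral_inner_wedge_eq hν hp.2.1), setLIntegral_const, mul_comm]
  have hm : Measurable fun v : Fin k → EucSpace n =>
      gaussPi Real.pi v * ENNReal.ofReal ‖wedge v‖ :=
    (measurable_gaussPi _).mul (continuous_wedge n k).norm.measurable.ennreal_ofReal
  rw [← hleft, hswap, ← lintegral_mul_const _ hm]
  refine lintegral_congr fun v => ?_
  have hm2 : ∀ w : KVec n k, Measurable fun p : FlagAmbient n k =>
      ENNReal.ofReal |(inner ℝ w p.snd : ℝ)| := by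
    intro w
    have hc : Continuous fun p : FlagAmbient n k => |(inner ℝ w p.snd : ℝ)| :=
      (continuous_const.inner (WithLp.continuous_snd 2 _ _)).abs
    exact hc.measurable.ennreal_ofReal
  simp_rw [real_inner_comm (wedge v)]
  rw [lintegral_const_mul _ (hm2 _), mul_assoc]
  congr 1
  by_cases h0 : wedge v = 0
  · simp [h0]
  · have hne : ‖wedge v‖ ≠ 0 := norm_ne_zero_iff.mpr h0
    have hω : ‖wedge v‖⁻¹ • wedge v ∈ unitSimple n k := by
      refine ⟨⟨_, v, rfl⟩, ?_⟩
      rw [norm_smul, norm_inv, norm_norm, inv_mul_cancel₀ hne]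
    rw [← setLIntegral_inner_eq m hν hω, ← lintegral_const_mul _ (hm2 _)]
    refine lintegral_congr fun p => ?_
    have hin : (inner ℝ (‖wedge v‖⁻¹ • wedge v) p.snd : ℝ) =
        ‖wedge v‖⁻¹ * inner ℝ (wedge v) p.snd :=
      real_inner_smul_left (F := KVec n k) (wedge v) p.snd _
    rw [← ENNReal.ofReal_mul (norm_nonneg _), hin, abs_mul, abs_inv, abs_norm,
      mul_inv_cancel_left₀ hne]

/-! ### Gaussian integrals -/

/-- The linear isometry `ℝᵏ⁺ˡ ≃ ℝᵏ × ℝˡ`. -/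
noncomputable def splitEuc (k l : ℕ) :
    EucSpace (k + l) ≃ₗᵢ[ℝ] WithLp 2 (EucSpace k × EucSpace l) :=
  (LinearIsometryEquiv.piLpCongrLeft 2 ℝ ℝ finSumFinEquiv.symm).trans
    (PiLp.sumPiLpEquivProdLpPiLp 2 _)

/-- The vector of `ℝᵏ⁺ˡ` with components `x ∈ ℝᵏ` and `y ∈ ℝˡ`. -/
noncomputable def joinEuc {k l : ℕ} (x : EucSpace k) (y : EucSpace l) : EucSpace (k + l) :=
  (splitEuc k l).symm (WithLp.toLp 2 (x, y))

theorem joinEuc_add {k l : ℕ} (x x' : EucSpace k) (y y' : EucSpace l) :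
    joinEuc (x + x') (y + y') = joinEuc x y + joinEuc x' y' :=
  map_add (splitEuc k l).symm (WithLp.toLp 2 (x, y)) (WithLp.toLp 2 (x', y'))

theorem joinEuc_smul {k l : ℕ} (c : ℝ) (x : EucSpace k) (y : EucSpace l) :
    joinEuc (c • x) (c • y) = c • joinEuc x y :=
  map_smul (splitEuc k l).symm c (WithLp.toLp 2 (x, y))

theorem inner_joinEuc {k l : ℕ} (x x' : EucSpace k) (y y' : EucSpace l) :
    (inner ℝ (joinEuc x y) (joinEuc x' y') : ℝ) = inner ℝ x x' + inner ℝ y y' :=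
  ((splitEuc k l).symm.inner_map_map _ _).trans (WithLp.prod_inner_apply _ _)

theorem norm_joinEuc_sq {k l : ℕ} (x : EucSpace k) (y : EucSpace l) :
    ‖joinEuc x y‖ ^ 2 = ‖x‖ ^ 2 + ‖y‖ ^ 2 := by
  rw [← real_inner_self_eq_norm_sq, inner_joinEuc, real_inner_self_eq_norm_sq,
    real_inner_self_eq_norm_sq]

theorem exists_joinEuc_eq {k l : ℕ} (v : EucSpace (k + l)) :
    ∃ (x : EucSpace k) (y : EucSpace l), v = joinEuc x y :=
  ⟨(splitEuc k l v).fst, (splitEuc k l v).snd, ((splitEuc k l).symm_apply_apply v).symm⟩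

theorem joinEuc_sum {k l : ℕ} {ι : Type*} (s : Finset ι) (x : ι → EucSpace k)
    (y : ι → EucSpace l) : joinEuc (∑ i ∈ s, x i) (∑ i ∈ s, y i) = ∑ i ∈ s, joinEuc (x i) (y i) := by
  induction s using Finset.cons_induction with
  | empty =>
    simp only [Finset.sum_empty]
    exact map_zero (splitEuc k l).symm
  | cons a s ha ih => rw [Finset.sum_cons, Finset.sum_cons, Finset.sum_cons, joinEuc_add, ih]

theorem measurePreserving_joinEuc (k l : ℕ) :
    MeasurePreserving fun p : EucSpace k × EucSpace l => joinEuc p.1 p.2 :=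
  (splitEuc k l).symm.measurePreserving.comp (WithLp.volume_preserving_toLp _ _)

theorem gaussW_joinEuc {k l : ℕ} (b : ℝ) (x : EucSpace k) (y : EucSpace l) :
    gaussW b (joinEuc x y) = gaussW b x * gaussW b y := by
  rw [gaussW, norm_joinEuc_sq, mul_add, Real.exp_add, ENNReal.ofReal_mul (Real.exp_pos _).le]
  rfl

theorem gaussPi_joinEuc {k l j : ℕ} (b : ℝ) (x : Fin j → EucSpace k) (y : Fin j → EucSpace l) :
    gaussPi b (fun i => joinEuc (x i) (y i)) = gaussPi b x * gaussPi b y := by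
  simp_rw [gaussPi, gaussW_joinEuc, Finset.prod_mul_distrib]

theorem lintegral_gaussW {E : Type*} [NormedAddCommGroup E] [InnerProductSpace ℝ E]
    [FiniteDimensional ℝ E] [MeasurableSpace E] [BorelSpace E] {b : ℝ} (hb : 0 < b) :
    ∫⁻ x : E, gaussW b x = ENNReal.ofReal ((Real.pi / b) ^ ((Module.finrank ℝ E : ℝ) / 2)) := by
  have h := GaussianFourier.integral_rexp_neg_mul_sq_norm (V := E) hb
  rw [← h, ofReal_integral_eq_lintegral_ofReal]
  · rfl
  · by_contra hni
    rw [integral_undef hni] at h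
    have : 0 < (Real.pi / b) ^ ((Module.finrank ℝ E : ℝ) / 2) := by positivity
    exact this.ne h
  · exact Filter.Eventually.of_forall fun x => (Real.exp_pos _).le

theorem lintegral_gaussW_pi {E : Type*} [NormedAddCommGroup E] [InnerProductSpace ℝ E]
    [FiniteDimensional ℝ E] [MeasurableSpace E] [BorelSpace E] :
    ∫⁻ x : E, gaussW Real.pi x = 1 := by
  rw [lintegral_gaussW Real.pi_pos, div_self Real.pi_pos.ne', Real.one_rpow, ENNReal.ofReal_one]

theorem lintegral_finCons {E : Type*} [MeasureSpace E] [SigmaFinite (volume : Measure E)] {j : ℕ}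
    {f : (Fin (j + 1) → E) → ENNReal} (hf : Measurable f) :
    ∫⁻ v, f v = ∫⁻ v : Fin j → E, ∫⁻ g : E, f (Fin.cons g v : Fin (j + 1) → E) := by
  have hmp := volume_preserving_piFinSuccAbove (fun _ : Fin (j + 1) => E) 0
  have hcons : ∀ p : E × (Fin j → E),
      (MeasurableEquiv.piFinSuccAbove (fun _ : Fin (j + 1) => E) 0).symm p =
        Fin.cons p.1 p.2 := fun p => Fin.insertNth_zero' _ _
  rw [← hmp.symm.lintegral_comp hf, Measure.volume_eq_prod, lintegral_prod_symm]
  · simp_rw [hcons]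
  · exact (hf.comp (MeasurableEquiv.measurable _)).aemeasurable

theorem gaussPi_cons {E : Type*} [NormedAddCommGroup E] {j : ℕ} (b : ℝ) (g : E) (v : Fin j → E) :
    gaussPi b (Fin.cons g v : Fin (j + 1) → E) = gaussW b g * gaussPi b v := by
  simp [gaussPi, Fin.prod_univ_succ]

theorem lintegral_gaussPi {E : Type*} [NormedAddCommGroup E] [InnerProductSpace ℝ E]
    [FiniteDimensional ℝ E] [MeasurableSpace E] [BorelSpace E] (b : ℝ) (j : ℕ) :
    ∫⁻ v : Fin j → E, gaussPi b v = (∫⁻ x : E, gaussW b x) ^ j := by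
  induction j with
  | zero => simp [gaussPi, volume_pi]
  | succ j ih =>
    rw [lintegral_finCons (measurable_gaussPi b)]
    simp_rw [gaussPi_cons]
    have h : ∀ v : Fin j → E, ∫⁻ g : E, gaussW b g * gaussPi b v =
        (∫⁻ x : E, gaussW b x) * gaussPi b v := fun v =>
      lintegral_mul_const _ (measurable_gaussW b)
    simp_rw [h]
    rw [lintegral_const_mul _ (measurable_gaussPi b), ih, pow_succ']

theorem lintegral_gaussFrame {n k : ℕ} :
    ∫⁻ p : (Fin k → EucSpace n) × EucSpace n, gaussFrame p = 1 := by
  simp_rw [gaussFrame]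
  rw [Measure.volume_eq_prod, lintegral_prod_mul (measurable_gaussPi _).aemeasurable
    (measurable_gaussW _).aemeasurable, lintegral_gaussPi, lintegral_gaussW_pi]
  simp

/-- The absolute moments of a Gaussian vector in `ℝˡ`: the integral of `‖x‖ ^ s * exp (-b ‖x‖²)`. -/
noncomputable def radialMoment (l s : ℕ) (b : ℝ) : ℝ :=
  Real.pi ^ ((l : ℝ) / 2) * Real.Gamma (((l : ℝ) + s) / 2) /
    (Real.Gamma ((l : ℝ) / 2) * b ^ (((l : ℝ) + s) / 2))

theorem radialMoment_pos {l : ℕ} (hl : 0 < l) (s : ℕ) {b : ℝ} (hb : 0 < b) :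
    0 < radialMoment l s b := by
  have hl' : (0 : ℝ) < l := by exact_mod_cast hl
  have h1 : 0 < Real.Gamma (((l : ℝ) + s) / 2) := Real.Gamma_pos_of_pos (by positivity)
  have h2 : 0 < Real.Gamma ((l : ℝ) / 2) := Real.Gamma_pos_of_pos (by positivity)
  have h3 := Real.pi_pos
  unfold radialMoment
  positivity

theorem lintegral_norm_pow_gaussW {l : ℕ} (hl : 0 < l) (s : ℕ) {b : ℝ} (hb : 0 < b) :
    ∫⁻ y : EucSpace l, gaussW b y * ENNReal.ofReal (‖y‖ ^ s) =
      ENNReal.ofReal (radialMoment l s b) := by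
  have hl' : (0 : ℝ) < l := by exact_mod_cast hl
  have : Nonempty (Fin l) := ⟨⟨0, hl⟩⟩
  have : Nontrivial (EucSpace l) := by
    apply Module.nontrivial_of_finrank_pos (R := ℝ)
    rwa [finrank_euclideanSpace_fin]
  have hexp : ∀ r ∈ Set.Ioi (0 : ℝ), r ^ (Module.finrank ℝ (EucSpace l) - 1) •
      (Real.exp (-b * r ^ 2) * r ^ s) =
      r ^ ((l : ℝ) + s - 1) * Real.exp (-b * r ^ (2 : ℝ)) := by
    intro r hr
    have hr' : (0 : ℝ) < r := hr
    have : ((l : ℝ) + s - 1) = ((l - 1 + s : ℕ) : ℝ) := by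
      push_cast [Nat.cast_sub (show 1 ≤ l from hl)]
      ring
    rw [finrank_euclideanSpace_fin, this, Real.rpow_natCast, Real.rpow_two, smul_eq_mul, pow_add]
    ring
  have hq : -1 < (l : ℝ) + s - 1 := by
    have : (0 : ℝ) ≤ s := Nat.cast_nonneg s
    linarith
  have hint : Integrable fun y : EucSpace l => Real.exp (-b * ‖y‖ ^ 2) * ‖y‖ ^ s := by
    rw [integrable_fun_norm_addHaar (volume : Measure (EucSpace l))
      (f := fun r => Real.exp (-b * r ^ 2) * r ^ s),
      integrableOn_congr_fun hexp measurableSet_Ioi]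
    exact integrableOn_rpow_mul_exp_neg_mul_rpow hq (by norm_num) hb
  have hval : ∫ y : EucSpace l, Real.exp (-b * ‖y‖ ^ 2) * ‖y‖ ^ s = radialMoment l s b := by
    rw [integral_fun_norm_addHaar (volume : Measure (EucSpace l))
      (fun r => Real.exp (-b * r ^ 2) * r ^ s), setIntegral_congr_fun measurableSet_Ioi hexp,
      integral_rpow_mul_exp_neg_mul_rpow (by norm_num) hq hb, Measure.real,
      EuclideanSpace.volume_ball, finrank_euclideanSpace_fin, Fintype.card_fin,
      Real.Gamma_add_one (by positivity), sub_add_cancel, ENNReal.ofReal_one, one_pow, one_mul,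
      ENNReal.toReal_ofReal (by
        have := Real.Gamma_pos_of_pos (half_pos hl')
        positivity)]
    have h1 : √Real.pi ^ l = Real.pi ^ ((l : ℝ) / 2) := by
      rw [Real.sqrt_eq_rpow, ← Real.rpow_natCast, ← Real.rpow_mul Real.pi_pos.le]
      congr 1
      ring
    have h2 : b ^ (-((l : ℝ) + s) / 2) = (b ^ (((l : ℝ) + s) / 2))⁻¹ := by
      rw [← Real.rpow_neg hb.le]
      congr 1
      ring
    have h3 := (Real.Gamma_pos_of_pos (half_pos hl')).ne'
    have h4 : b ^ (((l : ℝ) + s) / 2) ≠ 0 := (Real.rpow_pos_of_pos hb _).ne'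
    rw [h1, h2, radialMoment]
    simp only [nsmul_eq_mul, smul_eq_mul]
    field_simp
  rw [← hval, ofReal_integral_eq_lintegral_ofReal hint
    (Filter.Eventually.of_forall fun y => by positivity)]
  refine lintegral_congr fun y => ?_
  rw [ENNReal.ofReal_mul (Real.exp_pos _).le]
  rfl

/-- The integral over one factor of a wedge product, the others being orthonormal. -/
theorem lintegral_norm_wedge_cons {j l : ℕ} (hl : 0 < l) (s : ℕ) {b : ℝ} (hb : 0 < b)
    {u : Fin j → EucSpace (j + l)} (hu : Orthonormal ℝ u) :
    ∫⁻ g, gaussW b g *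
      ENNReal.ofReal (‖wedge (Fin.cons g u : Fin (j + 1) → EucSpace (j + l))‖ ^ s) =
      ENNReal.ofReal ((Real.pi / b) ^ ((j : ℝ) / 2) * radialMoment l s b) := by
  let e : Fin j → EucSpace (j + l) := fun i => joinEuc (EuclideanSpace.single i 1) 0
  have he : Orthonormal ℝ e := by
    rw [orthonormal_iff_ite]
    intro i i'
    simp only [e]
    rw [inner_joinEuc, inner_zero_left, add_zero,
      orthonormal_iff_ite.mp (EuclideanSpace.orthonormal_single (𝕜 := ℝ)) i i']
  obtain ⟨h, hh⟩ := exists_isometry_of_orthonormal hu he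
  have hn : ∀ g, ‖wedge (Fin.cons (h g) e : Fin (j + 1) → EucSpace (j + l))‖ =
      ‖wedge (Fin.cons g u : Fin (j + 1) → EucSpace (j + l))‖ := by
    intro g
    rw [← (kMap (j + 1) h).norm_map (wedge (Fin.cons g u : Fin (j + 1) → EucSpace (j + l))),
      kMap_wedge]
    congr 2
    ext1 i
    refine Fin.cases ?_ (fun i => ?_) i
    · simp
    · simp [hh]
  have hm : Measurable fun g : EucSpace (j + l) => gaussW b g *
      ENNReal.ofReal (‖wedge (Fin.cons g e : Fin (j + 1) → EucSpace (j + l))‖ ^ s) := by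
    refine (measurable_gaussW b).mul (Continuous.measurable ?_).ennreal_ofReal
    refine (Continuous.norm ((continuous_wedge _ _).comp (continuous_pi fun i => ?_))).pow s
    refine Fin.cases ?_ (fun i => ?_) i
    · simp only [Fin.cons_zero]
      fun_prop
    · simpa using continuous_const
  have h1 : ∫⁻ g, gaussW b g *
      ENNReal.ofReal (‖wedge (Fin.cons g u : Fin (j + 1) → EucSpace (j + l))‖ ^ s) =
      ∫⁻ g, gaussW b g *
      ENNReal.ofReal (‖wedge (Fin.cons g e : Fin (j + 1) → EucSpace (j + l))‖ ^ s) := by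
    rw [← h.measurePreserving.lintegral_comp hm]
    refine lintegral_congr fun g => ?_
    rw [hn]
    simp [gaussW]
  have hnorm : ∀ (x : EucSpace j) (y : EucSpace l),
      ‖wedge (Fin.cons (joinEuc x y) e : Fin (j + 1) → EucSpace (j + l))‖ = ‖y‖ := by
    intro x y
    rw [norm_wedge_cons he]
    have h2 : ∑ i, (inner ℝ (e i) (joinEuc x y) : ℝ) • e i = joinEuc x (0 : EucSpace l) := by
      have : ∀ i, (inner ℝ (e i) (joinEuc x y) : ℝ) • e i =
          joinEuc (x i • EuclideanSpace.single i (1 : ℝ)) (0 : EucSpace l) := by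
        intro i
        simp only [e]
        rw [inner_joinEuc, inner_zero_left, add_zero, ← joinEuc_smul, smul_zero]
        congr 2
        rw [real_inner_comm]
        exact (EuclideanSpace.inner_single_right i (1 : ℝ) x).trans (by simp)
      simp_rw [this]
      have h3 := joinEuc_sum (l := l) Finset.univ
        (fun i => x i • EuclideanSpace.single i (1 : ℝ)) (fun _ => 0)
      rw [← h3, Finset.sum_const_zero]
      congr 1
      have := (EuclideanSpace.basisFun (Fin j) ℝ).sum_repr x
      simpa using this
    have h3 : joinEuc x y - joinEuc x (0 : EucSpace l) = joinEuc 0 y := by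
      rw [sub_eq_iff_eq_add, ← joinEuc_add, zero_add, add_zero]
    rw [h2, h3]
    have := norm_joinEuc_sq (0 : EucSpace j) y
    rw [norm_zero, zero_pow two_ne_zero, zero_add] at this
    exact (sq_eq_sq₀ (norm_nonneg _) (norm_nonneg _)).mp this
  rw [h1, ← (measurePreserving_joinEuc j l).lintegral_comp hm]
  simp_rw [hnorm, gaussW_joinEuc, mul_assoc]
  rw [Measure.volume_eq_prod, lintegral_prod_mul (g := fun y : EucSpace l =>
      gaussW b y * ENNReal.ofReal (‖y‖ ^ s)) (measurable_gaussW b).aemeasurable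
    ((measurable_gaussW b).mul (by fun_prop)).aemeasurable, lintegral_gaussW hb,
    lintegral_norm_pow_gaussW hl s hb, finrank_euclideanSpace_fin,
    ENNReal.ofReal_mul (by positivity)]

/-- The moments of the volume of the parallelepiped spanned by `j` Gaussian vectors of `ℝᴺ`. -/
theorem lintegral_norm_wedge_pow {N : ℕ} (j : ℕ) (hj : j ≤ N) {s : ℕ} (hs : s ≠ 0) {b : ℝ}
    (hb : 0 < b) : ∫⁻ v : Fin j → EucSpace N, gaussPi b v * ENNReal.ofReal (‖wedge v‖ ^ s) =
      ENNReal.ofReal (∏ i ∈ Finset.range j,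
        ((Real.pi / b) ^ ((i : ℝ) / 2) * radialMoment (N - i) s b)) := by
  induction j with
  | zero =>
    have : ∀ v : Fin 0 → EucSpace N, gaussPi b v * ENNReal.ofReal (‖wedge v‖ ^ s) = 1 := by
      intro v
      have hv : Orthonormal ℝ v := ⟨fun i => i.elim0, fun i => i.elim0⟩
      rw [norm_wedge_of_orthonormal hv]
      simp [gaussPi]
    simp_rw [this]
    simp [volume_pi]
  | succ j ih =>
    have hm : ∀ j', Measurable fun v : Fin j' → EucSpace N =>
        gaussPi b v * ENNReal.ofReal (‖wedge v‖ ^ s) := fun j' =>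
      (measurable_gaussPi b).mul ((continuous_wedge N j').norm.pow s).measurable.ennreal_ofReal
    rw [lintegral_finCons (hm (j + 1))]
    have hinner : ∀ v : Fin j → EucSpace N, (∫⁻ g : EucSpace N,
        gaussPi b (Fin.cons g v : Fin (j + 1) → EucSpace N) *
          ENNReal.ofReal (‖wedge (Fin.cons g v : Fin (j + 1) → EucSpace N)‖ ^ s)) =
        (gaussPi b v * ENNReal.ofReal (‖wedge v‖ ^ s)) *
          ENNReal.ofReal ((Real.pi / b) ^ ((j : ℝ) / 2) * radialMoment (N - j) s b) := by
      intro v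
      simp_rw [gaussPi_cons]
      by_cases hv : wedge v = 0
      · have h0 : ∀ g, wedge (Fin.cons g v : Fin (j + 1) → EucSpace N) = 0 := by
          intro g
          have := wedge_cons_eq_smul (c := 0) (v := v) (u := v) (by rw [hv, smul_zero]) g
          rwa [zero_smul] at this
        simp [h0, hv, hs]
      · obtain ⟨u, X, hu, -, hX⟩ :=
          exists_orthonormal_of_linearIndependent (wedge_ne_zero_iff.mp hv)
        have hw : wedge v = X.det • wedge u := by
          rw [← wedge_sum_smul, ← hX]
        have hnv : ‖wedge v‖ = |X.det| := by
          rw [hw, norm_smul, norm_wedge_of_orthonormal hu, mul_one, Real.norm_eq_abs]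
        obtain ⟨l, rfl⟩ := Nat.exists_eq_add_of_le (show j ≤ N by omega)
        have hl : 0 < l := by omega
        have h1 : ∀ g, gaussW b g * gaussPi b v * ENNReal.ofReal
            (‖wedge (Fin.cons g v : Fin (j + 1) → EucSpace (j + l))‖ ^ s) =
            (gaussPi b v * ENNReal.ofReal (‖wedge v‖ ^ s)) * (gaussW b g * ENNReal.ofReal
            (‖wedge (Fin.cons g u : Fin (j + 1) → EucSpace (j + l))‖ ^ s)) := by
          intro g
          rw [wedge_cons_eq_smul hw, norm_smul, Real.norm_eq_abs, ← hnv, mul_pow,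
            ENNReal.ofReal_mul (by positivity)]
          ring
        simp_rw [h1]
        rw [lintegral_const_mul', lintegral_norm_wedge_cons hl s hb hu, Nat.add_sub_cancel_left]
        refine ENNReal.mul_ne_top ?_ ENNReal.ofReal_ne_top
        exact ENNReal.prod_ne_top fun i _ => ENNReal.ofReal_ne_top
    simp_rw [hinner]
    rw [lintegral_mul_const _ (hm j), ih (by omega), Finset.prod_range_succ, ← ENNReal.ofReal_mul]
    apply Finset.prod_nonneg
    intro i hi
    have hr := radialMoment_pos (show 0 < N - i by have := Finset.mem_range.mp hi; omega) s hb
    have hπ := Real.pi_pos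
    positivity

/-! ### A chart of the space of flags -/

/-- The inclusion of the second factor of `ℝᵏ⁺ˡ = ℝᵏ × ℝˡ`. -/
noncomputable def botEuc (k l : ℕ) : EucSpace l →ₗᵢ[ℝ] EucSpace (k + l) where
  toFun y := joinEuc 0 y
  map_add' y y' := by rw [← joinEuc_add, add_zero]
  map_smul' c y := by rw [RingHom.id_apply, ← joinEuc_smul, smul_zero]
  norm_map' y := by
    have := norm_joinEuc_sq (0 : EucSpace k) y
    rw [norm_zero, zero_pow two_ne_zero, zero_add] at this
    exact (sq_eq_sq₀ (norm_nonneg _) (norm_nonneg _)).mp this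

/-- The inclusion of the first factor of `ℝᵏ⁺ˡ = ℝᵏ × ℝˡ`. -/
noncomputable def topEuc (k l : ℕ) : EucSpace k →ₗᵢ[ℝ] EucSpace (k + l) where
  toFun x := joinEuc x 0
  map_add' y y' := by rw [← joinEuc_add, add_zero]
  map_smul' c y := by rw [RingHom.id_apply, ← joinEuc_smul, smul_zero]
  norm_map' y := by
    have := norm_joinEuc_sq y (0 : EucSpace l)
    rw [norm_zero, zero_pow two_ne_zero, add_zero] at this
    exact (sq_eq_sq₀ (norm_nonneg _) (norm_nonneg _)).mp this

theorem joinEuc_eq {k l : ℕ} (x : EucSpace k) (y : EucSpace l) :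
    joinEuc x y = topEuc k l x + botEuc k l y := by
  change joinEuc x y = joinEuc x 0 + joinEuc 0 y
  rw [← joinEuc_add, add_zero, zero_add]

@[simp] theorem inner_topEuc_botEuc {k l : ℕ} (x : EucSpace k) (y : EucSpace l) :
    (inner ℝ (topEuc k l x) (botEuc k l y) : ℝ) = 0 := by
  change (inner ℝ (joinEuc x 0) (joinEuc 0 y) : ℝ) = 0
  rw [inner_joinEuc, inner_zero_left, inner_zero_right, add_zero]

@[simp] theorem inner_botEuc_topEuc {k l : ℕ} (x : EucSpace k) (y : EucSpace l) :
    (inner ℝ (botEuc k l y) (topEuc k l x) : ℝ) = 0 := by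
  rw [real_inner_comm, inner_topEuc_botEuc]

/-- The first `k` standard basis vectors of `ℝᵏ⁺ˡ`. -/
noncomputable def stdTop (k l : ℕ) (i : Fin k) : EucSpace (k + l) :=
  topEuc k l (EuclideanSpace.single i 1)

theorem orthonormal_stdTop (k l : ℕ) : Orthonormal ℝ (stdTop k l) :=
  (EuclideanSpace.orthonormal_single (𝕜 := ℝ)).comp_linearIsometry (topEuc k l)

theorem topEuc_eq_sum {k l : ℕ} (x : EucSpace k) : topEuc k l x = ∑ i, x i • stdTop k l i := by
  have := (EuclideanSpace.basisFun (Fin k) ℝ).sum_repr x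
  rw [← congrArg (topEuc k l) this, map_sum]
  simp [stdTop]

@[simp] theorem inner_stdTop_topEuc {k l : ℕ} (i : Fin k) (x : EucSpace k) :
    (inner ℝ (stdTop k l i) (topEuc k l x) : ℝ) = x i := by
  rw [stdTop, LinearIsometry.inner_map_map]
  simp [EuclideanSpace.inner_single_left]

@[simp] theorem inner_stdTop_botEuc {k l : ℕ} (i : Fin k) (y : EucSpace l) :
    (inner ℝ (stdTop k l i) (botEuc k l y) : ℝ) = 0 := inner_topEuc_botEuc _ _

@[simp] theorem inner_botEuc_stdTop {k l : ℕ} (i : Fin k) (y : EucSpace l) :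
    (inner ℝ (botEuc k l y) (stdTop k l i) : ℝ) = 0 := inner_botEuc_topEuc _ _

theorem inner_stdTop_stdTop {k l : ℕ} (i j : Fin k) :
    (inner ℝ (stdTop k l i) (stdTop k l j) : ℝ) = if i = j then 1 else 0 :=
  orthonormal_iff_ite.mp (orthonormal_stdTop k l) i j

/-- The basis `eᵢ + Zᵢ` of the graph of the linear map `ℝᵏ → ℝˡ` with columns `Zᵢ`. -/
noncomputable def graphFrame {k l : ℕ} (Z : Fin k → EucSpace l) (i : Fin k) : EucSpace (k + l) :=
  stdTop k l i + botEuc k l (Z i)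

theorem sum_smul_graphFrame {k l : ℕ} (x : EucSpace k) (Z : Fin k → EucSpace l) :
    ∑ j, x j • graphFrame Z j = joinEuc x (∑ j, x j • Z j) := by
  simp_rw [graphFrame, smul_add, Finset.sum_add_distrib, joinEuc_eq, topEuc_eq_sum, map_sum,
    map_smul]

theorem inner_graphFrame_wedge_stdTop {k l : ℕ} (Z : Fin k → EucSpace l) :
    (inner ℝ (wedge (graphFrame Z)) (wedge (stdTop k l)) : ℝ) = 1 := by
  rw [inner_wedge]
  convert Matrix.det_one (R := ℝ) (n := Fin k)
  ext i j
  simp [graphFrame, inner_add_left, inner_stdTop_stdTop, Matrix.one_apply]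

/-- The columns `Zᵢ` are the Plücker coordinates of the graph. -/
theorem inner_graphFrame_wedge_update {k l : ℕ} (Z : Fin k → EucSpace l) (i : Fin k)
    (y : EucSpace l) : (inner ℝ (wedge (graphFrame Z))
      (wedge (Function.update (stdTop k l) i (botEuc k l y))) : ℝ) = inner ℝ (Z i) y := by
  rw [inner_wedge]
  have : (Matrix.of fun a b => (inner ℝ (graphFrame Z a)
      (Function.update (stdTop k l) i (botEuc k l y) b) : ℝ)) =
      (1 : Matrix (Fin k) (Fin k) ℝ).updateCol i (fun a => inner ℝ (Z a) y) := by
    ext a b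
    rw [Matrix.of_apply, Matrix.updateCol_apply]
    by_cases h : b = i
    · rw [if_pos h, h, Function.update_self]
      simp [graphFrame, inner_add_left]
    · rw [if_neg h, Function.update_of_ne h]
      simp [graphFrame, inner_add_left, inner_stdTop_stdTop, Matrix.one_apply]
  rw [this, ← Matrix.cramer_apply, Matrix.cramer_one]
  rfl

theorem wedge_graphFrame_ne_zero {k l : ℕ} (Z : Fin k → EucSpace l) : wedge (graphFrame Z) ≠ 0 := by
  intro h
  have := inner_graphFrame_wedge_stdTop Z
  rw [h, inner_zero_left] at this
  exact zero_ne_one this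

/-- The last standard basis vector of `ℝᵈ⁺¹`. -/
noncomputable def lastVec (d : ℕ) : EucSpace (d + 1) := botEuc d 1 (EuclideanSpace.single 0 1)

theorem norm_lastVec (d : ℕ) : ‖lastVec d‖ = 1 := by
  rw [lastVec, LinearIsometry.norm_map]
  simp

@[simp] theorem inner_lastVec_topEuc {d : ℕ} (c : EucSpace d) :
    (inner ℝ (lastVec d) (topEuc d 1 c) : ℝ) = 0 := inner_botEuc_topEuc _ _

theorem inner_lastVec_self (d : ℕ) : (inner ℝ (lastVec d) (lastVec d) : ℝ) = 1 := by
  rw [real_inner_self_eq_norm_sq, norm_lastVec, one_pow]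

/-- The first `d` components of a vector of `ℝᵈ⁺¹`. -/
noncomputable def initVec {d : ℕ} (y : EucSpace (d + 1)) : EucSpace d := (splitEuc d 1 y).fst

theorem eq_smul_lastVec_add {d : ℕ} (y : EucSpace (d + 1)) :
    y = (inner ℝ (lastVec d) y : ℝ) • lastVec d + topEuc d 1 (initVec y) := by
  have h1 : y = topEuc d 1 (initVec y) + botEuc d 1 (splitEuc d 1 y).snd := by
    rw [← joinEuc_eq]
    exact ((splitEuc d 1).symm_apply_apply y).symm
  have h2 : (splitEuc d 1 y).snd = (splitEuc d 1 y).snd 0 • EuclideanSpace.single 0 (1 : ℝ) := by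
    ext i
    fin_cases i
    simp
  have h3 : (inner ℝ (lastVec d) y : ℝ) = (splitEuc d 1 y).snd 0 := by
    conv_lhs => rw [h1, inner_add_right, inner_lastVec_topEuc, zero_add, lastVec,
      LinearIsometry.inner_map_map]
    simp [EuclideanSpace.inner_single_left]
  conv_lhs => rw [h1, h2, map_smul, ← h3]
  exact add_comm _ _

/-- The vector `(1, c)` of `ℝᵈ⁺¹`; the coordinate `1` is put in the last place. -/
noncomputable def affVec {d : ℕ} (c : EucSpace d) : EucSpace (d + 1) := lastVec d + topEuc d 1 c

@[simp] theorem inner_lastVec_affVec {d : ℕ} (c : EucSpace d) :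
    (inner ℝ (lastVec d) (affVec c) : ℝ) = 1 := by
  rw [affVec, inner_add_right, inner_lastVec_self, inner_lastVec_topEuc, add_zero]

theorem initVec_add {d : ℕ} (y y' : EucSpace (d + 1)) :
    initVec (y + y') = initVec y + initVec y' := by
  simp [initVec]

theorem initVec_smul {d : ℕ} (t : ℝ) (y : EucSpace (d + 1)) :
    initVec (t • y) = t • initVec y := by
  simp [initVec]

theorem initVec_topEuc {d : ℕ} (c : EucSpace d) : initVec (topEuc d 1 c) = c := by
  change (splitEuc d 1 ((splitEuc d 1).symm _)).fst = c
  rw [LinearIsometryEquiv.apply_symm_apply]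
  rfl

theorem initVec_lastVec (d : ℕ) : initVec (lastVec d) = 0 := by
  change (splitEuc d 1 ((splitEuc d 1).symm _)).fst = 0
  rw [LinearIsometryEquiv.apply_symm_apply]
  rfl

theorem initVec_affVec {d : ℕ} (c : EucSpace d) : initVec (affVec c) = c := by
  rw [affVec, initVec_add, initVec_lastVec, initVec_topEuc, zero_add]

theorem continuous_initVec (d : ℕ) : Continuous (initVec (d := d)) :=
  (WithLp.continuous_fst 2 _ _).comp (splitEuc d 1).continuous

/-- The vector `(-Zᵀ y, y)` for `y = (1, c)`, which is orthogonal to the graph of `Z`. -/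
noncomputable def normalVec {k d : ℕ} (Z : Fin k → EucSpace (d + 1)) (c : EucSpace d) :
    EucSpace (k + (d + 1)) :=
  botEuc k (d + 1) (affVec c) - ∑ i, (inner ℝ (Z i) (affVec c) : ℝ) • stdTop k (d + 1) i

theorem inner_stdTop_normalVec {k d : ℕ} (Z : Fin k → EucSpace (d + 1)) (c : EucSpace d)
    (i : Fin k) : (inner ℝ (stdTop k (d + 1) i) (normalVec Z c) : ℝ) = -inner ℝ (Z i) (affVec c) := by
  rw [normalVec, inner_sub_right, inner_stdTop_botEuc, zero_sub,
    (orthonormal_stdTop k (d + 1)).inner_right_fintype]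

theorem inner_botEuc_normalVec {k d : ℕ} (Z : Fin k → EucSpace (d + 1)) (c : EucSpace d)
    (y : EucSpace (d + 1)) :
    (inner ℝ (botEuc k (d + 1) y) (normalVec Z c) : ℝ) = inner ℝ y (affVec c) := by
  rw [normalVec, inner_sub_right, LinearIsometry.inner_map_map, inner_sum, Finset.sum_eq_zero,
    sub_zero]
  intro i _
  rw [inner_smul_right, inner_botEuc_stdTop, mul_zero]

theorem inner_graphFrame_normalVec {k d : ℕ} (Z : Fin k → EucSpace (d + 1)) (c : EucSpace d)
    (i : Fin k) : (inner ℝ (graphFrame Z i) (normalVec Z c) : ℝ) = 0 := by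
  rw [graphFrame, inner_add_left, inner_stdTop_normalVec, inner_botEuc_normalVec, neg_add_cancel]

/-- The vector of `ℝⁿ` that carries the direction of the base point of the chart. -/
noncomputable def baseVec (k d : ℕ) : EucSpace (k + (d + 1)) := botEuc k (d + 1) (lastVec d)

theorem inner_baseVec_normalVec {k d : ℕ} (Z : Fin k → EucSpace (d + 1)) (c : EucSpace d) :
    (inner ℝ (baseVec k d) (normalVec Z c) : ℝ) = 1 := by
  rw [baseVec, inner_botEuc_normalVec, inner_lastVec_affVec]

theorem normalVec_ne_zero {k d : ℕ} (Z : Fin k → EucSpace (d + 1)) (c : EucSpace d) :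
    normalVec Z c ≠ 0 := by
  intro h
  have := inner_baseVec_normalVec Z c
  rw [h, inner_zero_right] at this
  exact zero_ne_one this

/-- The chart of `𝒲` around the flag of the standard basis: `ω` is the direction of the graph of
`Z`, and `a` that of the vector orthogonal to it which lies over `(1, c)`. -/
noncomputable def flagChart {k d : ℕ} (q : (Fin k → EucSpace (d + 1)) × EucSpace d) :
    FlagAmbient (k + (d + 1)) k :=
  WithLp.toLp 2 (NormedSpace.normalize (normalVec q.1 q.2),
    NormedSpace.normalize (wedge (graphFrame q.1)))

/-- The base point of the chart, the flag of the standard basis. -/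
noncomputable def baseFlag (k d : ℕ) : FlagAmbient (k + (d + 1)) k :=
  WithLp.toLp 2 (baseVec k d, wedge (stdTop k (d + 1)))

theorem norm_baseVec (k d : ℕ) : ‖baseVec k d‖ = 1 := by
  rw [baseVec, LinearIsometry.norm_map, norm_lastVec]

theorem baseFlag_mem_setW (k d : ℕ) : baseFlag k d ∈ setW (k + (d + 1)) k := by
  rw [mem_setW_iff]
  exact ⟨norm_baseVec k d, stdTop k (d + 1), orthonormal_stdTop _ _,
    fun i => inner_stdTop_botEuc _ _, Or.inl rfl⟩

/-- The part of the ambient space over which the chart is inverted. -/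
def chartDomain (k d : ℕ) : Set (FlagAmbient (k + (d + 1)) k) :=
  {p | 0 < (inner ℝ p.snd (wedge (stdTop k (d + 1))) : ℝ) ∧ 0 < (inner ℝ (baseVec k d) p.fst : ℝ)}

theorem isOpen_chartDomain (k d : ℕ) : IsOpen (chartDomain k d) := by
  have h1 : Continuous fun p : FlagAmbient (k + (d + 1)) k =>
      (inner ℝ p.snd (wedge (stdTop k (d + 1))) : ℝ) :=
    (WithLp.continuous_snd 2 _ _).inner continuous_const
  have h2 : Continuous fun p : FlagAmbient (k + (d + 1)) k =>
      (inner ℝ (baseVec k d) p.fst : ℝ) :=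
    continuous_const.inner (WithLp.continuous_fst 2 _ _)
  exact (isOpen_lt continuous_const h1).inter (isOpen_lt continuous_const h2)

theorem baseFlag_mem_chartDomain (k d : ℕ) : baseFlag k d ∈ chartDomain k d := by
  constructor
  · change 0 < (inner ℝ (wedge (stdTop k (d + 1))) (wedge (stdTop k (d + 1))) : ℝ)
    rw [real_inner_self_eq_norm_sq, norm_wedge_of_orthonormal (orthonormal_stdTop _ _)]
    norm_num
  · change 0 < (inner ℝ (baseVec k d) (baseVec k d) : ℝ)
    rw [real_inner_self_eq_norm_sq, norm_baseVec]
    norm_num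

/-- The inverse of the chart, by Plücker coordinates. -/
noncomputable def chartInv {k d : ℕ} (p : FlagAmbient (k + (d + 1)) k) :
    (Fin k → EucSpace (d + 1)) × EucSpace d :=
  (fun i => (inner ℝ p.snd (wedge (stdTop k (d + 1))) : ℝ)⁻¹ •
    ∑ r, (inner ℝ p.snd (wedge (Function.update (stdTop k (d + 1)) i
      (botEuc k (d + 1) (EuclideanSpace.single r 1)))) : ℝ) • EuclideanSpace.single r 1,
   (inner ℝ (baseVec k d) p.fst : ℝ)⁻¹ • initVec (splitEuc k (d + 1) p.fst).snd)

theorem chartInv_smul {k d : ℕ} {s t : ℝ} (hs : s ≠ 0) (ht : t ≠ 0)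
    (Z : Fin k → EucSpace (d + 1)) (c : EucSpace d) :
    chartInv (WithLp.toLp 2 (t • normalVec Z c, s • wedge (graphFrame Z))) = (Z, c) := by
  have hsm : ∀ w : KVec (k + (d + 1)) k,
      (inner ℝ (s • wedge (graphFrame Z)) w : ℝ) = s * inner ℝ (wedge (graphFrame Z)) w := fun w =>
    real_inner_smul_left (F := KVec (k + (d + 1)) k) _ _ _
  refine Prod.ext ?_ ?_
  · ext1 i
    change (inner ℝ (s • wedge (graphFrame Z)) (wedge (stdTop k (d + 1))) : ℝ)⁻¹ •
      ∑ r, (inner ℝ (s • wedge (graphFrame Z)) (wedge (Function.update (stdTop k (d + 1)) i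
        (botEuc k (d + 1) (EuclideanSpace.single r 1)))) : ℝ) • EuclideanSpace.single r 1 = Z i
    simp_rw [hsm, inner_graphFrame_wedge_stdTop, inner_graphFrame_wedge_update]
    have h := (EuclideanSpace.basisFun (Fin (d + 1)) ℝ).sum_repr (Z i)
    have h2 : ∀ r, (s * (inner ℝ (Z i) (EuclideanSpace.single r (1 : ℝ)) : ℝ)) •
        (EuclideanSpace.single r (1 : ℝ) : EucSpace (d + 1)) =
        s • ((EuclideanSpace.basisFun (Fin (d + 1)) ℝ).repr (Z i) r •
          EuclideanSpace.basisFun (Fin (d + 1)) ℝ r) := by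
      intro r
      rw [smul_smul, EuclideanSpace.basisFun_repr, EuclideanSpace.basisFun_apply]
      congr 2
      rw [EuclideanSpace.inner_single_right]
      simp
    simp_rw [h2]
    rw [← Finset.smul_sum, h, mul_one, smul_smul, inv_mul_cancel₀ hs, one_smul]
  · change (inner ℝ (baseVec k d) (t • normalVec Z c) : ℝ)⁻¹ •
      initVec (splitEuc k (d + 1) (t • normalVec Z c)).snd = c
    have h1 : (splitEuc k (d + 1) (t • normalVec Z c)).snd = t • affVec c := by
      have h3 : normalVec Z c = joinEuc (-∑ i, (inner ℝ (Z i) (affVec c) : ℝ) •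
          EuclideanSpace.single i 1) (affVec c) := by
        rw [joinEuc_eq, map_neg, map_sum, normalVec, sub_eq_add_neg]
        simp_rw [map_smul]
        exact add_comm _ _
      rw [h3, joinEuc, map_smul, LinearIsometryEquiv.apply_symm_apply]
      rfl
    rw [h1, inner_smul_right, inner_baseVec_normalVec, initVec_smul, initVec_affVec, mul_one,
      smul_smul, inv_mul_cancel₀ ht, one_smul]

theorem chartInv_flagChart {k d : ℕ} (q : (Fin k → EucSpace (d + 1)) × EucSpace d) :
    chartInv (flagChart q) = q :=
  chartInv_smul (inv_ne_zero (norm_ne_zero_iff.mpr (wedge_graphFrame_ne_zero q.1)))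
    (inv_ne_zero (norm_ne_zero_iff.mpr (normalVec_ne_zero q.1 q.2))) q.1 q.2

theorem normalize_smul_of_norm_eq_one {E : Type*} [NormedAddCommGroup E] [NormedSpace ℝ E] {s : ℝ}
    (hs : 0 < s) {v : E} (h : ‖s • v‖ = 1) : NormedSpace.normalize v = s • v := by
  rw [norm_smul, Real.norm_eq_abs, abs_of_pos hs] at h
  rw [NormedSpace.normalize, ← eq_inv_of_mul_eq_one_left h]

theorem flagChart_chartInv {k d : ℕ} {p : FlagAmbient (k + (d + 1)) k}
    (hp : p ∈ setW (k + (d + 1)) k) (hU : p ∈ chartDomain k d) : flagChart (chartInv p) = p := by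
  obtain ⟨h1, u, hu, h2, h3⟩ := mem_setW_iff.mp hp
  obtain ⟨hU1, hU2⟩ := hU
  choose X' Y hXY using fun i => exists_joinEuc_eq (u i)
  let X : Matrix (Fin k) (Fin k) ℝ := fun i j => X' i j
  have hdet : X.det = inner ℝ (wedge u) (wedge (stdTop k (d + 1))) := by
    rw [inner_wedge]
    congr 1
    ext i j
    rw [Matrix.of_apply, hXY, joinEuc_eq, inner_add_left, inner_botEuc_stdTop, add_zero,
      real_inner_comm, inner_stdTop_topEuc]
  have hdet0 : X.det ≠ 0 := by
    intro h0
    rw [hdet] at h0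
    rcases h3 with h | h
    · rw [h, h0] at hU1
      exact lt_irrefl _ hU1
    · rw [h, inner_neg_left, h0, neg_zero] at hU1
      exact lt_irrefl _ hU1
  let Z : Fin k → EucSpace (d + 1) := fun i => ∑ j, X⁻¹ i j • Y j
  have hYZ : ∀ i, Y i = ∑ j, X i j • Z j := by
    intro i
    simp only [Z]
    simp_rw [Finset.smul_sum, smul_smul]
    rw [Finset.sum_comm]
    simp_rw [← Finset.sum_smul, ← Matrix.mul_apply,
      Matrix.mul_nonsing_inv X (isUnit_iff_ne_zero.mpr hdet0), Matrix.one_apply]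
    simp
  have hu' : u = fun i => ∑ j, X i j • graphFrame Z j := by
    ext1 i
    rw [hXY, hYZ]
    exact (sum_smul_graphFrame (X' i) Z).symm
  have hwu : wedge u = X.det • wedge (graphFrame Z) := by
    rw [← wedge_sum_smul, ← hu']
  have hω : ∃ s : ℝ, p.snd = s • wedge (graphFrame Z) := by
    rcases h3 with h | h
    · exact ⟨X.det, h.trans hwu⟩
    · exact ⟨-X.det, by rw [h, hwu]; exact (neg_smul X.det (wedge (graphFrame Z))).symm⟩
  obtain ⟨s, hs⟩ := hω
  have hspos : 0 < s := by
    have h4 : (inner ℝ (s • wedge (graphFrame Z)) (wedge (stdTop k (d + 1))) : ℝ) =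
        s * inner ℝ (wedge (graphFrame Z)) (wedge (stdTop k (d + 1))) :=
      real_inner_smul_left (F := KVec (k + (d + 1)) k) _ _ _
    rw [hs, h4, inner_graphFrame_wedge_stdTop, mul_one] at hU1
    exact hU1
  have horth : ∀ j, (inner ℝ (graphFrame Z j) p.fst : ℝ) = 0 := by
    intro j
    have : graphFrame Z j = ∑ i, X⁻¹ j i • u i := by
      rw [hu']
      simp_rw [Finset.smul_sum, smul_smul]
      rw [Finset.sum_comm]
      simp_rw [← Finset.sum_smul, ← Matrix.mul_apply,
        Matrix.nonsing_inv_mul X (isUnit_iff_ne_zero.mpr hdet0), Matrix.one_apply]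
      simp
    rw [this, sum_inner]
    refine Finset.sum_eq_zero fun i _ => ?_
    rw [inner_smul_left, h2, mul_zero]
  obtain ⟨α, β, hαβ⟩ := exists_joinEuc_eq p.fst
  set t : ℝ := inner ℝ (baseVec k d) p.fst with ht
  have htβ : t = inner ℝ (lastVec d) β := by
    rw [ht, hαβ, joinEuc_eq, baseVec, inner_add_right, inner_botEuc_topEuc, zero_add,
      LinearIsometry.inner_map_map]
  have hβ : β = t • affVec (t⁻¹ • initVec β) := by
    rw [affVec, smul_add, ← map_smul, smul_smul, mul_inv_cancel₀ hU2.ne', one_smul, htβ]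
    exact eq_smul_lastVec_add β
  have hα : ∀ i, α i = -inner ℝ (Z i) β := by
    intro i
    have := horth i
    rw [hαβ, joinEuc_eq, graphFrame, inner_add_left, inner_add_right, inner_add_right,
      inner_stdTop_topEuc, inner_stdTop_botEuc, inner_botEuc_topEuc,
      LinearIsometry.inner_map_map] at this
    linarith
  have ha : p.fst = t • normalVec Z (t⁻¹ • initVec β) := by
    rw [hαβ, joinEuc_eq, topEuc_eq_sum, normalVec, smul_sub, ← map_smul, ← hβ, sub_eq_add_neg,
      Finset.smul_sum, ← Finset.sum_neg_distrib]
    refine (add_comm _ _).trans ?_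
    congr 1
    refine Finset.sum_congr rfl fun i _ => ?_
    rw [hα, smul_smul, ← neg_smul]
    congr 2
    conv_lhs => rw [hβ]
    rw [inner_smul_right]
  have hpq : p = WithLp.toLp 2 (t • normalVec Z (t⁻¹ • initVec β), s • wedge (graphFrame Z)) :=
    (WithLp.equiv 2 _).injective (Prod.ext ha hs)
  have hinv : chartInv p = (Z, t⁻¹ • initVec β) := by
    conv_lhs => rw [hpq]
    exact chartInv_smul hspos.ne' hU2.ne' Z _
  rw [hinv]
  refine (WithLp.equiv 2 _).injective (Prod.ext ?_ ?_)
  · change NormedSpace.normalize (normalVec Z (t⁻¹ • initVec β)) = p.fst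
    rw [ha]
    exact normalize_smul_of_norm_eq_one hU2 (by rw [← ha, h1])
  · change NormedSpace.normalize (wedge (graphFrame Z)) = p.snd
    rw [hs]
    exact normalize_smul_of_norm_eq_one hspos (by rw [← hs]; exact hp.2.1.2)

theorem flagChart_mem_setW {k d : ℕ} (q : (Fin k → EucSpace (d + 1)) × EucSpace d) :
    flagChart q ∈ setW (k + (d + 1)) k := by
  have h : flagChart q = flagOf (graphFrame q.1, normalVec q.1 q.2) := by
    rw [flagOf, perp_eq (fun i => inner_graphFrame_normalVec q.1 q.2 i) (by simp)]
    rfl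
  rw [h]
  refine flagOf_mem_setW (wedge_ne_zero_iff.mp (wedge_graphFrame_ne_zero q.1)) fun hmem => ?_
  have h1 : ∀ x ∈ Submodule.span ℝ (Set.range (graphFrame q.1)),
      (inner ℝ x (normalVec q.1 q.2) : ℝ) = 0 := by
    intro x hx
    induction hx using Submodule.span_induction with
    | mem x hx => obtain ⟨i, rfl⟩ := hx; exact inner_graphFrame_normalVec q.1 q.2 i
    | zero => simp
    | add x y _ _ hx hy => rw [inner_add_left, hx, hy, add_zero]
    | smul c x _ hx => rw [inner_smul_left, hx, mul_zero]
  exact normalVec_ne_zero q.1 q.2 (inner_self_eq_zero.mp (h1 _ hmem))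

theorem continuousAt_chartInv (k d : ℕ) : ContinuousAt (chartInv (k := k) (d := d))
    (baseFlag k d) := by
  obtain ⟨h1, h2⟩ := baseFlag_mem_chartDomain k d
  have hf := WithLp.continuous_fst 2 (EucSpace (k + (d + 1))) (KVec (k + (d + 1)) k)
  have hs := WithLp.continuous_snd 2 (EucSpace (k + (d + 1))) (KVec (k + (d + 1)) k)
  have c1 : ∀ w, Continuous fun p : FlagAmbient (k + (d + 1)) k => (inner ℝ p.snd w : ℝ) :=
    fun w => hs.inner continuous_const
  have c2 : Continuous fun p : FlagAmbient (k + (d + 1)) k => (inner ℝ (baseVec k d) p.fst : ℝ) :=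
    continuous_const.inner hf
  have c3 : Continuous fun p : FlagAmbient (k + (d + 1)) k =>
      initVec (splitEuc k (d + 1) p.fst).snd :=
    (continuous_initVec d).comp ((WithLp.continuous_snd 2 _ _).comp
      ((splitEuc k (d + 1)).continuous.comp hf))
  refine ContinuousAt.prodMk ?_ ?_
  · refine continuousAt_pi.mpr fun i => ?_
    refine ContinuousAt.smul ((c1 _).continuousAt.inv₀ h1.ne') (Continuous.continuousAt ?_)
    exact continuous_finsetSum _ fun r _ => (c1 _).smul continuous_const
  · exact ContinuousAt.smul (c2.continuousAt.inv₀ h2.ne') c3.continuousAt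

theorem flagChart_zero (k d : ℕ) : flagChart (0 : (Fin k → EucSpace (d + 1)) × EucSpace d) =
    baseFlag k d := by
  have h1 : normalVec (0 : Fin k → EucSpace (d + 1)) (0 : EucSpace d) = baseVec k d := by
    simp [normalVec, affVec, baseVec]
  have h2 : graphFrame (0 : Fin k → EucSpace (d + 1)) = stdTop k (d + 1) := by
    ext1 i
    simp [graphFrame]
  refine (WithLp.equiv 2 _).injective (Prod.ext ?_ ?_)
  · change NormedSpace.normalize (normalVec (0 : Fin k → EucSpace (d + 1)) (0 : EucSpace d)) = _
    rw [h1, NormedSpace.normalize, norm_baseVec, inv_one, one_smul]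
    rfl
  · change NormedSpace.normalize (wedge (graphFrame (0 : Fin k → EucSpace (d + 1)))) = _
    rw [h2, NormedSpace.normalize, norm_wedge_of_orthonormal (orthonormal_stdTop _ _), inv_one,
      one_smul]
    rfl

theorem chartInv_baseFlag (k d : ℕ) : chartInv (baseFlag k d) = 0 := by
  rw [← flagChart_zero, chartInv_flagChart]

/-! ### Hausdorff measure of small pieces of a parametrised surface -/

/-- The volume distortion of an injective linear map is read off from the integral of a Gaussian. -/
theorem euclideanHausdorffMeasure_image_of_lintegral_gaussW {P E : Type*} [NormedAddCommGroup P]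
    [NormedSpace ℝ P] [FiniteDimensional ℝ P] [MeasureSpace P] [BorelSpace P]
    [(volume : Measure P).IsAddHaarMeasure] [NormedAddCommGroup E] [InnerProductSpace ℝ E]
    [MeasurableSpace E] [BorelSpace E] (A : P →L[ℝ] E) (hA : Function.Injective A) {c : ENNReal}
    (hc : c * ∫⁻ q, gaussW Real.pi (A q) = 1) (T : Set P) :
    μHE[Module.finrank ℝ P] (A '' T) = c * volume T := by
  let V : Submodule ℝ E := LinearMap.range A.toLinearMap
  let e : P ≃L[ℝ] V := (LinearEquiv.ofInjective A.toLinearMap hA).toContinuousLinearEquiv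
  have he : ∀ q, ((e q : V) : E) = A q := fun q => rfl
  have hrank : Module.finrank ℝ V = Module.finrank ℝ P := e.toLinearEquiv.finrank_eq.symm
  have hH : (Measure.map e volume : Measure V).IsAddHaarMeasure :=
    e.isAddHaarMeasure_map _
  have hmap := Measure.isAddLeftInvariant_eq_smul (Measure.map e volume : Measure V) volume
  set a := Measure.addHaarScalarFactor (Measure.map e volume : Measure V) volume
  have ha : ∫⁻ q, gaussW Real.pi (A q) = a := by
    have h1 : ∫⁻ x, gaussW Real.pi x ∂(Measure.map e volume : Measure V) =
        ∫⁻ q, gaussW Real.pi (A q) :=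
      lintegral_map (measurable_gaussW _) e.continuous.measurable
    rw [← h1, hmap, lintegral_smul_measure, lintegral_gaussW_pi, ENNReal.smul_def, smul_eq_mul,
      mul_one]
  have h2 : A '' T = ((↑) : V → E) '' (e '' T) := by
    rw [Set.image_image]
    rfl
  have h3 : (Measure.map e volume : Measure V) (e '' T) = volume T := by
    have := (e.toHomeomorph.toMeasurableEquiv).map_apply (μ := (volume : Measure P)) (e '' T)
    refine this.trans ?_
    congr 1
    exact Set.preimage_image_eq T e.injective
  rw [h2, isometry_subtype_coe.euclideanHausdorffMeasure_image, ← hrank,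
    InnerProductSpace.euclideanHausdorffMeasure_eq_volume, ← h3, hmap, Measure.smul_apply,
    ENNReal.smul_def, smul_eq_mul, ← mul_assoc, ← ha, hc, one_mul]

theorem euclideanHausdorffMeasure_image_le {X Y : Type*} [EMetricSpace X] [EMetricSpace Y]
    [MeasurableSpace X] [BorelSpace X] [MeasurableSpace Y] [BorelSpace Y] {K : NNReal}
    {f : X → Y} {s : Set X} (hf : LipschitzOnWith K f s) (m : ℕ) :
    μHE[m] (f '' s) ≤ (K : ENNReal) ^ m * μHE[m] s := by
  have h := hf.hausdorffMeasure_image_le (d := m) (Nat.cast_nonneg m)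
  rw [ENNReal.rpow_natCast] at h
  rw [Measure.euclideanHausdorffMeasure_def, Measure.euclideanHausdorffMeasure_def,
    Measure.smul_apply, Measure.smul_apply, ENNReal.smul_def, ENNReal.smul_def, smul_eq_mul,
    smul_eq_mul, mul_left_comm]
  gcongr

/-- Near a point where a map is strictly differentiable with injective derivative `A`, it distorts
volumes as `A` does, up to factors close to `1`. -/
theorem exists_nhds_euclideanHausdorffMeasure_image {P E : Type*} [NormedAddCommGroup P]
    [NormedSpace ℝ P] [FiniteDimensional ℝ P] [MeasureSpace P] [BorelSpace P]
    [(volume : Measure P).IsAddHaarMeasure] [NormedAddCommGroup E] [InnerProductSpace ℝ E]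
    [MeasurableSpace E] [BorelSpace E] {A : P →L[ℝ] E} (hA : Function.Injective A) {c : ENNReal}
    (hc : c * ∫⁻ q, gaussW Real.pi (A q) = 1) {f : P → E} {x : P} (hf : HasStrictFDerivAt f A x)
    {ε : NNReal} (hε : 0 < ε) (hε1 : ε < 1) :
    ∃ U ∈ nhds x, ∀ T ⊆ U,
      μHE[Module.finrank ℝ P] (f '' T) ≤ (1 + ε : NNReal) ^ Module.finrank ℝ P * (c * volume T) ∧
      (1 - ε : NNReal) ^ Module.finrank ℝ P * (c * volume T) ≤
        μHE[Module.finrank ℝ P] (f '' T) := by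
  obtain ⟨K, hK, hAK⟩ := A.toLinearMap.exists_antilipschitzWith (LinearMap.ker_eq_bot.mpr hA)
  have hK' : ∀ q, ‖q‖ ≤ K * ‖A q‖ := fun q => by
    simpa [dist_eq_norm] using hAK.le_mul_dist q 0
  obtain ⟨U, hU, hfU⟩ := hf.approximates_deriv_on_nhds (c := ε / K)
    (Or.inr (div_pos hε hK))
  have key : ∀ p ∈ U, ∀ q ∈ U, ‖f p - f q - (A p - A q)‖ ≤ ε * ‖A p - A q‖ := by
    intro p hp q hq
    have h := hfU p hp q hq
    rw [map_sub] at h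
    refine h.trans ?_
    have h2 := hK' (p - q)
    rw [map_sub] at h2
    calc ((ε / K : NNReal) : ℝ) * ‖p - q‖ ≤ (ε / K : NNReal) * (K * ‖A p - A q‖) := by gcongr
      _ = ε * ‖A p - A q‖ := by
        have : (K : ℝ) ≠ 0 := by exact_mod_cast hK.ne'
        push_cast
        field_simp
  refine ⟨U, hU, fun T hT => ?_⟩
  rw [← euclideanHausdorffMeasure_image_of_lintegral_gaussW A hA hc T]
  set m := Module.finrank ℝ P
  let g : E → P := Function.invFun A
  have hg : ∀ q, g (A q) = q := Function.leftInverse_invFun hA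
  have h1 : f '' T = (f ∘ g) '' (A '' T) := by
    rw [Set.image_image]
    simp [hg]
  constructor
  · rw [h1]
    refine euclideanHausdorffMeasure_image_le ?_ m
    rw [lipschitzOnWith_iff_norm_sub_le]
    rintro _ ⟨p, hp, rfl⟩ _ ⟨q, hq, rfl⟩
    simp only [Function.comp_apply, hg]
    have h3 := norm_le_norm_add_norm_sub (A p - A q) (f p - f q)
    have h4 := key p (hT hp) q (hT hq)
    rw [norm_sub_rev (A p - A q)] at h3
    push_cast
    linarith
  · have hinj : Set.InjOn f T := by
      intro p hp q hq hpq
      have h4 := key p (hT hp) q (hT hq)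
      rw [hpq, sub_self, zero_sub, norm_neg] at h4
      have h5 : (ε : ℝ) < 1 := by exact_mod_cast hε1
      have h6 : ‖A p - A q‖ = 0 := by
        by_contra h
        have : 0 < ‖A p - A q‖ := lt_of_le_of_ne (norm_nonneg _) (Ne.symm h)
        nlinarith
      exact hA (sub_eq_zero.mp (norm_eq_zero.mp h6))
    have h2 : A '' T = (A ∘ Function.invFunOn f T) '' (f '' T) := by
      rw [Set.image_image]
      refine Set.image_congr fun p hp => ?_
      simp only [Function.comp_apply]
      rw [hinj.leftInvOn_invFunOn hp]
    have hpos : 0 < 1 - ε := tsub_pos_of_lt hε1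
    have hlip : LipschitzOnWith (1 - ε)⁻¹ (A ∘ Function.invFunOn f T) (f '' T) := by
      rw [lipschitzOnWith_iff_norm_sub_le]
      rintro _ ⟨p, hp, rfl⟩ _ ⟨q, hq, rfl⟩
      simp only [Function.comp_apply]
      rw [hinj.leftInvOn_invFunOn hp, hinj.leftInvOn_invFunOn hq]
      have h3 := norm_le_norm_add_norm_sub (f p - f q) (A p - A q)
      have h4 := key p (hT hp) q (hT hq)
      have h5 : ((1 - ε : NNReal) : ℝ) = 1 - ε := NNReal.coe_sub hε1.le
      have h6 : (0 : ℝ) < ((1 - ε : NNReal) : ℝ) := hpos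
      rw [NNReal.coe_inv, inv_mul_eq_div, le_div_iff₀ h6, h5]
      linarith
    have h3 := euclideanHausdorffMeasure_image_le hlip m
    rw [← h2] at h3
    calc ((1 - ε : NNReal) : ENNReal) ^ m * μHE[m] (A '' T)
        ≤ ((1 - ε : NNReal) : ENNReal) ^ m * ((((1 - ε)⁻¹ : NNReal) : ENNReal) ^ m *
          μHE[m] (f '' T)) := by gcongr
      _ = μHE[m] (f '' T) := by
        rw [← mul_assoc, ← mul_pow, ← ENNReal.coe_mul, mul_inv_cancel₀ hpos.ne', ENNReal.coe_one,
          one_pow, one_mul]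

/-- The derivative of the normalisation at a unit vector is the identity on the vectors orthogonal
to it. -/
theorem hasStrictFDerivAt_normalize {P E : Type*} [NormedAddCommGroup P]
    [NormedSpace ℝ P] [NormedAddCommGroup E] [InnerProductSpace ℝ E] {f : P → E} {A : P →L[ℝ] E}
    {x : P} (hf : HasStrictFDerivAt f A x) (h1 : ‖f x‖ = 1)
    (h2 : ∀ v, (inner ℝ (f x) (A v) : ℝ) = 0) :
    HasStrictFDerivAt (fun p => NormedSpace.normalize (f p)) A x := by
  have h3 : HasStrictFDerivAt (fun p => ‖f p‖ ^ 2) (0 : P →L[ℝ] ℝ) x := by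
    have := (hasStrictFDerivAt_norm_sq (f x)).comp x hf
    refine this.congr_fderiv ?_
    ext v
    simp [h2]
  have h4 : HasStrictFDerivAt (fun p => (√(‖f p‖ ^ 2))⁻¹) (0 : P →L[ℝ] ℝ) x := by
    have h5 : HasStrictDerivAt (fun t : ℝ => (√t)⁻¹) (deriv (fun t : ℝ => (√t)⁻¹) (‖f x‖ ^ 2))
        (‖f x‖ ^ 2) := by
      rw [h1, one_pow]
      refine ContDiffAt.hasStrictDerivAt (n := 1) ?_ one_ne_zero
      exact (Real.contDiffAt_sqrt one_ne_zero).inv (by simp)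
    have := h5.comp_hasStrictFDerivAt x h3
    rwa [smul_zero] at this
  have h5 := h4.smul hf
  have h6 : (fun p => NormedSpace.normalize (f p)) =
      (fun p => (√(‖f p‖ ^ 2))⁻¹) • f := by
    ext1 p
    simp [NormedSpace.normalize, Real.sqrt_sq (norm_nonneg _)]
  rw [h6]
  refine h5.congr_fderiv ?_
  ext v
  simp [h1]

/-! ### The derivative of the chart -/

/-- The derivative at the origin of `(Z, c) ↦ normalVec Z c`. -/
noncomputable def normalDeriv (k d : ℕ) :
    ((Fin k → EucSpace (d + 1)) × EucSpace d) →L[ℝ] EucSpace (k + (d + 1)) :=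
  ((botEuc k (d + 1)).toContinuousLinearMap ∘L (topEuc d 1).toContinuousLinearMap) ∘L
      ContinuousLinearMap.snd ℝ _ _ -
    ∑ i, ((innerSL ℝ (lastVec d)) ∘L (ContinuousLinearMap.proj i ∘L
      ContinuousLinearMap.fst ℝ (Fin k → EucSpace (d + 1)) (EucSpace d))).smulRight
        (stdTop k (d + 1) i)

theorem normalDeriv_apply {k d : ℕ} (q : (Fin k → EucSpace (d + 1)) × EucSpace d) :
    normalDeriv k d q = botEuc k (d + 1) (topEuc d 1 q.2) -
      ∑ i, (inner ℝ (lastVec d) (q.1 i) : ℝ) • stdTop k (d + 1) i := by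
  simp [normalDeriv]

/-- The derivative at the origin of `Z ↦ wedge (graphFrame Z)`. -/
noncomputable def graphDeriv (k l : ℕ) : (Fin k → EucSpace l) →L[ℝ] KVec (k + l) k :=
  (wedgeCMM (k + l) k).linearDeriv (stdTop k l) ∘L
    ContinuousLinearMap.pi fun i => (botEuc k l).toContinuousLinearMap ∘L ContinuousLinearMap.proj i

theorem graphDeriv_apply {k l : ℕ} (Z : Fin k → EucSpace l) :
    graphDeriv k l Z = ∑ i, wedge (Function.update (stdTop k l) i (botEuc k l (Z i))) := by
  simp [graphDeriv, ContinuousMultilinearMap.linearDeriv_apply, wedgeCMM_apply]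

/-- The derivative of `flagChart` at the origin. -/
noncomputable def chartDeriv (k d : ℕ) :
    ((Fin k → EucSpace (d + 1)) × EucSpace d) →L[ℝ] FlagAmbient (k + (d + 1)) k :=
  (WithLp.prodContinuousLinearEquiv 2 ℝ (EucSpace (k + (d + 1)))
      (KVec (k + (d + 1)) k)).symm.toContinuousLinearMap ∘L
    (normalDeriv k d).prod (graphDeriv k (d + 1) ∘L ContinuousLinearMap.fst ℝ _ _)

theorem hasStrictFDerivAt_normalVec (k d : ℕ) :
    HasStrictFDerivAt (fun q : (Fin k → EucSpace (d + 1)) × EucSpace d => normalVec q.1 q.2)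
      (normalDeriv k d) 0 := by
  have h1 : HasStrictFDerivAt (fun q : (Fin k → EucSpace (d + 1)) × EucSpace d => affVec q.2)
      ((topEuc d 1).toContinuousLinearMap ∘L ContinuousLinearMap.snd ℝ _ _) 0 :=
    ((topEuc d 1).toContinuousLinearMap ∘L ContinuousLinearMap.snd ℝ
      (Fin k → EucSpace (d + 1)) (EucSpace d)).hasStrictFDerivAt.const_add _
  have h2 : ∀ i, HasStrictFDerivAt (fun q : (Fin k → EucSpace (d + 1)) × EucSpace d => q.1 i)
      (ContinuousLinearMap.proj i ∘L ContinuousLinearMap.fst ℝ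
      (Fin k → EucSpace (d + 1)) (EucSpace d)) 0 := fun i =>
    (ContinuousLinearMap.proj i ∘L ContinuousLinearMap.fst ℝ
      (Fin k → EucSpace (d + 1)) (EucSpace d)).hasStrictFDerivAt
  have h3 := ((botEuc k (d + 1)).toContinuousLinearMap.hasStrictFDerivAt.comp _ h1).sub
    (HasStrictFDerivAt.fun_sum (u := Finset.univ) fun i _ =>
      ((h2 i).inner ℝ h1).smul_const (stdTop k (d + 1) i))
  refine h3.congr_fderiv ?_
  refine ContinuousLinearMap.ext fun q => ?_
  rw [normalDeriv_apply]
  simp [fderivInnerCLM_apply, affVec, real_inner_comm]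

theorem hasStrictFDerivAt_wedge_graphFrame (k l : ℕ) :
    HasStrictFDerivAt (fun Z : Fin k → EucSpace l => wedge (graphFrame Z)) (graphDeriv k l) 0 := by
  have h1 : HasStrictFDerivAt (fun Z : Fin k → EucSpace l => graphFrame Z)
      (ContinuousLinearMap.pi fun i => (botEuc k l).toContinuousLinearMap ∘L
        ContinuousLinearMap.proj i) 0 := by
    rw [hasStrictFDerivAt_pi]
    intro i
    exact ((botEuc k l).toContinuousLinearMap ∘L
        ContinuousLinearMap.proj (φ := fun _ : Fin k => EucSpace l) i).hasStrictFDerivAt.const_add _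
  have h2 : graphFrame (0 : Fin k → EucSpace l) = stdTop k l := by
    ext1 i
    simp [graphFrame]
  have h3 := ((wedgeCMM (k + l) k).hasStrictFDerivAt
    (graphFrame (0 : Fin k → EucSpace l))).comp (0 : Fin k → EucSpace l) h1
  refine h3.congr_fderiv ?_
  rw [h2]
  rfl

theorem hasStrictFDerivAt_flagChart (k d : ℕ) :
    HasStrictFDerivAt (flagChart (k := k) (d := d)) (chartDeriv k d) 0 := by
  have h0 : normalVec (0 : Fin k → EucSpace (d + 1)) (0 : EucSpace d) = baseVec k d := by
    simp [normalVec, baseVec, affVec]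
  have h0' : graphFrame (0 : Fin k → EucSpace (d + 1)) = stdTop k (d + 1) := by
    ext1 i
    simp [graphFrame]
  have h1 := hasStrictFDerivAt_normalize (hasStrictFDerivAt_normalVec k d)
    (by rw [Prod.fst_zero, Prod.snd_zero, h0, norm_baseVec]) (by
      intro q
      rw [Prod.fst_zero, Prod.snd_zero, h0, normalDeriv_apply, baseVec]
      simp [inner_sub_right, inner_sum, inner_smul_right, LinearIsometry.inner_map_map])
  have h2' : HasStrictFDerivAt (fun q : (Fin k → EucSpace (d + 1)) × EucSpace d =>
      wedge (graphFrame q.1)) (graphDeriv k (d + 1) ∘L ContinuousLinearMap.fst ℝ _ _) 0 :=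
    HasStrictFDerivAt.comp (𝕜 := ℝ) (0 : (Fin k → EucSpace (d + 1)) × EucSpace d)
      (hasStrictFDerivAt_wedge_graphFrame k (d + 1)) hasStrictFDerivAt_fst
  have h2 := hasStrictFDerivAt_normalize h2'
    (by rw [Prod.fst_zero, h0', norm_wedge_of_orthonormal (orthonormal_stdTop _ _)]) (by
      intro q
      rw [Prod.fst_zero, ContinuousLinearMap.comp_apply, graphDeriv_apply, inner_sum]
      refine Finset.sum_eq_zero fun i _ => ?_
      refine (inner_graphFrame_wedge_update 0 i (q.1 i)).trans ?_
      simp)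
  exact (WithLp.prodContinuousLinearEquiv 2 ℝ (EucSpace (k + (d + 1)))
      (KVec (k + (d + 1)) k)).symm.toContinuousLinearMap.hasStrictFDerivAt.comp _ (h1.prodMk h2)

theorem inner_wedge_update_stdTop {k l : ℕ} (i j : Fin k) (y z : EucSpace l) :
    (inner ℝ (wedge (Function.update (stdTop k l) i (botEuc k l y)))
      (wedge (Function.update (stdTop k l) j (botEuc k l z))) : ℝ) =
      if i = j then inner ℝ y z else 0 := by
  rw [inner_wedge]
  split_ifs with h
  · subst h
    have : (Matrix.of fun a b => (inner ℝ (Function.update (stdTop k l) i (botEuc k l y) a)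
        (Function.update (stdTop k l) i (botEuc k l z) b) : ℝ)) =
        Matrix.diagonal (Function.update 1 i (inner ℝ y z)) := by
      ext a b
      rw [Matrix.of_apply, Matrix.diagonal_apply]
      by_cases ha : a = i <;> by_cases hb : b = i
      · simp [ha, hb]
      · simp [ha, hb, Ne.symm hb]
      · simp [ha, hb]
      · simp [ha, hb, inner_stdTop_stdTop]
    rw [this, Matrix.det_diagonal, Finset.prod_update_of_mem (Finset.mem_univ i)]
    simp
  · refine Matrix.det_eq_zero_of_row_eq_zero j fun b => ?_
    rw [Matrix.of_apply, Function.update_of_ne (Ne.symm h)]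
    by_cases hb : b = j
    · simp [hb]
    · simp [hb, inner_stdTop_stdTop, Ne.symm hb]

theorem norm_chartDeriv_sq {k d : ℕ} (q : (Fin k → EucSpace (d + 1)) × EucSpace d) :
    ‖chartDeriv k d q‖ ^ 2 =
      ∑ i, (‖q.1 i‖ ^ 2 + (inner ℝ (lastVec d) (q.1 i) : ℝ) ^ 2) + ‖q.2‖ ^ 2 := by
  have h1 : ‖chartDeriv k d q‖ ^ 2 = ‖normalDeriv k d q‖ ^ 2 + ‖graphDeriv k (d + 1) q.1‖ ^ 2 :=
    WithLp.prod_norm_sq_eq_of_L2 _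
  have h2 : normalDeriv k d q = joinEuc (-∑ i, (inner ℝ (lastVec d) (q.1 i) : ℝ) •
      EuclideanSpace.single i 1) (topEuc d 1 q.2) := by
    rw [normalDeriv_apply, joinEuc_eq, map_neg, map_sum, sub_eq_add_neg]
    simp_rw [map_smul]
    exact add_comm _ _
  have h3 : ‖∑ i, (inner ℝ (lastVec d) (q.1 i) : ℝ) • EuclideanSpace.single i (1 : ℝ)‖ ^ 2 =
      ∑ i, (inner ℝ (lastVec d) (q.1 i) : ℝ) ^ 2 := by
    rw [EuclideanSpace.norm_sq_eq]
    simp [Pi.single_apply]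
  have h4 : ‖graphDeriv k (d + 1) q.1‖ ^ 2 = ∑ i, ‖q.1 i‖ ^ 2 := by
    rw [graphDeriv_apply, ← real_inner_self_eq_norm_sq, sum_inner]
    simp_rw [inner_sum, inner_wedge_update_stdTop]
    simp
  rw [h1, h2, norm_joinEuc_sq, norm_neg, h3, h4, LinearIsometry.norm_map, Finset.sum_add_distrib]
  ring

theorem chartDeriv_injective (k d : ℕ) : Function.Injective (chartDeriv k d) := by
  rw [injective_iff_map_eq_zero]
  intro q hq
  have h := norm_chartDeriv_sq q
  rw [hq, norm_zero, zero_pow two_ne_zero] at h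
  have h1 : ∀ i, 0 ≤ ‖q.1 i‖ ^ 2 + (inner ℝ (lastVec d) (q.1 i) : ℝ) ^ 2 := fun i => by positivity
  have h2 := Finset.sum_nonneg fun i (_ : i ∈ Finset.univ) => h1 i
  have h3 : ‖q.2‖ ^ 2 = 0 := by nlinarith [sq_nonneg ‖q.2‖]
  have h4 : ∑ i, (‖q.1 i‖ ^ 2 + (inner ℝ (lastVec d) (q.1 i) : ℝ) ^ 2) = 0 := by linarith
  rw [Finset.sum_eq_zero_iff_of_nonneg fun i _ => h1 i] at h4
  refine Prod.ext (funext fun i => ?_) ?_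
  · have h5 := h4 i (Finset.mem_univ i)
    have h6 : ‖q.1 i‖ ^ 2 = 0 := by
      nlinarith [sq_nonneg ‖q.1 i‖, sq_nonneg (inner ℝ (lastVec d) (q.1 i) : ℝ)]
    exact norm_eq_zero.mp (pow_eq_zero_iff two_ne_zero |>.mp h6)
  · exact norm_eq_zero.mp (pow_eq_zero_iff two_ne_zero |>.mp h3)

theorem lintegral_pi_prod_eq_pow {E : Type*} [MeasureSpace E] [SigmaFinite (volume : Measure E)]
    {f : E → ENNReal} (hf : Measurable f) (j : ℕ) :
    ∫⁻ v : Fin j → E, ∏ i, f (v i) = (∫⁻ x, f x) ^ j := by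
  have hm : ∀ j : ℕ, Measurable fun v : Fin j → E => ∏ i, f (v i) := fun j =>
    Finset.measurable_fun_prod _ fun i _ => hf.comp (measurable_pi_apply i)
  induction j with
  | zero => simp [volume_pi]
  | succ j ih =>
    rw [lintegral_finCons (hm (j + 1))]
    simp_rw [Fin.prod_univ_succ, Fin.cons_zero, Fin.cons_succ]
    simp_rw [lintegral_mul_const _ hf]
    rw [lintegral_const_mul _ (hm j), ih, pow_succ']

/-- The factor `√2` comes from the coordinate of `Zᵢ` that moves both components of the flag. -/
theorem lintegral_gaussW_chartDeriv (k d : ℕ) :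
    ∫⁻ q, gaussW Real.pi (chartDeriv k d q) = ENNReal.ofReal ((√2)⁻¹ ^ k) := by
  let f : EucSpace (d + 1) → ENNReal := fun y =>
    gaussW Real.pi y * ENNReal.ofReal (Real.exp (-Real.pi * (inner ℝ (lastVec d) y : ℝ) ^ 2))
  have hf : Measurable f :=
    (measurable_gaussW _).mul (by fun_prop)
  have h1 : ∀ q : (Fin k → EucSpace (d + 1)) × EucSpace d,
      gaussW Real.pi (chartDeriv k d q) = (∏ i, f (q.1 i)) * gaussW Real.pi q.2 := by
    intro q
    rw [gaussW, norm_chartDeriv_sq, mul_add, Real.exp_add, ENNReal.ofReal_mul (Real.exp_pos _).le,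
      Finset.mul_sum, Real.exp_sum, ENNReal.ofReal_prod_of_nonneg fun i _ => (Real.exp_pos _).le]
    congr 1
    refine Finset.prod_congr rfl fun i _ => ?_
    rw [mul_add, Real.exp_add, ENNReal.ofReal_mul (Real.exp_pos _).le]
    rfl
  have h2 : ∫⁻ y, f y = ENNReal.ofReal (√2)⁻¹ := by
    rw [← (measurePreserving_joinEuc d 1).lintegral_comp hf]
    have h3 : ∀ p : EucSpace d × EucSpace 1,
        f (joinEuc p.1 p.2) = gaussW Real.pi p.1 * gaussW (2 * Real.pi) p.2 := by
      intro p
      have h4 : (inner ℝ (lastVec d) (joinEuc p.1 p.2) : ℝ) ^ 2 = ‖p.2‖ ^ 2 := by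
        have : (inner ℝ (lastVec d) (joinEuc p.1 p.2) : ℝ) = p.2 0 := by
          rw [joinEuc_eq, inner_add_right, inner_lastVec_topEuc, zero_add, lastVec,
            LinearIsometry.inner_map_map]
          simp [EuclideanSpace.inner_single_left]
        rw [this, EuclideanSpace.norm_sq_eq]
        simp
      simp only [f]
      rw [h4, gaussW_joinEuc, mul_assoc]
      congr 1
      rw [gaussW, gaussW, ← ENNReal.ofReal_mul (Real.exp_pos _).le, ← Real.exp_add]
      congr 2
      ring
    simp_rw [h3]
    rw [Measure.volume_eq_prod, lintegral_prod_mul (measurable_gaussW _).aemeasurable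
      (measurable_gaussW _).aemeasurable, lintegral_gaussW_pi, one_mul,
      lintegral_gaussW (by positivity), finrank_euclideanSpace_fin]
    congr 1
    have : Real.pi / (2 * Real.pi) = 2⁻¹ := by
      field_simp
    rw [this, Nat.cast_one, ← Real.sqrt_eq_rpow, Real.sqrt_inv]
  simp_rw [h1]
  rw [Measure.volume_eq_prod, lintegral_prod_mul (f := fun v : Fin k → EucSpace (d + 1) =>
      ∏ i, f (v i)) (Finset.measurable_fun_prod _ fun i _ =>
      hf.comp (measurable_pi_apply i)).aemeasurable (measurable_gaussW _).aemeasurable,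
    lintegral_gaussW_pi, mul_one, lintegral_pi_prod_eq_pow hf, h2, ENNReal.ofReal_pow (by positivity)]

theorem finrank_chart (k d : ℕ) :
    Module.finrank ℝ ((Fin k → EucSpace (d + 1)) × EucSpace d) = k + d + k * d := by
  rw [Module.finrank_prod, Module.finrank_pi_fintype]
  simp
  ring

/-- Near the origin, the chart distorts volumes by a factor close to `2^{k/2}`. -/
theorem exists_nhds_euclideanHausdorffMeasure_flagChart (k d : ℕ) {ε : NNReal} (hε : 0 < ε)
    (hε1 : ε < 1) : ∃ U ∈ nhds (0 : (Fin k → EucSpace (d + 1)) × EucSpace d), ∀ T ⊆ U,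
      μHE[k + d + k * d] (flagChart '' T) ≤
        (1 + ε : NNReal) ^ (k + d + k * d) * (ENNReal.ofReal (√2 ^ k) * volume T) ∧
      (1 - ε : NNReal) ^ (k + d + k * d) * (ENNReal.ofReal (√2 ^ k) * volume T) ≤
        μHE[k + d + k * d] (flagChart '' T) := by
  have : (volume : Measure ((Fin k → EucSpace (d + 1)) × EucSpace d)).IsAddHaarMeasure :=
    Measure.prod.instIsAddHaarMeasure _ _
  rw [← finrank_chart]
  refine exists_nhds_euclideanHausdorffMeasure_image (chartDeriv_injective k d) ?_
    (hasStrictFDerivAt_flagChart k d) hε hε1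
  rw [lintegral_gaussW_chartDeriv, ← ENNReal.ofReal_mul (by positivity), ← mul_pow,
    mul_inv_cancel₀ (by positivity), one_pow, ENNReal.ofReal_one]

/-! ### Integration over frames in the coordinates of the chart -/

theorem lintegral_eq_mul_lintegral_linearMap {E : Type*} [NormedAddCommGroup E] [NormedSpace ℝ E]
    [FiniteDimensional ℝ E] [MeasureSpace E] [BorelSpace E] [(volume : Measure E).IsAddHaarMeasure]
    {A : E →ₗ[ℝ] E} (hA : LinearMap.det A ≠ 0) {f : E → ENNReal} (hf : Measurable f) :
    ∫⁻ x, f x = ENNReal.ofReal |LinearMap.det A| * ∫⁻ x, f (A x) := by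
  have hm : Measurable A := A.continuous_of_finiteDimensional.measurable
  rw [← lintegral_map hf hm, Measure.map_linearMap_addHaar_eq_smul_addHaar volume hA,
    lintegral_smul_measure, smul_eq_mul, ← mul_assoc, ← ENNReal.ofReal_mul (abs_nonneg _),
    ← abs_mul, mul_inv_cancel₀ hA, abs_one, ENNReal.ofReal_one, one_mul]

/-- The linear combinations of a family of vectors with the rows of a matrix as coefficients. -/
noncomputable def mixRows {k : ℕ} (l : ℕ) (X : Matrix (Fin k) (Fin k) ℝ) :
    (Fin k → EucSpace l) →ₗ[ℝ] (Fin k → EucSpace l) :=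
  LinearMap.pi fun i => ∑ j, X i j • LinearMap.proj j

theorem mixRows_apply {k l : ℕ} (X : Matrix (Fin k) (Fin k) ℝ) (Z : Fin k → EucSpace l)
    (i : Fin k) : mixRows l X Z i = ∑ j, X i j • Z j := by
  simp [mixRows]

/-- In coordinates, `mixRows l X` consists of `l` copies of `X`. -/
theorem det_mixRows {k : ℕ} (l : ℕ) (X : Matrix (Fin k) (Fin k) ℝ) :
    LinearMap.det (mixRows l X) = X.det ^ l := by
  let e : (Fin k → EucSpace l) ≃ₗ[ℝ] (Fin l → Fin k → ℝ) :=
    { toFun := fun Z r j => Z j r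
      invFun := fun W j => WithLp.toLp 2 fun r => W r j
      map_add' := fun _ _ => rfl
      map_smul' := fun _ _ => rfl
      left_inv := fun _ => rfl
      right_inv := fun _ => rfl }
  have h : (e : (Fin k → EucSpace l) →ₗ[ℝ] (Fin l → Fin k → ℝ)) ∘ₗ mixRows l X ∘ₗ
      (e.symm : (Fin l → Fin k → ℝ) →ₗ[ℝ] (Fin k → EucSpace l)) =
      LinearMap.pi fun r => Matrix.toLin' X ∘ₗ LinearMap.proj r := by
    refine LinearMap.ext fun W => ?_
    ext r i
    change (mixRows l X (e.symm W) i) r = _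
    rw [mixRows_apply]
    simp [e, Matrix.mulVec, dotProduct]
  rw [← LinearMap.det_conj _ e, h, LinearMap.det_pi]
  simp

/-- The linear map of `ℝᵏ × ℝˡ` that carries `ℝᵏ` to the graph of `Z`, and `ℝˡ` to the orthogonal
complement of this graph. -/
noncomputable def tilt {k l : ℕ} (Z : Fin k → EucSpace l) :
    EucSpace (k + l) →L[ℝ] EucSpace (k + l) :=
  ContinuousLinearMap.id ℝ _ + ∑ i, ((innerSL ℝ (stdTop k l i)).smulRight (botEuc k l (Z i)) -
    (innerSL ℝ (botEuc k l (Z i))).smulRight (stdTop k l i))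

theorem tilt_apply {k l : ℕ} (Z : Fin k → EucSpace l) (g : EucSpace (k + l)) :
    tilt Z g = g + ∑ i, ((inner ℝ (stdTop k l i) g : ℝ) • botEuc k l (Z i) -
      (inner ℝ (botEuc k l (Z i)) g : ℝ) • stdTop k l i) := by
  simp [tilt]

theorem tilt_stdTop {k l : ℕ} (Z : Fin k → EucSpace l) (i : Fin k) :
    tilt Z (stdTop k l i) = graphFrame Z i := by
  rw [tilt_apply, graphFrame]
  simp [inner_stdTop_stdTop]

theorem tilt_topEuc {k l : ℕ} (Z : Fin k → EucSpace l) (x : EucSpace k) :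
    tilt Z (topEuc k l x) = ∑ j, x j • graphFrame Z j := by
  simp_rw [topEuc_eq_sum, map_sum, map_smul, tilt_stdTop]

theorem tilt_botEuc_affVec {k d : ℕ} (Z : Fin k → EucSpace (d + 1)) (c : EucSpace d) :
    tilt Z (botEuc k (d + 1) (affVec c)) = normalVec Z c := by
  rw [tilt_apply, normalVec]
  simp [LinearIsometry.inner_map_map, sub_eq_add_neg]

theorem norm_tilt_sub_le {k l : ℕ} (Z : Fin k → EucSpace l) (g : EucSpace (k + l)) :
    ‖tilt Z g - g‖ ≤ 2 * (∑ i, ‖Z i‖) * ‖g‖ := by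
  rw [tilt_apply, add_sub_cancel_left, Finset.mul_sum, Finset.sum_mul]
  refine (norm_sum_le _ _).trans (Finset.sum_le_sum fun i _ => ?_)
  refine (norm_sub_le _ _).trans ?_
  have h1 : |(inner ℝ (stdTop k l i) g : ℝ)| ≤ ‖g‖ := by
    have := abs_real_inner_le_norm (stdTop k l i) g
    rwa [(orthonormal_stdTop k l).1 i, one_mul] at this
  have h2 : |(inner ℝ (botEuc k l (Z i)) g : ℝ)| ≤ ‖Z i‖ * ‖g‖ := by
    have := abs_real_inner_le_norm (botEuc k l (Z i)) g
    rwa [LinearIsometry.norm_map] at this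
  rw [norm_smul, norm_smul, LinearIsometry.norm_map, (orthonormal_stdTop k l).1 i, mul_one,
    Real.norm_eq_abs, Real.norm_eq_abs]
  nlinarith [norm_nonneg (Z i)]

theorem tilt_zero (k l : ℕ) : tilt (0 : Fin k → EucSpace l) = ContinuousLinearMap.id ℝ _ := by
  ext1 g
  rw [tilt_apply]
  simp

/-- `tilt Z` is injective, since its difference from the identity is skew. -/
theorem det_tilt_ne_zero {k l : ℕ} (Z : Fin k → EucSpace l) :
    LinearMap.det (tilt Z).toLinearMap ≠ 0 := by
  have h : ∀ g, (inner ℝ g (tilt Z g) : ℝ) = ‖g‖ ^ 2 := by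
    intro g
    rw [tilt_apply, inner_add_right, real_inner_self_eq_norm_sq, inner_sum, Finset.sum_eq_zero,
      add_zero]
    intro i _
    rw [inner_sub_right, inner_smul_right, inner_smul_right, real_inner_comm g (stdTop k l i),
      real_inner_comm g (botEuc k l (Z i)), mul_comm, sub_self]
  have hinj : LinearMap.ker (tilt Z).toLinearMap = ⊥ := by
    rw [LinearMap.ker_eq_bot']
    intro g hg
    have h1 := h g
    rw [show tilt Z g = 0 from hg, inner_zero_right] at h1
    exact norm_eq_zero.mp (pow_eq_zero_iff two_ne_zero |>.mp h1.symm)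
  exact (LinearMap.bot_lt_ker_of_det_eq_zero.mt (by rw [hinj]; exact lt_irrefl _))

theorem continuousAt_tilt_zero (k l : ℕ) : ContinuousAt (tilt (k := k) (l := l)) 0 := by
  rw [ContinuousAt, tilt_zero, tendsto_iff_norm_sub_tendsto_zero]
  have h1 : Filter.Tendsto (fun Z : Fin k → EucSpace l => 2 * ∑ i, ‖Z i‖) (nhds 0) (nhds 0) := by
    have : Continuous fun Z : Fin k → EucSpace l => 2 * ∑ i, ‖Z i‖ := by fun_prop
    simpa using this.tendsto 0
  refine squeeze_zero (fun _ => norm_nonneg _) (fun Z => ?_) h1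
  exact ContinuousLinearMap.opNorm_le_bound _ (by positivity) fun g => norm_tilt_sub_le Z g

theorem measurable_joinEuc_right {k l : ℕ} (x : EucSpace k) :
    Measurable fun y : EucSpace l => joinEuc x y := by
  simp_rw [joinEuc_eq]
  exact (continuous_const.add (botEuc k l).continuous).measurable

theorem measurable_joinEuc_left {k l : ℕ} (y : EucSpace l) :
    Measurable fun x : EucSpace k => joinEuc x y := by
  simp_rw [joinEuc_eq]
  exact ((topEuc k l).continuous.add continuous_const).measurable

theorem lintegral_pi_joinEuc {j k l : ℕ} {f : (Fin j → EucSpace (k + l)) → ENNReal}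
    (hf : Measurable f) :
    ∫⁻ v, f v = ∫⁻ X : Fin j → EucSpace k, ∫⁻ Y : Fin j → EucSpace l,
      f fun i => joinEuc (X i) (Y i) := by
  have h1 := volume_preserving_pi fun _ : Fin j => measurePreserving_joinEuc k l
  have h2 := (volume_measurePreserving_arrowProdEquivProdArrow (EucSpace k) (EucSpace l)
    (Fin j)).symm
  have h3 := h1.comp h2
  rw [← h3.lintegral_comp hf, Measure.volume_eq_prod]
  exact lintegral_prod _ (hf.comp h3.measurable).aemeasurable

theorem lintegral_joinEuc {k l : ℕ} {f : EucSpace (k + l) → ENNReal} (hf : Measurable f) :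
    ∫⁻ v, f v = ∫⁻ x : EucSpace k, ∫⁻ y : EucSpace l, f (joinEuc x y) := by
  have h := measurePreserving_joinEuc k l
  rw [← h.lintegral_comp hf, Measure.volume_eq_prod]
  exact lintegral_prod _ (hf.comp h.measurable).aemeasurable

/-- Integration in projective coordinates: the vectors of `ℝᵈ⁺¹` outside a hyperplane are the
multiples `τ (1, c)`.  The number `τ` is the coordinate of a vector of `ℝ¹`. -/
theorem lintegral_smul_affVec {d : ℕ} {f : EucSpace (d + 1) → ENNReal} (hf : Measurable f) :
    ∫⁻ w, f w = ∫⁻ t : EucSpace 1, ENNReal.ofReal (‖t‖ ^ d) *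
      ∫⁻ c : EucSpace d, f (t 0 • affVec c) := by
  have h := measurePreserving_joinEuc d 1
  rw [← h.lintegral_comp hf, Measure.volume_eq_prod]
  refine (lintegral_prod_symm _ (hf.comp h.measurable).aemeasurable).trans ?_
  have hne : ∀ᵐ t : EucSpace 1, t ≠ 0 := by
    rw [ae_iff]
    simp
  refine lintegral_congr_ae ?_
  filter_upwards [hne] with t ht
  have ht0 : t 0 ≠ 0 := by
    intro h0
    refine ht (PiLp.ext fun i => ?_)
    fin_cases i
    exact h0
  have hnorm : ‖t‖ = |t 0| := by
    rw [EuclideanSpace.norm_eq]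
    simp [Real.sqrt_sq_eq_abs]
  have hdet : LinearMap.det (t 0 • (LinearMap.id : EucSpace d →ₗ[ℝ] EucSpace d)) = t 0 ^ d := by
    rw [LinearMap.det_smul, LinearMap.det_id, mul_one, finrank_euclideanSpace_fin]
  have hjoin : ∀ c : EucSpace d, joinEuc (t 0 • c) t = t 0 • affVec c := by
    intro c
    have h1 : t = t 0 • EuclideanSpace.single 0 (1 : ℝ) := by
      ext i
      fin_cases i
      simp
    have h2 : t 0 • lastVec d = botEuc d 1 t := by
      rw [lastVec, ← map_smul, ← h1]
    rw [joinEuc_eq, affVec, smul_add, map_smul, h2]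
    exact add_comm _ _
  have hm : Measurable fun c : EucSpace d => f (joinEuc c t) :=
    hf.comp (measurable_joinEuc_left t)
  have hdet0 : LinearMap.det (t 0 • (LinearMap.id : EucSpace d →ₗ[ℝ] EucSpace d)) ≠ 0 := by
    rw [hdet]
    exact pow_ne_zero _ ht0
  refine (lintegral_eq_mul_lintegral_linearMap hdet0 hm).trans ?_
  rw [hdet, abs_pow, hnorm]
  congr 1
  refine lintegral_congr fun c => ?_
  rw [← hjoin]
  rfl

theorem abs_det_eq_norm_wedge {k : ℕ} (X : Fin k → EucSpace k) :
    |(Matrix.of fun i j => X i j).det| = ‖wedge X‖ := by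
  have h := wedge_sum_smul (Matrix.of fun i j => X i j)
    (fun j : Fin k => (EuclideanSpace.single j (1 : ℝ) : EucSpace k))
  have h2 : (fun i => ∑ j, (Matrix.of fun i j => X i j) i j •
      (EuclideanSpace.single j (1 : ℝ) : EucSpace k)) = X := by
    ext1 i
    simpa using (EuclideanSpace.basisFun (Fin k) ℝ).sum_repr (X i)
  rw [h2] at h
  rw [h, norm_smul, norm_wedge_of_orthonormal (EuclideanSpace.orthonormal_single (𝕜 := ℝ)), mul_one,
    Real.norm_eq_abs]

/-- Integration over frames: a frame of `k` vectors is a basis of the graph of some `Z`, given by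
the matrix `X` of its top components, and a further vector is resolved along this graph and its
orthogonal complement. -/
theorem lintegral_frame {k d : ℕ}
    {f : (Fin k → EucSpace (k + (d + 1))) × EucSpace (k + (d + 1)) → ENNReal} (hf : Measurable f) :
    ∫⁻ p, f p = ∫⁻ X : Fin k → EucSpace k, ENNReal.ofReal (‖wedge X‖ ^ (d + 1)) *
      ∫⁻ Z : Fin k → EucSpace (d + 1), ENNReal.ofReal |LinearMap.det (tilt Z).toLinearMap| *
        ∫⁻ x : EucSpace k, ∫⁻ t : EucSpace 1, ENNReal.ofReal (‖t‖ ^ d) *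
          ∫⁻ c : EucSpace d, f (fun i => tilt Z (topEuc k (d + 1) (X i)),
            tilt Z (joinEuc x (t 0 • affVec c))) := by
  have hF : Measurable fun v : Fin k → EucSpace (k + (d + 1)) => ∫⁻ g, f (v, g) :=
    hf.lintegral_prod_right'
  rw [Measure.volume_eq_prod, lintegral_prod _ hf.aemeasurable, lintegral_pi_joinEuc hF]
  refine lintegral_congr_ae ?_
  filter_upwards [ae_linearIndependent k le_rfl] with X hX
  have hdet : (Matrix.of fun i j => X i j).det ≠ 0 := by
    rw [← abs_pos, abs_det_eq_norm_wedge, norm_pos_iff]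
    exact wedge_ne_zero_iff.mpr hX
  have hm : Measurable fun Y : Fin k → EucSpace (d + 1) =>
      ∫⁻ g, f (fun i => joinEuc (X i) (Y i), g) := by
    have h1 : Measurable fun (Y : Fin k → EucSpace (d + 1)) i => joinEuc (X i) (Y i) :=
      measurable_pi_lambda _ fun i =>
        (measurable_joinEuc_right (X i)).comp (measurable_pi_apply i)
    exact hF.comp h1
  refine (lintegral_eq_mul_lintegral_linearMap
    (A := mixRows (d + 1) (Matrix.of fun i j => X i j))
    (by rw [det_mixRows]; exact pow_ne_zero _ hdet) hm).trans ?_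
  rw [det_mixRows, abs_pow, abs_det_eq_norm_wedge]
  congr 1
  refine lintegral_congr fun Z => ?_
  have h1 : (fun i => joinEuc (X i) (mixRows (d + 1) (Matrix.of fun i j => X i j) Z i)) =
      fun i => tilt Z (topEuc k (d + 1) (X i)) := by
    ext1 i
    rw [mixRows_apply, tilt_topEuc, sum_smul_graphFrame]
    rfl
  rw [h1]
  have hm2 : Measurable fun g : EucSpace (k + (d + 1)) =>
      f (fun i => tilt Z (topEuc k (d + 1) (X i)), g) := hf.comp measurable_prodMk_left
  have hm3 : Measurable fun g : EucSpace (k + (d + 1)) =>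
      f (fun i => tilt Z (topEuc k (d + 1) (X i)), tilt Z g) :=
    hm2.comp (tilt Z).continuous.measurable
  refine (lintegral_eq_mul_lintegral_linearMap (det_tilt_ne_zero Z) hm2).trans ?_
  congr 1
  refine (lintegral_joinEuc hm3).trans (lintegral_congr fun x => ?_)
  have hm4 : Measurable fun w : EucSpace (d + 1) =>
      f (fun i => tilt Z (topEuc k (d + 1) (X i)), tilt Z (joinEuc x w)) :=
    hm3.comp (measurable_joinEuc_right x)
  exact lintegral_smul_affVec hm4

/-! ### The Gaussian weight of small balls -/

theorem inner_normalize_graphFrame_pos {k l : ℕ} (Z : Fin k → EucSpace l) :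
    0 < (inner ℝ (NormedSpace.normalize (wedge (graphFrame Z))) (wedge (stdTop k l)) : ℝ) := by
  have h : (inner ℝ (NormedSpace.normalize (wedge (graphFrame Z))) (wedge (stdTop k l)) : ℝ) =
      ‖wedge (graphFrame Z)‖⁻¹ * inner ℝ (wedge (graphFrame Z)) (wedge (stdTop k l)) :=
    real_inner_smul_left (F := KVec (k + l) k) _ _ _
  rw [h, inner_graphFrame_wedge_stdTop, mul_one]
  exact inv_pos.mpr (norm_pos_iff.mpr (wedge_graphFrame_ne_zero Z))

/-- Among the flag of a frame and the reversed flag, exactly one can lie in the domain of the chart,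
and it does so if the last vector of the frame is on the right side of the hyperplane. -/
theorem indicator_flagOf_add {k d : ℕ} {B : Set (FlagAmbient (k + (d + 1)) k)}
    (hB : B ⊆ chartDomain k d) (X : Fin k → EucSpace k) (hX : wedge X ≠ 0)
    (Z : Fin k → EucSpace (d + 1)) (x : EucSpace k) (τ : ℝ) (c : EucSpace d) :
    (B.indicator 1 (flagOf (fun i => tilt Z (topEuc k (d + 1) (X i)),
        tilt Z (joinEuc x (τ • affVec c)))) +
      B.indicator 1 (flagFlip _ k (flagOf (fun i => tilt Z (topEuc k (d + 1) (X i)),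
        tilt Z (joinEuc x (τ • affVec c))))) : ENNReal) =
    (if 0 < τ then 1 else 0) * (flagChart ⁻¹' B).indicator 1 (Z, c) := by
  let D : Matrix (Fin k) (Fin k) ℝ := Matrix.of fun i j => X i j
  have hD : D.det ≠ 0 := by
    rw [← abs_pos, abs_det_eq_norm_wedge, norm_pos_iff]
    exact hX
  have hg : tilt Z (joinEuc x (τ • affVec c)) =
      ∑ j, x j • graphFrame Z j + τ • normalVec Z c := by
    rw [joinEuc_eq, map_add, tilt_topEuc, map_smul, map_smul, tilt_botEuc_affVec]
  have hv : (fun i => tilt Z (topEuc k (d + 1) (X i))) = fun i => ∑ j, D i j • graphFrame Z j := by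
    ext1 i
    rw [tilt_topEuc]
    rfl
  rw [hv, flagOf_eq D hD (graphFrame Z) x τ (inner_graphFrame_normalVec Z c) hg]
  have hnot : ∀ p : FlagAmbient (k + (d + 1)) k, p ∉ chartDomain k d →
      (B.indicator 1 p : ENNReal) = 0 := fun p hp =>
    Set.indicator_of_notMem (fun h => hp (hB h)) _
  by_cases hτ : 0 < τ
  · rw [if_pos hτ, one_mul, NormedSpace.normalize_smul_of_pos hτ]
    have hchart : (flagChart ⁻¹' B).indicator 1 (Z, c) =
        (B.indicator 1 (flagChart (Z, c)) : ENNReal) := rfl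
    have hflip : flagFlip _ k (flagChart (Z, c)) ∉ chartDomain k d := by
      rintro ⟨h, -⟩
      have h2 := inner_normalize_graphFrame_pos Z
      have h3 : (inner ℝ (flagFlip _ k (flagChart (Z, c))).snd (wedge (stdTop k (d + 1))) : ℝ) =
          -inner ℝ (NormedSpace.normalize (wedge (graphFrame Z))) (wedge (stdTop k (d + 1))) :=
        inner_neg_left (E := KVec (k + (d + 1)) k) _ _
      linarith
    rcases lt_or_gt_of_ne hD with h | h
    · have h1 : WithLp.toLp 2 (NormedSpace.normalize (normalVec Z c),
          NormedSpace.normalize (D.det • wedge (graphFrame Z))) =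
          flagFlip _ k (flagChart (Z, c)) := by
        refine (WithLp.equiv 2 _).injective (Prod.ext rfl ?_)
        exact NormedSpace.normalize_smul_of_neg h _
      rw [h1, flagFlip_flagFlip, hnot _ hflip, zero_add, hchart]
    · have h1 : WithLp.toLp 2 (NormedSpace.normalize (normalVec Z c),
          NormedSpace.normalize (D.det • wedge (graphFrame Z))) = flagChart (Z, c) := by
        refine (WithLp.equiv 2 _).injective (Prod.ext rfl ?_)
        exact NormedSpace.normalize_smul_of_pos h _
      rw [h1, hnot _ hflip, add_zero, hchart]
  · have h1 : ¬ 0 < (inner ℝ (baseVec k d) (NormedSpace.normalize (τ • normalVec Z c)) : ℝ) := by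
      rw [NormedSpace.normalize, inner_smul_right, inner_smul_right, inner_baseVec_normalVec,
        mul_one, not_lt]
      exact mul_nonpos_of_nonneg_of_nonpos (by positivity) (not_lt.mp hτ)
    have h2 : ∀ w, WithLp.toLp 2 (NormedSpace.normalize (τ • normalVec Z c), w) ∉ chartDomain k d :=
      fun w h => h1 h.2
    have h3 : ∀ w, flagFlip _ k (WithLp.toLp 2 (NormedSpace.normalize (τ • normalVec Z c), w)) ∉
        chartDomain k d := fun w h => h1 h.2
    rw [if_neg hτ, zero_mul, hnot _ (h2 _), hnot _ (h3 _), add_zero]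

theorem norm_eucSpace_one (t : EucSpace 1) : ‖t‖ = |t 0| := by
  rw [EuclideanSpace.norm_eq]
  simp [Real.sqrt_sq_eq_abs]

/-- Near the origin of the chart, the coordinates of a frame have almost the same norms as the
vectors they stand for. -/
theorem eventually_norm_tilt (k d : ℕ) {η : ℝ} (hη : 0 < η) :
    ∀ᶠ q in nhds (0 : (Fin k → EucSpace (d + 1)) × EucSpace d),
      |(|LinearMap.det (tilt q.1).toLinearMap| - 1)| ≤ η ∧
      (∀ x, |‖tilt q.1 (topEuc k (d + 1) x)‖ - ‖x‖| ≤ η * ‖x‖) ∧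
      ∀ x (t : EucSpace 1), |‖tilt q.1 (joinEuc x (t 0 • affVec q.2))‖ -
        ‖joinEuc x (t 0 • lastVec d)‖| ≤ η * ‖joinEuc x (t 0 • lastVec d)‖ := by
  have htilt : Filter.Tendsto (fun q : (Fin k → EucSpace (d + 1)) × EucSpace d => tilt q.1)
      (nhds 0) (nhds (ContinuousLinearMap.id ℝ _)) := by
    have h1 := continuousAt_tilt_zero k (d + 1)
    rw [ContinuousAt, tilt_zero] at h1
    exact h1.comp continuous_fst.continuousAt
  have hdet : Filter.Tendsto (fun q : (Fin k → EucSpace (d + 1)) × EucSpace d =>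
      |(|LinearMap.det (tilt q.1).toLinearMap| - 1)|) (nhds 0) (nhds 0) := by
    have h2 := ((ContinuousLinearMap.continuous_det (𝕜 := ℝ)
      (E := EucSpace (k + (d + 1)))).tendsto _).comp htilt
    have h3 := ((h2.abs).sub_const 1).abs
    have h4 : (ContinuousLinearMap.id ℝ (EucSpace (k + (d + 1)))).det = 1 := by
      exact LinearMap.det_id
    rw [h4, abs_one, sub_self, abs_zero] at h3
    exact h3
  have hsum : Filter.Tendsto (fun q : (Fin k → EucSpace (d + 1)) × EucSpace d =>
      2 * (∑ i, ‖q.1 i‖)) (nhds 0) (nhds 0) := by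
    have : Continuous fun q : (Fin k → EucSpace (d + 1)) × EucSpace d => 2 * ∑ i, ‖q.1 i‖ := by
      fun_prop
    simpa using this.tendsto 0
  have hc : Filter.Tendsto (fun q : (Fin k → EucSpace (d + 1)) × EucSpace d =>
      2 * (∑ i, ‖q.1 i‖) * (1 + ‖q.2‖) + ‖q.2‖) (nhds 0) (nhds 0) := by
    have : Continuous fun q : (Fin k → EucSpace (d + 1)) × EucSpace d =>
        2 * (∑ i, ‖q.1 i‖) * (1 + ‖q.2‖) + ‖q.2‖ := by
      fun_prop
    simpa using this.tendsto 0
  filter_upwards [hdet.eventually_le_const hη, hsum.eventually_le_const hη,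
    hc.eventually_le_const hη] with q h1 h2 h3
  refine ⟨h1, fun x => ?_, fun x t => ?_⟩
  · have h4 := norm_tilt_sub_le q.1 (topEuc k (d + 1) x)
    rw [LinearIsometry.norm_map] at h4
    have h5 := abs_norm_sub_norm_le (tilt q.1 (topEuc k (d + 1) x)) (topEuc k (d + 1) x)
    rw [LinearIsometry.norm_map] at h5
    refine h5.trans (h4.trans ?_)
    gcongr
  · set g := joinEuc x (t 0 • affVec q.2)
    set g' := joinEuc x (t 0 • lastVec d)
    have h4 := norm_tilt_sub_le q.1 g
    have h5 : g - g' = botEuc k (d + 1) (t 0 • topEuc d 1 q.2) := by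
      simp only [g, g', joinEuc_eq, affVec, smul_add, map_add]
      abel
    have h6 : |t 0| ≤ ‖g'‖ := by
      have := norm_joinEuc_sq x (t 0 • lastVec d)
      rw [norm_smul, norm_lastVec, mul_one, Real.norm_eq_abs] at this
      exact abs_le_of_sq_le_sq' (by nlinarith [sq_nonneg ‖x‖]) (norm_nonneg _) |>.2
    have h7 : ‖g - g'‖ ≤ ‖q.2‖ * ‖g'‖ := by
      rw [h5, LinearIsometry.norm_map, norm_smul, LinearIsometry.norm_map, Real.norm_eq_abs,
        mul_comm]
      gcongr
    have h8 : ‖g‖ ≤ (1 + ‖q.2‖) * ‖g'‖ := by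
      have := norm_le_norm_add_norm_sub' g g'
      linarith
    have h9 := abs_norm_sub_norm_le (tilt q.1 g) g'
    have h10 := norm_sub_le_norm_sub_add_norm_sub (tilt q.1 g) g g'
    have hS : 0 ≤ 2 * ∑ i, ‖q.1 i‖ := by positivity
    calc _ ≤ ‖tilt q.1 g - g‖ + ‖g - g'‖ := h9.trans h10
      _ ≤ 2 * (∑ i, ‖q.1 i‖) * ((1 + ‖q.2‖) * ‖g'‖) + ‖q.2‖ * ‖g'‖ := by
        refine add_le_add (h4.trans ?_) h7
        gcongr
      _ = (2 * (∑ i, ‖q.1 i‖) * (1 + ‖q.2‖) + ‖q.2‖) * ‖g'‖ := by ring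
      _ ≤ η * ‖g'‖ := by gcongr

theorem gaussW_le_gaussW {E F : Type*} [NormedAddCommGroup E] [NormedAddCommGroup F] {η : ℝ}
    (hη : η ≤ 1) {b : ℝ} (hb : 0 ≤ b) {g : E} {x : F} (h : |‖g‖ - ‖x‖| ≤ η * ‖x‖) :
    gaussW b g ≤ gaussW (b * (1 - η) ^ 2) x := by
  rw [abs_le] at h
  refine ENNReal.ofReal_le_ofReal (Real.exp_le_exp.mpr ?_)
  have h1 : ((1 - η) * ‖x‖) ^ 2 ≤ ‖g‖ ^ 2 := by
    have : 0 ≤ (1 - η) * ‖x‖ := mul_nonneg (by linarith) (norm_nonneg _)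
    gcongr
    linarith
  nlinarith [mul_le_mul_of_nonneg_left h1 hb]

theorem gaussW_ge_gaussW {E F : Type*} [NormedAddCommGroup E] [NormedAddCommGroup F] {η : ℝ}
    {b : ℝ} (hb : 0 ≤ b) {g : E} {x : F} (h : |‖g‖ - ‖x‖| ≤ η * ‖x‖) :
    gaussW (b * (1 + η) ^ 2) x ≤ gaussW b g := by
  rw [abs_le] at h
  refine ENNReal.ofReal_le_ofReal (Real.exp_le_exp.mpr ?_)
  have h1 : ‖g‖ ^ 2 ≤ ((1 + η) * ‖x‖) ^ 2 := by
    gcongr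
    linarith
  nlinarith [mul_le_mul_of_nonneg_left h1 hb]

theorem gaussW_joinEuc_smul_lastVec {k d : ℕ} (b : ℝ) (x : EucSpace k) (t : EucSpace 1) :
    gaussW b (joinEuc x (t 0 • lastVec d)) = gaussW b x * gaussW b t := by
  rw [gaussW_joinEuc]
  congr 1
  rw [gaussW, gaussW, norm_smul, norm_lastVec, mul_one, norm_eucSpace_one, Real.norm_eq_abs]

/-- The Gaussian integral over frames that remains when the chart is split off. -/
noncomputable def frameConst (k d : ℕ) (b : ℝ) : ENNReal :=
  (∫⁻ X : Fin k → EucSpace k, gaussPi b X * ENNReal.ofReal (‖wedge X‖ ^ (d + 1))) *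
    ((∫⁻ x : EucSpace k, gaussW b x) *
      ∫⁻ t : EucSpace 1, (gaussW b t * ENNReal.ofReal (‖t‖ ^ d)) * if 0 < t 0 then 1 else 0)

theorem measurable_ite_pos : Measurable fun t : EucSpace 1 => (if 0 < t 0 then 1 else 0 : ENNReal) :=
  Measurable.ite (measurableSet_lt measurable_const
    (EuclideanSpace.proj (𝕜 := ℝ) (0 : Fin 1)).continuous.measurable)
    measurable_const measurable_const

/-- The frame integral for a Gaussian density that does not see the tilt of the flag splits into
the volume of the domain in the chart and a constant. In `flagWeight_le` and `flagWeight_ge` the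
tilt is absorbed into the parameter `b`. -/
theorem lintegral_frame_product {k d : ℕ} (a : ENNReal) (b : ℝ)
    {T : Set ((Fin k → EucSpace (d + 1)) × EucSpace d)} (hT : MeasurableSet T) :
    ∫⁻ X : Fin k → EucSpace k, ENNReal.ofReal (‖wedge X‖ ^ (d + 1)) *
      ∫⁻ Z : Fin k → EucSpace (d + 1), a *
        ∫⁻ x : EucSpace k, ∫⁻ t : EucSpace 1, ENNReal.ofReal (‖t‖ ^ d) *
          ∫⁻ c : EucSpace d, (gaussPi b X * (gaussW b x * gaussW b t)) *
            ((if 0 < t 0 then 1 else 0) * T.indicator 1 (Z, c)) =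
    a * (frameConst k d b * volume T) := by
  have hT' : Measurable (T.indicator 1 : _ → ENNReal) := measurable_one.indicator hT
  have h1 : ∀ (X : Fin k → EucSpace k) (Z : Fin k → EucSpace (d + 1)) (x : EucSpace k)
      (t : EucSpace 1), ENNReal.ofReal (‖t‖ ^ d) *
          ∫⁻ c : EucSpace d, (gaussPi b X * (gaussW b x * gaussW b t)) *
            ((if 0 < t 0 then 1 else 0) * T.indicator 1 (Z, c)) =
      (gaussPi b X * gaussW b x * ∫⁻ c : EucSpace d, T.indicator 1 (Z, c)) *
        ((gaussW b t * ENNReal.ofReal (‖t‖ ^ d)) * if 0 < t 0 then 1 else 0) := by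
    intro X Z x t
    have hm : Measurable fun c : EucSpace d => (T.indicator 1 (Z, c) : ENNReal) :=
      hT'.comp measurable_prodMk_left
    rw [lintegral_const_mul _ (hm.const_mul _), lintegral_const_mul _ hm]
    ring
  have hmt : Measurable fun t : EucSpace 1 =>
      (gaussW b t * ENNReal.ofReal (‖t‖ ^ d)) * (if 0 < t 0 then 1 else 0 : ENNReal) :=
    ((measurable_gaussW b).mul (by fun_prop)).mul measurable_ite_pos
  have hmZ : Measurable fun Z : Fin k → EucSpace (d + 1) =>
      ∫⁻ c : EucSpace d, (T.indicator 1 (Z, c) : ENNReal) := hT'.lintegral_prod_right'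
  have hmX : Measurable fun X : Fin k → EucSpace k =>
      gaussPi b X * ENNReal.ofReal (‖wedge X‖ ^ (d + 1)) :=
    (measurable_gaussPi b).mul ((continuous_wedge k k).norm.pow _).measurable.ennreal_ofReal
  have h2 : ∀ (X : Fin k → EucSpace k) (Z : Fin k → EucSpace (d + 1)),
      a * ∫⁻ x : EucSpace k, ∫⁻ t : EucSpace 1,
        (gaussPi b X * gaussW b x * ∫⁻ c : EucSpace d, T.indicator 1 (Z, c)) *
        ((gaussW b t * ENNReal.ofReal (‖t‖ ^ d)) * if 0 < t 0 then 1 else 0) =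
      (a * gaussPi b X * ((∫⁻ x : EucSpace k, gaussW b x) *
        ∫⁻ t : EucSpace 1, (gaussW b t * ENNReal.ofReal (‖t‖ ^ d)) * if 0 < t 0 then 1 else 0)) *
        ∫⁻ c : EucSpace d, (T.indicator 1 (Z, c) : ENNReal) := by
    intro X Z
    simp_rw [lintegral_const_mul _ hmt]
    set s := ∫⁻ c : EucSpace d, (T.indicator 1 (Z, c) : ENNReal)
    set C := ∫⁻ t : EucSpace 1, (gaussW b t * ENNReal.ofReal (‖t‖ ^ d)) *
      (if 0 < t 0 then 1 else 0 : ENNReal)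
    have h3 : ∀ x : EucSpace k, gaussPi b X * gaussW b x * s * C =
        gaussW b x * (gaussPi b X * s * C) := fun x => by ring
    simp_rw [h3]
    rw [lintegral_mul_const _ (measurable_gaussW b)]
    ring
  simp_rw [h1, h2, lintegral_const_mul _ hmZ]
  have h3 : ∫⁻ (Z : Fin k → EucSpace (d + 1)) (c : EucSpace d), (T.indicator 1 (Z, c) : ENNReal) =
      volume T := by
    rw [← lintegral_indicator_one hT, Measure.volume_eq_prod, lintegral_prod _ hT'.aemeasurable]
  rw [h3, frameConst]
  have h4 : ∀ X : Fin k → EucSpace k, ENNReal.ofReal (‖wedge X‖ ^ (d + 1)) *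
      ((a * gaussPi b X * ((∫⁻ x : EucSpace k, gaussW b x) *
        ∫⁻ t : EucSpace 1, (gaussW b t * ENNReal.ofReal (‖t‖ ^ d)) * if 0 < t 0 then 1 else 0)) *
        volume T) = (gaussPi b X * ENNReal.ofReal (‖wedge X‖ ^ (d + 1))) *
      (a * ((∫⁻ x : EucSpace k, gaussW b x) *
        ∫⁻ t : EucSpace 1, (gaussW b t * ENNReal.ofReal (‖t‖ ^ d)) * if 0 < t 0 then 1 else 0) *
        volume T) := by
    intro X
    ring
  simp_rw [h4]
  rw [lintegral_mul_const _ hmX]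
  ring

theorem flagWeight_eq {k d : ℕ} {B : Set (FlagAmbient (k + (d + 1)) k)} (hBm : MeasurableSet B)
    (hB : B ⊆ chartDomain k d) : flagWeight B =
    ∫⁻ X : Fin k → EucSpace k, ENNReal.ofReal (‖wedge X‖ ^ (d + 1)) *
      ∫⁻ Z : Fin k → EucSpace (d + 1), ENNReal.ofReal |LinearMap.det (tilt Z).toLinearMap| *
        ∫⁻ x : EucSpace k, ∫⁻ t : EucSpace 1, ENNReal.ofReal (‖t‖ ^ d) *
          ∫⁻ c : EucSpace d, (gaussPi Real.pi (fun i => tilt Z (topEuc k (d + 1) (X i))) *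
            gaussW Real.pi (tilt Z (joinEuc x (t 0 • affVec c)))) *
            ((if 0 < t 0 then 1 else 0) * (flagChart ⁻¹' B).indicator 1 (Z, c)) := by
  rw [flagWeight, lintegral_frame (measurable_flagWeight_integrand hBm)]
  refine lintegral_congr fun X => ?_
  by_cases hX : wedge X = 0
  · rw [hX, norm_zero, zero_pow (Nat.succ_ne_zero d), ENNReal.ofReal_zero, zero_mul, zero_mul]
  · simp_rw [indicator_flagOf_add hB X hX]
    rfl

/-- The Gaussian weight of a small set around the base point is nearly proportional to the volume
of the set in the chart: estimate from above. -/
theorem flagWeight_le {k d : ℕ} {η : ℝ} (hη : η ≤ 1)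
    {U : Set ((Fin k → EucSpace (d + 1)) × EucSpace d)}
    (hU : ∀ q ∈ U, |(|LinearMap.det (tilt q.1).toLinearMap| - 1)| ≤ η ∧
      (∀ x, |‖tilt q.1 (topEuc k (d + 1) x)‖ - ‖x‖| ≤ η * ‖x‖) ∧
      ∀ x (t : EucSpace 1), |‖tilt q.1 (joinEuc x (t 0 • affVec q.2))‖ -
        ‖joinEuc x (t 0 • lastVec d)‖| ≤ η * ‖joinEuc x (t 0 • lastVec d)‖)
    {B : Set (FlagAmbient (k + (d + 1)) k)} (hBm : MeasurableSet B) (hB : B ⊆ chartDomain k d)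
    (hT : MeasurableSet (flagChart (k := k) (d := d) ⁻¹' B)) (hBU : flagChart ⁻¹' B ⊆ U) :
    flagWeight B ≤ ENNReal.ofReal (1 + η) *
      (frameConst k d (Real.pi * (1 - η) ^ 2) * volume (flagChart (k := k) (d := d) ⁻¹' B)) := by
  rw [flagWeight_eq hBm hB, ← lintegral_frame_product _ _ hT]
  refine lintegral_mono fun X => mul_le_mul_right (?_ : _ ≤ _) _
  refine lintegral_mono fun Z => ?_
  by_cases hZ : ∃ c, (Z, c) ∈ flagChart ⁻¹' B
  · obtain ⟨c₀, hc₀⟩ := hZ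
    have h0 := (hU _ (hBU hc₀)).1
    refine mul_le_mul' (ENNReal.ofReal_le_ofReal ?_) ?_
    · rw [abs_le] at h0
      linarith
    refine lintegral_mono fun x => lintegral_mono fun t => mul_le_mul_right (?_ : _ ≤ _) _
    refine lintegral_mono fun c => ?_
    by_cases hc : (Z, c) ∈ flagChart ⁻¹' B
    · obtain ⟨-, h1, h2⟩ := hU _ (hBU hc)
      refine mul_le_mul' (mul_le_mul' ?_ ?_) le_rfl
      · exact Finset.prod_le_prod' fun i _ => gaussW_le_gaussW hη Real.pi_pos.le (h1 (X i))
      · rw [← gaussW_joinEuc_smul_lastVec (d := d)]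
        exact gaussW_le_gaussW hη Real.pi_pos.le (h2 x t)
    · rw [Set.indicator_of_notMem hc]
      simp
  · push Not at hZ
    simp_rw [Set.indicator_of_notMem (hZ _)]
    simp

/-- The Gaussian weight of a small set around the base point is nearly proportional to the volume
of the set in the chart: estimate from below. -/
theorem flagWeight_ge {k d : ℕ} {η : ℝ}
    {U : Set ((Fin k → EucSpace (d + 1)) × EucSpace d)}
    (hU : ∀ q ∈ U, |(|LinearMap.det (tilt q.1).toLinearMap| - 1)| ≤ η ∧
      (∀ x, |‖tilt q.1 (topEuc k (d + 1) x)‖ - ‖x‖| ≤ η * ‖x‖) ∧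
      ∀ x (t : EucSpace 1), |‖tilt q.1 (joinEuc x (t 0 • affVec q.2))‖ -
        ‖joinEuc x (t 0 • lastVec d)‖| ≤ η * ‖joinEuc x (t 0 • lastVec d)‖)
    {B : Set (FlagAmbient (k + (d + 1)) k)} (hBm : MeasurableSet B) (hB : B ⊆ chartDomain k d)
    (hT : MeasurableSet (flagChart (k := k) (d := d) ⁻¹' B)) (hBU : flagChart ⁻¹' B ⊆ U) :
    ENNReal.ofReal (1 - η) *
      (frameConst k d (Real.pi * (1 + η) ^ 2) * volume (flagChart (k := k) (d := d) ⁻¹' B)) ≤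
      flagWeight B := by
  rw [flagWeight_eq hBm hB, ← lintegral_frame_product _ _ hT]
  refine lintegral_mono fun X => mul_le_mul_right (?_ : _ ≤ _) _
  refine lintegral_mono fun Z => ?_
  by_cases hZ : ∃ c, (Z, c) ∈ flagChart ⁻¹' B
  · obtain ⟨c₀, hc₀⟩ := hZ
    have h0 := (hU _ (hBU hc₀)).1
    refine mul_le_mul' (ENNReal.ofReal_le_ofReal ?_) ?_
    · rw [abs_le] at h0
      linarith
    refine lintegral_mono fun x => lintegral_mono fun t => mul_le_mul_right (?_ : _ ≤ _) _
    refine lintegral_mono fun c => ?_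
    by_cases hc : (Z, c) ∈ flagChart ⁻¹' B
    · obtain ⟨-, h1, h2⟩ := hU _ (hBU hc)
      refine mul_le_mul' (mul_le_mul' ?_ ?_) le_rfl
      · exact Finset.prod_le_prod' fun i _ => gaussW_ge_gaussW Real.pi_pos.le (h1 (X i))
      · rw [← gaussW_joinEuc_smul_lastVec (d := d)]
        exact gaussW_ge_gaussW Real.pi_pos.le (h2 x t)
    · rw [Set.indicator_of_notMem hc]
      simp
  · push Not at hZ
    simp_rw [Set.indicator_of_notMem (hZ _)]
    simp

theorem continuous_flagChart (k d : ℕ) : Continuous (flagChart (k := k) (d := d)) := by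
  have h1 : Continuous fun q : (Fin k → EucSpace (d + 1)) × EucSpace d => normalVec q.1 q.2 := by
    have h2 : Continuous fun q : (Fin k → EucSpace (d + 1)) × EucSpace d => affVec q.2 :=
      continuous_const.add ((topEuc d 1).continuous.comp continuous_snd)
    have h3 : ∀ i, Continuous fun q : (Fin k → EucSpace (d + 1)) × EucSpace d =>
        (inner ℝ (q.1 i) (affVec q.2) : ℝ) • stdTop k (d + 1) i := fun i => by
      have h4 : Continuous fun q : (Fin k → EucSpace (d + 1)) × EucSpace d => q.1 i :=
        (continuous_apply i).comp continuous_fst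
      have h5 : Continuous fun q : (Fin k → EucSpace (d + 1)) × EucSpace d =>
          (inner ℝ (q.1 i) (affVec q.2) : ℝ) := h4.inner h2
      exact h5.smul continuous_const
    exact ((botEuc k (d + 1)).continuous.comp h2).sub (continuous_finsetSum _ fun i _ => h3 i)
  have h3 : Continuous fun q : (Fin k → EucSpace (d + 1)) × EucSpace d =>
      wedge (graphFrame q.1) := by
    have h4 : Continuous fun q : (Fin k → EucSpace (d + 1)) × EucSpace d => graphFrame q.1 :=
      continuous_pi fun i => by
        have h5 : Continuous fun q : (Fin k → EucSpace (d + 1)) × EucSpace d => q.1 i :=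
          (continuous_apply i).comp continuous_fst
        exact continuous_const.add ((botEuc k (d + 1)).continuous.comp h5)
    exact (continuous_wedge _ _).comp h4
  refine (WithLp.prod_continuous_toLp 2 _ _).comp (Continuous.prodMk ?_ ?_)
  · exact (h1.norm.inv₀ fun q => norm_ne_zero_iff.mpr (normalVec_ne_zero _ _)).smul h1
  · exact (h3.norm.inv₀ fun q => norm_ne_zero_iff.mpr (wedge_graphFrame_ne_zero _)).smul h3

theorem frameConst_eq (k d : ℕ) {b : ℝ} (hb : 0 < b) :
    frameConst k d b = ENNReal.ofReal ((∏ i ∈ Finset.range k,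
      ((Real.pi / b) ^ ((i : ℝ) / 2) * radialMoment (k - i) (d + 1) b)) *
      ((Real.pi / b) ^ ((k : ℝ) / 2) * (radialMoment 1 d b / 2))) := by
  have h1 : ∫⁻ t : EucSpace 1, (gaussW b t * ENNReal.ofReal (‖t‖ ^ d)) *
      (if 0 < t 0 then 1 else 0) = ENNReal.ofReal (radialMoment 1 d b / 2) := by
    have hm : Measurable fun t : EucSpace 1 =>
        (gaussW b t * ENNReal.ofReal (‖t‖ ^ d)) * (if 0 < t 0 then 1 else 0 : ENNReal) :=
      ((measurable_gaussW b).mul (by fun_prop)).mul measurable_ite_pos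
    have hneg := (LinearIsometryEquiv.neg ℝ (E := EucSpace 1)).measurePreserving.lintegral_comp hm
    have hne : ∀ᵐ t : EucSpace 1, t ≠ 0 := by
      rw [ae_iff]
      simp
    have hsum : ∫⁻ t : EucSpace 1, gaussW b t * ENNReal.ofReal (‖t‖ ^ d) =
        2 * ∫⁻ t : EucSpace 1, (gaussW b t * ENNReal.ofReal (‖t‖ ^ d)) *
          (if 0 < t 0 then 1 else 0) := by
      rw [two_mul]
      conv_rhs => enter [1]; rw [← hneg]
      rw [← lintegral_add_right _ hm]
      refine lintegral_congr_ae ?_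
      filter_upwards [hne] with t ht
      have ht0 : t 0 ≠ 0 := by
        rw [← abs_pos, ← norm_eucSpace_one]
        exact norm_pos_iff.mpr ht
      rcases lt_or_gt_of_ne ht0 with h | h
      · simp [gaussW, h, not_lt.mpr h.le]
      · simp [gaussW, h, not_lt.mpr h.le]
    rw [lintegral_norm_pow_gaussW one_pos d hb] at hsum
    rw [ENNReal.ofReal_div_of_pos two_pos, hsum, ENNReal.ofReal_ofNat, mul_comm,
      ENNReal.mul_div_cancel_right two_ne_zero ENNReal.ofNat_ne_top]
  have hπ := Real.pi_pos
  have hr : 0 ≤ ∏ i ∈ Finset.range k,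
      ((Real.pi / b) ^ ((i : ℝ) / 2) * radialMoment (k - i) (d + 1) b) := by
    refine Finset.prod_nonneg fun i hi => ?_
    have hr := radialMoment_pos (show 0 < k - i by have := Finset.mem_range.mp hi; omega) (d + 1) hb
    positivity
  rw [frameConst, h1, lintegral_norm_wedge_pow k le_rfl (Nat.succ_ne_zero d) hb,
    lintegral_gaussW hb, finrank_euclideanSpace_fin, ENNReal.ofReal_mul hr,
    ENNReal.ofReal_mul (p := (Real.pi / b) ^ ((k : ℝ) / 2)) (by positivity)]

/-- The value of `frameConst` as a real number. -/
noncomputable def frameReal (k d : ℕ) (b : ℝ) : ℝ :=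
  (∏ i ∈ Finset.range k, ((Real.pi / b) ^ ((i : ℝ) / 2) * radialMoment (k - i) (d + 1) b)) *
    ((Real.pi / b) ^ ((k : ℝ) / 2) * (radialMoment 1 d b / 2))

theorem continuousAt_frameReal (k d : ℕ) : ContinuousAt (frameReal k d) Real.pi := by
  have h1 : ∀ l s : ℕ, 0 < l → ContinuousAt (radialMoment l s) Real.pi := by
    intro l s hl
    have hl' : (0 : ℝ) < l := by exact_mod_cast hl
    have h2 := Real.Gamma_pos_of_pos (half_pos hl')
    have h3 : 0 < Real.pi ^ (((l : ℝ) + s) / 2) := Real.rpow_pos_of_pos Real.pi_pos _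
    refine continuousAt_const.div (continuousAt_const.mul ?_) (mul_pos h2 h3).ne'
    exact Real.continuousAt_rpow_const _ _ (Or.inl Real.pi_ne_zero)
  have h2 : ∀ s : ℝ, ContinuousAt (fun b => (Real.pi / b) ^ s) Real.pi := by
    intro s
    refine ContinuousAt.rpow_const (continuousAt_const.div continuousAt_id Real.pi_ne_zero)
      (Or.inl ?_)
    simp
  refine ContinuousAt.mul ?_ ((h2 _).mul ((h1 1 d one_pos).div_const _))
  refine tendsto_finsetProd _ fun i hi => (h2 _).mul (h1 _ _ ?_)
  have := Finset.mem_range.mp hi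
  omega

/-! ### The measure of the space of flags -/

/-- Small balls around the base point are parametrised by small open sets of the chart. -/
theorem exists_ball_baseFlag (k d : ℕ) {V : Set ((Fin k → EucSpace (d + 1)) × EucSpace d)}
    (hV : V ∈ nhds 0) : ∃ r > 0, Metric.ball (baseFlag k d) r ⊆ chartDomain k d ∧
      flagChart ⁻¹' Metric.ball (baseFlag k d) r ⊆ V ∧
      setW (k + (d + 1)) k ∩ Metric.ball (baseFlag k d) r =
        flagChart '' (flagChart ⁻¹' Metric.ball (baseFlag k d) r) ∧
      volume (flagChart (k := k) (d := d) ⁻¹' Metric.ball (baseFlag k d) r) ≠ 0 ∧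
      volume (flagChart (k := k) (d := d) ⁻¹' Metric.ball (baseFlag k d) r) ≠ ⊤ := by
  have hV' : chartInv ⁻¹' (V ∩ Metric.ball 0 1) ∈ nhds (baseFlag k d) := by
    refine (continuousAt_chartInv k d).preimage_mem_nhds ?_
    rw [chartInv_baseFlag]
    exact Filter.inter_mem hV (Metric.ball_mem_nhds _ one_pos)
  obtain ⟨r, hr, hball⟩ := Metric.mem_nhds_iff.mp (Filter.inter_mem hV'
    ((isOpen_chartDomain k d).mem_nhds (baseFlag_mem_chartDomain k d)))
  have hsub : flagChart ⁻¹' Metric.ball (baseFlag k d) r ⊆ V ∩ Metric.ball 0 1 := by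
    intro q hq
    have := (hball hq).1
    rwa [Set.mem_preimage, chartInv_flagChart] at this
  refine ⟨r, hr, fun p hp => (hball hp).2, fun q hq => (hsub hq).1, ?_, ?_, ?_⟩
  · refine Set.Subset.antisymm ?_ ?_
    · rintro p ⟨hp, hpb⟩
      have h := flagChart_chartInv hp (hball hpb).2
      exact ⟨chartInv p, by rwa [Set.mem_preimage, h], h⟩
    · rintro _ ⟨q, hq, rfl⟩
      exact ⟨flagChart_mem_setW q, hq⟩
  · have : (volume : Measure ((Fin k → EucSpace (d + 1)) × EucSpace d)).IsAddHaarMeasure :=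
      Measure.prod.instIsAddHaarMeasure _ _
    refine (IsOpen.measure_pos _ (Metric.isOpen_ball.preimage (continuous_flagChart k d))
      ⟨0, ?_⟩).ne'
    rw [Set.mem_preimage, flagChart_zero]
    exact Metric.mem_ball_self hr
  · have : (volume : Measure ((Fin k → EucSpace (d + 1)) × EucSpace d)).IsAddHaarMeasure :=
      Measure.prod.instIsAddHaarMeasure _ _
    exact ((measure_mono fun q hq => (hsub hq).2).trans_lt measure_ball_lt_top).ne

/-- A small ball around the base flag has finite measure by the chart, hence so has the ball of the
same radius around any other flag, and `𝒲` is compact. -/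
theorem euclideanHausdorffMeasure_setW_lt_top (k d : ℕ) :
    μHE[k + d + k * d] (setW (k + (d + 1)) k) < ⊤ := by
  obtain ⟨U, hU, hUb⟩ := exists_nhds_euclideanHausdorffMeasure_flagChart k d
    (ε := 1 / 2) (by norm_num) (by
      rw [← NNReal.coe_lt_coe]
      norm_num)
  obtain ⟨r, hr, -, h2, h3, -, h5⟩ := exists_ball_baseFlag k d hU
  have hfin : (μHE[k + d + k * d].restrict (setW (k + (d + 1)) k))
      (Metric.ball (baseFlag k d) r) < ⊤ := by
    rw [Measure.restrict_apply Metric.isOpen_ball.measurableSet, Set.inter_comm, h3]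
    refine (hUb _ h2).1.trans_lt ?_
    exact ENNReal.mul_lt_top (ENNReal.pow_lt_top ENNReal.coe_lt_top)
      (ENNReal.mul_lt_top ENNReal.ofReal_lt_top h5.lt_top)
  refine (isCompact_setW _ k).measure_lt_top_of_nhdsWithin fun x hx => ?_
  refine ⟨Metric.ball x r ∩ setW (k + (d + 1)) k, ?_, ?_⟩
  · exact Filter.inter_mem (mem_nhdsWithin_of_mem_nhds (Metric.ball_mem_nhds x hr))
      self_mem_nhdsWithin
  · rw [← Measure.restrict_apply Metric.isOpen_ball.measurableSet,
      measure_ball_eq _ r (baseFlag_mem_setW k d) hx]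
    exact hfin

theorem frameReal_pos (k d : ℕ) {b : ℝ} (hb : 0 < b) : 0 < frameReal k d b := by
  have hπ := Real.pi_pos
  have h1 : 0 < ∏ i ∈ Finset.range k,
      ((Real.pi / b) ^ ((i : ℝ) / 2) * radialMoment (k - i) (d + 1) b) := by
    refine Finset.prod_pos fun i hi => ?_
    have hr := radialMoment_pos (show 0 < k - i by have := Finset.mem_range.mp hi; omega) (d + 1) hb
    positivity
  have h2 := radialMoment_pos one_pos d hb
  exact mul_pos h1 (mul_pos (Real.rpow_pos_of_pos (div_pos hπ hb) _) (half_pos h2))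

/-- The Gaussian weight of a small ball around the base flag compared with its measure. The volume
of the ball in the chart is positive and finite, and cancels. -/
theorem toReal_measure_setW_bounds (k d : ℕ) {ε : ℝ} (hε : 0 < ε) (hε1 : ε < 1) :
    (μHE[k + d + k * d] (setW (k + (d + 1)) k)).toReal *
        ((1 - ε) * frameReal k d (Real.pi * (1 + ε) ^ 2)) ≤
      2 * ((1 + ε) ^ (k + d + k * d) * √2 ^ k) ∧
    2 * ((1 - ε) ^ (k + d + k * d) * √2 ^ k) ≤
      (μHE[k + d + k * d] (setW (k + (d + 1)) k)).toReal *
        ((1 + ε) * frameReal k d (Real.pi * (1 - ε) ^ 2)) := by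
  lift ε to NNReal using hε.le
  have hε' : 0 < ε := by exact_mod_cast hε
  have hε1' : ε < 1 := by exact_mod_cast hε1
  obtain ⟨U, hU, hUb⟩ := exists_nhds_euclideanHausdorffMeasure_flagChart k d hε' hε1'
  obtain ⟨r, hr, h1, h2, h3, h4, h5⟩ := exists_ball_baseFlag k d
    (Filter.inter_mem hU (eventually_norm_tilt k d hε))
  set B := Metric.ball (baseFlag k d) r
  have hBm : MeasurableSet B := Metric.isOpen_ball.measurableSet
  have hT : MeasurableSet (flagChart (k := k) (d := d) ⁻¹' B) :=
    (Metric.isOpen_ball.preimage (continuous_flagChart k d)).measurableSet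
  have hfin := euclideanHausdorffMeasure_setW_lt_top k d
  have : IsFiniteMeasure (μHE[k + d + k * d].restrict (setW (k + (d + 1)) k)) :=
    ⟨by rwa [Measure.restrict_apply_univ]⟩
  have hmul := measure_mul_flagWeight (show k < k + (d + 1) by omega) (k + d + k * d) r
    (baseFlag_mem_setW k d)
  rw [lintegral_gaussFrame, one_mul, Measure.restrict_apply hBm, Set.inter_comm, h3] at hmul
  obtain ⟨hle, hge⟩ := hUb _ fun q hq => (h2 hq).1
  have hup := flagWeight_le hε1.le (fun q hq => hq) hBm h1 hT fun q hq => (h2 hq).2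
  have hlow := flagWeight_ge (fun q hq => hq) hBm h1 hT fun q hq => (h2 hq).2
  have hb1 : 0 < Real.pi * (1 - (ε : ℝ)) ^ 2 :=
    mul_pos Real.pi_pos (pow_pos (by linarith) 2)
  have hb2 : 0 < Real.pi * (1 + (ε : ℝ)) ^ 2 :=
    mul_pos Real.pi_pos (pow_pos (by linarith) 2)
  rw [frameConst_eq k d hb1] at hup
  rw [frameConst_eq k d hb2] at hlow
  change _ ≤ _ * (ENNReal.ofReal (frameReal k d _) * _) at hup
  change _ * (ENNReal.ofReal (frameReal k d _) * _) ≤ _ at hlow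
  set v := volume (flagChart (k := k) (d := d) ⁻¹' B)
  set M := μHE[k + d + k * d] (setW (k + (d + 1)) k) with hM
  have hM' : M = ENNReal.ofReal M.toReal := (ENNReal.ofReal_toReal hfin.ne).symm
  have hp : ((1 + ε : NNReal) : ENNReal) = ENNReal.ofReal (1 + ε) := by
    rw [← ENNReal.ofReal_coe_nnreal]
    rfl
  have hm : ((1 - ε : NNReal) : ENNReal) = ENNReal.ofReal (1 - ε) := by
    rw [← ENNReal.ofReal_coe_nnreal, NNReal.coe_sub hε1'.le]
    rfl
  have hε0 : (0 : ℝ) ≤ 1 - ε := by linarith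
  have hε2 : (0 : ℝ) ≤ 1 + ε := by linarith
  have hF1 := (frameReal_pos k d hb1).le
  have hF2 := (frameReal_pos k d hb2).le
  have hMn : 0 ≤ M.toReal := ENNReal.toReal_nonneg
  rw [hp] at hle
  rw [hm] at hge
  constructor
  · have h6 : v * (M * (ENNReal.ofReal (1 - ε) *
        ENNReal.ofReal (frameReal k d (Real.pi * (1 + ε) ^ 2)))) ≤
        v * (2 * (ENNReal.ofReal (1 + ε) ^ (k + d + k * d) * ENNReal.ofReal (√2 ^ k))) := by
      calc _ = M * (ENNReal.ofReal (1 - ε) *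
            (ENNReal.ofReal (frameReal k d (Real.pi * (1 + ε) ^ 2)) * v)) := by ring
        _ ≤ M * flagWeight B := by gcongr
        _ ≤ 2 * (ENNReal.ofReal (1 + ε) ^ (k + d + k * d) * (ENNReal.ofReal (√2 ^ k) * v)) := by
          rw [hmul]
          gcongr
        _ = _ := by ring
    rw [ENNReal.mul_le_mul_iff_right h4 h5, hM', ← ENNReal.ofReal_mul hε0,
      ← ENNReal.ofReal_mul hMn, ← ENNReal.ofReal_pow hε2, ← ENNReal.ofReal_mul (by positivity),
      ← ENNReal.ofReal_ofNat, ← ENNReal.ofReal_mul (by positivity),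
      ENNReal.ofReal_le_ofReal_iff (by positivity)] at h6
    exact h6
  · have h6 : v * (2 * (ENNReal.ofReal (1 - ε) ^ (k + d + k * d) * ENNReal.ofReal (√2 ^ k))) ≤
        v * (M * (ENNReal.ofReal (1 + ε) *
        ENNReal.ofReal (frameReal k d (Real.pi * (1 - ε) ^ 2)))) := by
      calc _ = 2 * (ENNReal.ofReal (1 - ε) ^ (k + d + k * d) * (ENNReal.ofReal (√2 ^ k) * v)) := by
            ring
        _ ≤ M * flagWeight B := by
          rw [hmul]
          gcongr
        _ ≤ M * (ENNReal.ofReal (1 + ε) *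
            (ENNReal.ofReal (frameReal k d (Real.pi * (1 - ε) ^ 2)) * v)) := by gcongr
        _ = _ := by ring
    rw [ENNReal.mul_le_mul_iff_right h4 h5, hM', ← ENNReal.ofReal_mul hε2,
      ← ENNReal.ofReal_mul hMn, ← ENNReal.ofReal_pow hε0, ← ENNReal.ofReal_mul (by positivity),
      ← ENNReal.ofReal_ofNat, ← ENNReal.ofReal_mul (by positivity),
      ENNReal.ofReal_le_ofReal_iff (by positivity)] at h6
    exact h6

/-- The measure of `𝒲`, by letting `ε` tend to `0` in `toReal_measure_setW_bounds`. -/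
theorem toReal_measure_setW_mul (k d : ℕ) :
    (μHE[k + d + k * d] (setW (k + (d + 1)) k)).toReal * frameReal k d Real.pi = 2 * √2 ^ k := by
  set M := (μHE[k + d + k * d] (setW (k + (d + 1)) k)).toReal
  have hb : ∀ s : ℝ, Filter.Tendsto (fun ε : ℝ => frameReal k d (Real.pi * (1 + s * ε) ^ 2))
      (nhdsWithin 0 (Set.Ioi 0)) (nhds (frameReal k d Real.pi)) := by
    intro s
    refine (continuousAt_frameReal k d).tendsto.comp ?_
    have h : Continuous fun ε : ℝ => Real.pi * (1 + s * ε) ^ 2 := by fun_prop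
    have h2 := h.tendsto 0
    simp only [mul_zero, add_zero, one_pow, mul_one] at h2
    exact h2.mono_left nhdsWithin_le_nhds
  have hlin : ∀ (s : ℝ) (j : ℕ), Filter.Tendsto (fun ε : ℝ => (1 + s * ε) ^ j)
      (nhdsWithin 0 (Set.Ioi 0)) (nhds 1) := by
    intro s j
    have h : Continuous fun ε : ℝ => (1 + s * ε) ^ j := by fun_prop
    have h2 := h.tendsto 0
    simp only [mul_zero, add_zero, one_pow] at h2
    exact h2.mono_left nhdsWithin_le_nhds
  have hev : ∀ᶠ ε in nhdsWithin (0 : ℝ) (Set.Ioi 0), ε ∈ Set.Ioo (0 : ℝ) 1 :=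
    Ioo_mem_nhdsGT one_pos
  apply le_antisymm
  · have h1 : Filter.Tendsto (fun ε : ℝ => M * ((1 + (-1) * ε) ^ 1 *
        frameReal k d (Real.pi * (1 + 1 * ε) ^ 2))) (nhdsWithin 0 (Set.Ioi 0))
        (nhds (M * (1 * frameReal k d Real.pi))) := ((hlin _ _).mul (hb 1)).const_mul M
    have h2 : Filter.Tendsto (fun ε : ℝ => 2 * ((1 + 1 * ε) ^ (k + d + k * d) * √2 ^ k))
        (nhdsWithin 0 (Set.Ioi 0)) (nhds (2 * (1 * √2 ^ k))) :=
      ((hlin 1 _).mul_const _).const_mul 2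
    rw [one_mul] at h1 h2
    refine le_of_tendsto_of_tendsto h1 h2 ?_
    filter_upwards [hev] with ε hε
    simpa [sub_eq_add_neg] using (toReal_measure_setW_bounds k d hε.1 hε.2).1
  · have h1 : Filter.Tendsto (fun ε : ℝ => M * ((1 + 1 * ε) ^ 1 *
        frameReal k d (Real.pi * (1 + (-1) * ε) ^ 2))) (nhdsWithin 0 (Set.Ioi 0))
        (nhds (M * (1 * frameReal k d Real.pi))) := ((hlin _ _).mul (hb (-1))).const_mul M
    have h2 : Filter.Tendsto (fun ε : ℝ => 2 * ((1 + (-1) * ε) ^ (k + d + k * d) * √2 ^ k))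
        (nhdsWithin 0 (Set.Ioi 0)) (nhds (2 * (1 * √2 ^ k))) :=
      ((hlin (-1) _).mul_const _).const_mul 2
    rw [one_mul] at h1 h2
    refine le_of_tendsto_of_tendsto h2 h1 ?_
    filter_upwards [hev] with ε hε
    simpa [sub_eq_add_neg] using (toReal_measure_setW_bounds k d hε.1 hε.2).2

theorem dimH_of_euclideanHausdorffMeasure_ne_zero_ne_top {X : Type*} [EMetricSpace X]
    [MeasurableSpace X] [BorelSpace X] {s : Set X} {m : ℕ} (h0 : μHE[m] s ≠ 0)
    (h1 : μHE[m] s ≠ ⊤) : dimH s = m := by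
  rw [Measure.euclideanHausdorffMeasure_def, Measure.smul_apply, ENNReal.smul_def, smul_eq_mul]
    at h0 h1
  have h4 := Measure.addHaarScalarFactor_volume_hausdorffMeasure_ne_zero m
  refine dimH_of_hausdorffMeasure_ne_zero_ne_top (d := (m : NNReal)) (fun h => h0 ?_)
    (fun h => h1 ?_)
  · rw [NNReal.coe_natCast] at h
    rw [h, mul_zero]
  · rw [NNReal.coe_natCast] at h
    rw [h, ENNReal.mul_top (by exact_mod_cast h4)]

theorem dimH_setW (k d : ℕ) :
    dimH (setW (k + (d + 1)) k) = ((k + d + k * d : ℕ) : ENNReal) := by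
  have h1 := toReal_measure_setW_mul k d
  have h2 := euclideanHausdorffMeasure_setW_lt_top k d
  have h3 : μHE[k + d + k * d] (setW (k + (d + 1)) k) ≠ 0 := by
    intro h
    rw [h, ENNReal.toReal_zero, zero_mul] at h1
    have : (0 : ℝ) < 2 * √2 ^ k := by positivity
    linarith
  exact dimH_of_euclideanHausdorffMeasure_ne_zero_ne_top h3 h2.ne

/-! ### The integral -/

theorem stdTop_mem_unitSimple (k l : ℕ) : wedge (stdTop k l) ∈ unitSimple (k + l) k :=
  ⟨⟨1, stdTop k l, (one_smul ℝ _).symm⟩, norm_wedge_of_orthonormal (orthonormal_stdTop k l)⟩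

theorem radialMoment_pi (l s : ℕ) : radialMoment l s Real.pi =
    Real.Gamma (((l : ℝ) + s) / 2) / (Real.Gamma ((l : ℝ) / 2) * Real.pi ^ ((s : ℝ) / 2)) := by
  have h : Real.pi ^ (((l : ℝ) + s) / 2) = Real.pi ^ ((l : ℝ) / 2) * Real.pi ^ ((s : ℝ) / 2) := by
    rw [← Real.rpow_add Real.pi_pos]
    congr 1
    ring
  have h1 : Real.pi ^ ((l : ℝ) / 2) ≠ 0 := (Real.rpow_pos_of_pos Real.pi_pos _).ne'
  rw [radialMoment, h, mul_left_comm, mul_div_mul_left _ _ h1]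

theorem lintegral_norm_wedge (N j : ℕ) (hj : j ≤ N) :
    ∫⁻ v : Fin j → EucSpace N, gaussPi Real.pi v * ENNReal.ofReal ‖wedge v‖ =
      ENNReal.ofReal (∏ i ∈ Finset.range j, radialMoment (N - i) 1 Real.pi) := by
  have h := lintegral_norm_wedge_pow (N := N) j hj one_ne_zero Real.pi_pos
  simpa [div_self Real.pi_ne_zero] using h

/-- The average of the component along a fixed unit simple `k`-vector. -/
theorem lintegral_inner_wedge {k l : ℕ} {ν : KVec (k + l) k} (hν : ν ∈ unitSimple (k + l) k) :
    ∫⁻ v : Fin k → EucSpace (k + l), gaussPi Real.pi v * ENNReal.ofReal |inner ℝ ν (wedge v)| =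
      ENNReal.ofReal (∏ i ∈ Finset.range k, radialMoment (k - i) 1 Real.pi) := by
  have hm : Measurable fun v : Fin k → EucSpace (k + l) => gaussPi Real.pi v *
      ENNReal.ofReal |(inner ℝ (wedge (stdTop k l)) (wedge v) : ℝ)| := by
    have h1 : Continuous fun v : Fin k → EucSpace (k + l) =>
        |(inner ℝ (wedge (stdTop k l)) (wedge v) : ℝ)| :=
      (continuous_const.inner (continuous_wedge _ _)).abs
    exact (measurable_gaussPi _).mul h1.measurable.ennreal_ofReal
  have hdet : ∀ (X : Fin k → EucSpace k) (Y : Fin k → EucSpace l),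
      |(inner ℝ (wedge (stdTop k l)) (wedge fun i => joinEuc (X i) (Y i)) : ℝ)| = ‖wedge X‖ := by
    intro X Y
    rw [inner_wedge, ← abs_det_eq_norm_wedge, ← Matrix.det_transpose]
    congr 2
    ext i j
    simp [joinEuc_eq, inner_add_right]
  have hmX : Measurable fun X : Fin k → EucSpace k =>
      gaussPi Real.pi X * ENNReal.ofReal ‖wedge X‖ :=
    (measurable_gaussPi _).mul (continuous_wedge k k).norm.measurable.ennreal_ofReal
  rw [lintegral_inner_wedge_eq (stdTop_mem_unitSimple k l) hν, lintegral_pi_joinEuc hm]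
  simp_rw [hdet, gaussPi_joinEuc]
  have h2 : ∀ (X : Fin k → EucSpace k), ∫⁻ Y : Fin k → EucSpace l,
      gaussPi Real.pi X * gaussPi Real.pi Y * ENNReal.ofReal ‖wedge X‖ =
      gaussPi Real.pi X * ENNReal.ofReal ‖wedge X‖ := by
    intro X
    have h3 : ∀ Y : Fin k → EucSpace l,
        gaussPi Real.pi X * gaussPi Real.pi Y * ENNReal.ofReal ‖wedge X‖ =
        (gaussPi Real.pi X * ENNReal.ofReal ‖wedge X‖) * gaussPi Real.pi Y := fun Y => by ring
    simp_rw [h3]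
    rw [lintegral_const_mul _ (measurable_gaussPi _), lintegral_gaussPi, lintegral_gaussW_pi,
      one_pow, mul_one]
  simp_rw [h2]
  exact lintegral_norm_wedge k k le_rfl

theorem prod_range_sub_eq {M : Type*} [CommMonoid M] (f : ℕ → M) (k : ℕ) :
    ∏ i ∈ Finset.range k, f (k - i) = ∏ i ∈ Finset.range k, f (i + 1) := by
  rw [← Finset.prod_range_reflect (fun i => f (i + 1))]
  refine Finset.prod_congr rfl fun i hi => ?_
  have := Finset.mem_range.mp hi
  congr 1
  omega

theorem prod_radialMoment_one (a k : ℕ) (ha : 0 < a) :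
    ∏ i ∈ Finset.range k, radialMoment (a + k - 1 - i) 1 Real.pi =
      Real.Gamma (((a : ℝ) + k) / 2) / (Real.Gamma ((a : ℝ) / 2) * Real.pi ^ ((k : ℝ) / 2)) := by
  have hG : ∀ b : ℕ, 0 < b → Real.Gamma ((b : ℝ) / 2) ≠ 0 := fun b hb => by
    have : (0 : ℝ) < b := by exact_mod_cast hb
    exact (Real.Gamma_pos_of_pos (by positivity)).ne'
  have h1 : ∏ i ∈ Finset.range k, radialMoment (a + k - 1 - i) 1 Real.pi =
      ∏ i ∈ Finset.range k, radialMoment (a + i) 1 Real.pi := by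
    rw [← Finset.prod_range_reflect (fun i => radialMoment (a + i) 1 Real.pi)]
    refine Finset.prod_congr rfl fun i hi => ?_
    have := Finset.mem_range.mp hi
    congr 1
    omega
  rw [h1]
  clear h1
  induction k with
  | zero =>
    have := hG a ha
    simp [div_self this]
  | succ k ih =>
    have h2 := hG (a + k) (by omega)
    push_cast at h2
    have h3 : Real.pi ^ (((k + 1 : ℕ) : ℝ) / 2) = Real.pi ^ ((k : ℝ) / 2) * Real.pi ^ ((1 : ℝ) / 2) := by
      rw [← Real.rpow_add Real.pi_pos]
      congr 1
      push_cast
      ring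
    have h4 := hG a ha
    have h5 := (Real.rpow_pos_of_pos Real.pi_pos ((k : ℝ) / 2)).ne'
    have h6 := (Real.rpow_pos_of_pos Real.pi_pos ((1 : ℝ) / 2)).ne'
    rw [Finset.prod_range_succ, ih, radialMoment_pi, h3]
    push_cast
    rw [add_assoc (a : ℝ) k 1]
    field_simp

theorem frameReal_pi (k d : ℕ) : frameReal k d Real.pi =
    (∏ i ∈ Finset.range (k + 1), Real.Gamma ((i + d + 1 : ℝ) / 2)) /
      ((∏ i ∈ Finset.range k, Real.Gamma ((i + 1 : ℝ) / 2)) * 2 *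
        Real.pi ^ (((k : ℝ) + 1) * (d + 1) / 2)) := by
  have h1 : ∀ b s : ℝ, (Real.pi / Real.pi) ^ s * b = b := by
    intro b s
    rw [div_self Real.pi_ne_zero, Real.one_rpow, one_mul]
  have h2 : Real.pi ^ (((k : ℝ) + 1) * (d + 1) / 2) =
      (Real.pi ^ (((d : ℝ) + 1) / 2)) ^ k * (Real.pi ^ ((1 : ℝ) / 2) * Real.pi ^ ((d : ℝ) / 2)) := by
    rw [← Real.rpow_natCast, ← Real.rpow_mul Real.pi_pos.le, ← Real.rpow_add Real.pi_pos,
      ← Real.rpow_add Real.pi_pos]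
    congr 1
    ring
  simp only [frameReal, h1]
  rw [prod_range_sub_eq (fun i => radialMoment i (d + 1) Real.pi), radialMoment_pi]
  simp_rw [radialMoment_pi]
  rw [Finset.prod_div_distrib, Finset.prod_mul_distrib, Finset.prod_const, Finset.card_range, h2,
    Finset.prod_range_succ']
  have h3 : ∀ i : ℕ, Real.Gamma ((((i + 1 : ℕ) : ℝ) + ((d + 1 : ℕ) : ℝ)) / 2) =
      Real.Gamma ((((i + 1 : ℕ) : ℝ) + d + 1) / 2) := by
    intro i
    push_cast
    congr 2
    ring
  have h4 : Real.Gamma (((1 : ℕ) : ℝ) / 2) = Real.pi ^ ((1 : ℝ) / 2) := by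
    rw [Nat.cast_one, Real.Gamma_one_half_eq, Real.sqrt_eq_rpow]
  simp_rw [h3]
  rw [h4]
  push_cast
  rw [zero_add, add_comm (1 : ℝ) (d : ℝ)]
  have hG : ∏ i ∈ Finset.range k, Real.Gamma (((i : ℝ) + 1) / 2) ≠ 0 :=
    Finset.prod_ne_zero_iff.mpr fun i _ => (Real.Gamma_pos_of_pos (by positivity)).ne'
  have h5 := (Real.rpow_pos_of_pos Real.pi_pos ((d : ℝ) / 2)).ne'
  have h6 := (Real.rpow_pos_of_pos Real.pi_pos ((1 : ℝ) / 2)).ne'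
  have h7 := (Real.rpow_pos_of_pos Real.pi_pos (((d : ℝ) + 1) / 2)).ne'
  field_simp

/-- The integral of `|ν · ω|` over `𝒲`, from the measure of `𝒲` and the Gaussian averages: the
products of first moments telescope to quotients of Gamma values. -/
theorem setLIntegral_inner (k d : ℕ) {ν : KVec (k + (d + 1)) k}
    (hν : ν ∈ unitSimple (k + (d + 1)) k) :
    ∫⁻ p in setW (k + (d + 1)) k, ENNReal.ofReal |inner ℝ ν p.snd| ∂μHE[k + d + k * d] =
      ENNReal.ofReal (2 * √2 ^ k / frameReal k d Real.pi *
        (Real.Gamma (((k : ℝ) + 1) / 2) * Real.Gamma (((d : ℝ) + 2) / 2) /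
          (√Real.pi * Real.Gamma (((k : ℝ) + d + 2) / 2)))) := by
  have hfin := euclideanHausdorffMeasure_setW_lt_top k d
  have : IsFiniteMeasure (μHE[k + d + k * d].restrict (setW (k + (d + 1)) k)) :=
    ⟨by rwa [Measure.restrict_apply_univ]⟩
  have h1 := setLIntegral_inner_mul (k + d + k * d) hν
  have hM := toReal_measure_setW_mul k d
  have hF := frameReal_pos k d Real.pi_pos
  rw [← eq_div_iff hF.ne'] at hM
  have e1 := prod_radialMoment_one (d + 2) k (by omega)
  have e2 := prod_radialMoment_one 1 k one_pos
  have e3 : ∀ i, d + 2 + k - 1 - i = k + (d + 1) - i := fun i => by omega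
  have e4 : ∀ i, 1 + k - 1 - i = k - i := fun i => by omega
  simp_rw [e3] at e1
  simp_rw [e4] at e2
  rw [lintegral_norm_wedge _ _ (by omega), lintegral_inner_wedge hν, e1, e2,
    ← ENNReal.ofReal_toReal hfin.ne, hM, ← ENNReal.ofReal_mul (by positivity)] at h1
  have g1 : 0 < Real.Gamma ((((d + 2 : ℕ) : ℝ) + k) / 2) := Real.Gamma_pos_of_pos (by positivity)
  have g2 : 0 < Real.Gamma (((d + 2 : ℕ) : ℝ) / 2) := Real.Gamma_pos_of_pos (by positivity)
  have g3 := Real.rpow_pos_of_pos Real.pi_pos ((k : ℝ) / 2)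
  have g4 : 0 < Real.Gamma ((((d + 2 : ℕ) : ℝ) + k) / 2) /
      (Real.Gamma (((d + 2 : ℕ) : ℝ) / 2) * Real.pi ^ ((k : ℝ) / 2)) := by positivity
  refine (ENNReal.mul_left_inj (ENNReal.ofReal_pos.mpr g4).ne' ENNReal.ofReal_ne_top).mp
    ((mul_comm _ _).trans h1 |>.trans ?_)
  rw [← ENNReal.ofReal_mul' g4.le]
  congr 1
  have g5 : (((d + 2 : ℕ) : ℝ) + k) = (k : ℝ) + d + 2 := by
    push_cast
    ring
  rw [g5] at g1 ⊢
  rw [Nat.cast_one, Real.Gamma_one_half_eq, add_comm (1 : ℝ) (k : ℝ)]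
  push_cast at g2 ⊢
  field_simp

theorem prod_pi_pow (j : ℕ) :
    ∏ i ∈ Finset.range j, Real.pi ^ (i + 1) = Real.pi ^ ((j : ℝ) * (j + 1) / 2) := by
  induction j with
  | zero => simp
  | succ j ih =>
    rw [Finset.prod_range_succ, ih, ← Real.rpow_natCast, ← Real.rpow_add Real.pi_pos]
    congr 1
    push_cast
    ring

theorem prod_Icc_Gamma (k d : ℕ) :
    ∏ i ∈ Finset.Icc 1 (k + 1), Real.Gamma ((i : ℝ) / 2) /
        (Real.pi ^ i * Real.Gamma ((((k + (d + 1) : ℕ) : ℝ) - i + 1) / 2)) =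
      (∏ i ∈ Finset.range (k + 1), Real.Gamma ((i + 1 : ℝ) / 2)) /
        (Real.pi ^ (((k : ℝ) + 1) * (k + 2) / 2) *
          ∏ i ∈ Finset.range (k + 1), Real.Gamma ((i + d + 1 : ℝ) / 2)) := by
  have h0 : Finset.Icc 1 (k + 1) = Finset.Ico 1 (k + 2) := rfl
  have h1 : ∏ i ∈ Finset.range (k + 1), Real.Gamma ((((k + (d + 1) : ℕ) : ℝ) -
      ((1 + i : ℕ) : ℝ) + 1) / 2) = ∏ i ∈ Finset.range (k + 1), Real.Gamma ((i + d + 1 : ℝ) / 2) := by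
    rw [← Finset.prod_range_reflect]
    refine Finset.prod_congr rfl fun i hi => ?_
    have h2 : i ≤ k := Nat.lt_succ_iff.mp (Finset.mem_range.mp hi)
    have h3 : k + 1 - 1 - i = k - i := by omega
    rw [h3]
    push_cast [Nat.cast_sub h2]
    congr 2
    ring
  have h4 := prod_pi_pow (k + 1)
  rw [h0, Finset.prod_Ico_eq_prod_range, show k + 2 - 1 = k + 1 from rfl, Finset.prod_div_distrib,
    Finset.prod_mul_distrib, h1]
  simp_rw [add_comm 1]
  rw [h4]
  push_cast
  congr 3
  ring

theorem measure_mul_moments_eq (k d : ℕ) : 2 * √2 ^ k / frameReal k d Real.pi *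
        (Real.Gamma (((k : ℝ) + 1) / 2) * Real.Gamma (((d : ℝ) + 2) / 2) /
          (√Real.pi * Real.Gamma (((k : ℝ) + d + 2) / 2))) =
      (2 : ℝ) ^ (((k : ℝ) + 4) / 2) *
          Real.pi ^ ((((k + (d + 1) : ℕ) : ℝ) + 2) * ((k : ℝ) + 1) / 2) *
          Real.Gamma ((((k + (d + 1) : ℕ) : ℝ) - k + 1) / 2) /
        (√Real.pi * Real.Gamma ((((k + (d + 1) : ℕ) : ℝ) + 1) / 2)) *
      ∏ i ∈ Finset.Icc 1 (k + 1), Real.Gamma ((i : ℝ) / 2) /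
        (Real.pi ^ i * Real.Gamma ((((k + (d + 1) : ℕ) : ℝ) - i + 1) / 2)) := by
  have h1 : (2 : ℝ) ^ (((k : ℝ) + 4) / 2) = 4 * √2 ^ k := by
    rw [Real.sqrt_eq_rpow, ← Real.rpow_natCast, ← Real.rpow_mul two_pos.le, add_div,
      Real.rpow_add two_pos, show (4 : ℝ) / 2 = (2 : ℕ) by norm_num, Real.rpow_natCast, mul_comm]
    congr 1
    · norm_num
    · congr 1
      ring
  have h2 : Real.pi ^ ((((k + (d + 1) : ℕ) : ℝ) + 2) * ((k : ℝ) + 1) / 2) =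
      Real.pi ^ (((k : ℝ) + 1) * (d + 1) / 2) * Real.pi ^ (((k : ℝ) + 1) * (k + 2) / 2) := by
    rw [← Real.rpow_add Real.pi_pos]
    congr 1
    push_cast
    ring
  have h3 : (((k + (d + 1) : ℕ) : ℝ) - k + 1) = (d : ℝ) + 2 := by
    push_cast
    ring
  have h4 : (((k + (d + 1) : ℕ) : ℝ) + 1) = (k : ℝ) + d + 2 := by
    push_cast
    ring
  have g1 : ∏ i ∈ Finset.range k, Real.Gamma ((i + 1 : ℝ) / 2) ≠ 0 :=
    Finset.prod_ne_zero_iff.mpr fun i _ => (Real.Gamma_pos_of_pos (by positivity)).ne'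
  have g2 : ∏ i ∈ Finset.range (k + 1), Real.Gamma ((i + d + 1 : ℝ) / 2) ≠ 0 :=
    Finset.prod_ne_zero_iff.mpr fun i _ => (Real.Gamma_pos_of_pos (by positivity)).ne'
  have g3 := (Real.rpow_pos_of_pos Real.pi_pos (((k : ℝ) + 1) * (k + 2) / 2)).ne'
  have g4 := (Real.rpow_pos_of_pos Real.pi_pos (((k : ℝ) + 1) * (d + 1) / 2)).ne'
  have g5 : Real.Gamma (((k : ℝ) + d + 2) / 2) ≠ 0 :=
    (Real.Gamma_pos_of_pos (by positivity)).ne'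
  have g6 : √Real.pi ≠ 0 := (Real.sqrt_pos.mpr Real.pi_pos).ne'
  rw [prod_Icc_Gamma, frameReal_pi, h1, h2, h3, h4,
    Finset.prod_range_succ (fun i : ℕ => Real.Gamma ((i + 1 : ℝ) / 2))]
  field_simp
  ring

end

theorem lemma4p2 (n k : ℕ) (hk : k < n) (ν : KVec n k) (hν : ν ∈ unitSimple n k) (m : ℕ)
    (hm : m = (n - 1) + k * (n - k - 1)) :
    dimH (setW n k) = (m : ENNReal) ∧
    IntegrableOn (fun p : WithLp 2 (EucSpace n × KVec n k) => |inner ℝ ν p.snd|)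
      (setW n k) μHE[m] ∧
    ∫ p in setW n k, |inner ℝ ν p.snd| ∂μHE[m] =
      (2 : ℝ) ^ (((k : ℝ) + 4) / 2) * Real.pi ^ (((n : ℝ) + 2) * ((k : ℝ) + 1) / 2) *
          Real.Gamma (((n : ℝ) - k + 1) / 2) /
        (√Real.pi * Real.Gamma (((n : ℝ) + 1) / 2)) *
      ∏ i ∈ Finset.Icc 1 (k + 1),
        Real.Gamma ((i : ℝ) / 2) / (Real.pi ^ i * Real.Gamma (((n : ℝ) - i + 1) / 2)) := by
  obtain ⟨d, rfl⟩ : ∃ d, n = k + (d + 1) := ⟨n - k - 1, by omega⟩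
  obtain rfl : m = k + d + k * d := by
    have h1 : k + (d + 1) - k - 1 = d := by omega
    rw [hm, h1]
    omega
  have hI := setLIntegral_inner k d hν
  have := borelSpace_flagAmbient (k + (d + 1)) k
  have hcont : Continuous fun p : WithLp 2 (EucSpace (k + (d + 1)) × KVec (k + (d + 1)) k) =>
      |(inner ℝ ν p.snd : ℝ)| :=
    (continuous_const.inner (WithLp.continuous_snd 2 _ _)).abs
  have h0 : ∀ p : WithLp 2 (EucSpace (k + (d + 1)) × KVec (k + (d + 1)) k),
      0 ≤ |(inner ℝ ν p.snd : ℝ)| := fun p => abs_nonneg _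
  refine ⟨dimH_setW k d, ⟨hcont.measurable.aestronglyMeasurable, ?_⟩, ?_⟩
  · rw [hasFiniteIntegral_iff_ofReal (Filter.Eventually.of_forall h0), hI]
    exact ENNReal.ofReal_lt_top
  · rw [integral_eq_lintegral_of_nonneg_ae (Filter.Eventually.of_forall h0)
      hcont.measurable.aestronglyMeasurable, hI, ENNReal.toReal_ofReal, measure_mul_moments_eq]
    have h1 := frameReal_pos k d Real.pi_pos
    have h2 : 0 < Real.Gamma (((k : ℝ) + 1) / 2) := Real.Gamma_pos_of_pos (by positivity)
    have h3 : 0 < Real.Gamma (((d : ℝ) + 2) / 2) := Real.Gamma_pos_of_pos (by positivity)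
    have h4 : 0 < Real.Gamma (((k : ℝ) + d + 2) / 2) := Real.Gamma_pos_of_pos (by positivity)
    positivity
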